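/- \textbf{Conventions.} A metric space $X$ is \emph{tree-graded} with respect to a collection $\mathcal P$ of closed geodesic subsets (\emph{pieces}) covering $X$ if $X$ is complete and geodesic, two different pieces meet in at most one point, and every simple geodesic triangle is contained in one piece. Its \emph{transversal trees are trivial} if no two distinct points are joined by a path which meets each piece in at most one point. A space is \emph{homogeneous} if its isometry group acts transitively. A map $f$ is \emph{$k$-bilipschitz} if $k^{-1}d(x,y)\le d(f(x),f(y))\le k\,d(x,y)$ for all $x,y$. All spaces are non-empty. Let $\{(P_i,r_i)\}_{i\in I}$ be pairwise non-isometric complete homogeneous geodesic pointed metric spaces, none of them a single point. A \emph{P-geodesic} $\Gamma$ with range $\{(P_i,r_i)\}$ consists of some $l>0$, a family $\{I_a=[p_a,q_a)\}_{a\in A}$ of non-trivial pairwise disjoint intervals in $[0,l]$ with union dense in $[0,l]$, and, for each $a$, an index $h(a)\in I$ and a point $\Gamma(a)\in P_{h(a)}$ with $d(r_{h(a)},\Gamma(a))=q_a-p_a$. Two P-geodesics \emph{have the same initial P-pattern} if for some $x>0$ they have the same intervals contained in $[0,x]$, with the same values on them, and, if $x$ is an interior point of an interval of the first one, then $x$ is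 an interior point of an interval of the second one with the same index. Let $\mathcal W$ be the set of classes of P-geodesics for this equivalence relation. Let $X$ be tree-graded with trivial transversal trees and pieces isometric to some of the $P_i$. A \emph{choice of charts} assigns to each piece $A$ and each $x\in A$ an isometry of $A$ onto some $P_i$ with $x\mapsto r_i$. A geodesic $\gamma:[0,l]\to X$ parametrized by arc length, $l>0$, \emph{induces} a P-geodesic: its intervals $[p_a,q_a)$ are the maximal closed-open intervals mapped by $\gamma$ into one piece $A_a$, and its value on $[p_a,q_a)$ is the image of $\gamma(q_a)$ under the chart of $A_a$ at $\gamma(p_a)$. Two such geodesics starting at $p$ have the same germ if for some $x>0$ in both domains their values at $x$ lie in a common piece. The class in $\mathcal W$ of the induced P-geodesic depends only on the germ, and $H_{X,p}(w)$ denotes the cardinality of the set of germs at $p$ with class $w\in\mathcal W$. Let $\{Q_j\}_{j\in J}$ be complete homogeneous geodesic metric spaces, $s_j\in Q_j$, let $k\ge 1$, and let $f_j:Q_j\to P_{i(j)}$ be $k$-bilipschitz bijections with $f_j(s_j)=r_{i(j)}$, where $j\mapsto i(j)$ is onto $I$. Let $\mathcal X$ be the set of classes of P-geodesics with range $\{(Q_j,s_j)\}$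 with the same initial P-pattern. For such a P-geodesic $\Gamma$ put $c_a=d(r_{i(h(a))},f_{h(a)}(\Gamma(a)))$, and for $t\in[0,l]$ not in the interior of any $I_a$ put $$s_\Gamma(t)=\sum_{q_b\le t}c_b+\lambda\Big([0,t]\setminus\bigcup_{q_b\le t}I_b\Big),$$ where $\lambda$ is Lebesgue measure. The P-geodesic with intervals $[s_\Gamma(p_a),s_\Gamma(q_a))$ in $[0,s_\Gamma(l)]$ and values $f_{h(a)}(\Gamma(a))$ depends, up to having the same initial P-pattern, only on the class of $\Gamma$; this defines $\psi:\mathcal X\to\mathcal W$. \textbf{Theorem.} Let $\alpha$ assign to each $w\in\mathcal W$ an infinite cardinal $\alpha(w)$, and let $\mathbb F_\alpha$ be a homogeneous tree-graded space with trivial transversal trees, with pieces isometric to some of the $P_i$, such that for each $p\in\mathbb F_\alpha$ there is a choice of charts with $H_{\mathbb F_\alpha,p}(w)=\alpha(w)$ for all $w\in\mathcal W$. Let $\mathbb F$ be a homogeneous tree-graded space with trivial transversal trees, each of whose pieces is isometric to one of the $Q_j$. \begin{enumerate} \item If for each $p\in\mathbb F$ there is a choice of charts (with values in the $(Q_j,s_j)$)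 such that $$\sum_{x'\in\mathcal X,\ \psi(x')=\psi(x)}H_{\mathbb F,p}(x')\le\alpha(\psi(x))\quad\text{for each }x\in\mathcal X,$$ then there is a $k$-bilipschitz embedding of $\mathbb F$ into $\mathbb F_\alpha$. \item If for each $p\in\mathbb F$ there is a choice of charts such that equality holds for each $x\in\mathcal X$, then there is a $k$-bilipschitz bijection from $\mathbb F$ onto $\mathbb F_\alpha$. \end{enumerate} -/

import Mathlib

open Set MeasureTheory

universe u

noncomputable section

namespace TreeGr

/-! ### Geodesics, homogeneity, bilipschitz maps -/

/-- `γ` restricted to `[0, l]` is a geodesic parametrized by arc length (values of `γ` outside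
`[0, l]` are irrelevant). -/
def IsGeodesicOn {X : Type u} [MetricSpace X] (γ : ℝ → X) (l : ℝ) : Prop :=
  0 ≤ l ∧ ∀ t ∈ Icc 0 l, ∀ t' ∈ Icc 0 l, dist (γ t) (γ t') = |t - t'|

/-- `S` is (the image of) a geodesic from `x` to `y`. -/
def IsGeodesicSegment {X : Type u} [MetricSpace X] (S : Set X) (x y : X) : Prop :=
  ∃ (γ : ℝ → X) (l : ℝ), IsGeodesicOn γ l ∧ γ 0 = x ∧ γ l = y ∧ S = γ '' Icc 0 l

/-- A geodesic subset: any two of its points are joined by a geodesic contained in it. -/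
def IsGeodesicSet {X : Type u} [MetricSpace X] (A : Set X) : Prop :=
  ∀ x ∈ A, ∀ y ∈ A, ∃ S ⊆ A, IsGeodesicSegment S x y

/-- Homogeneous: the isometry group acts transitively. -/
def IsHomogeneous (X : Type u) [MetricSpace X] : Prop :=
  ∀ x y : X, ∃ e : X ≃ᵢ X, e x = y

/-- `k`-bilipschitz maps. -/
def IsBilipschitz {X Y : Type u} [MetricSpace X] [MetricSpace Y] (k : ℝ) (f : X → Y) : Prop :=
  ∀ x y, k⁻¹ * dist x y ≤ dist (f x) (f y) ∧ dist (f x) (f y) ≤ k * dist x y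

/-! ### Tree-graded spaces -/

/-- `X` is tree-graded with respect to the collection `𝓟` of pieces. -/
structure IsTreeGraded {X : Type u} [MetricSpace X] (𝓟 : Set (Set X)) : Prop where
  complete : CompleteSpace X
  geodesic : IsGeodesicSet (univ : Set X)
  piece_closed : ∀ P ∈ 𝓟, IsClosed P
  piece_geodesic : ∀ P ∈ 𝓟, IsGeodesicSet P
  cover : ⋃₀ 𝓟 = univ
  /-- Two different pieces meet in at most one point. -/
  inter_subsingleton : ∀ P ∈ 𝓟, ∀ Q ∈ 𝓟, P ≠ Q → (P ∩ Q).Subsingleton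
  /-- Each simple geodesic triangle (two sides meet only in their common vertex) is contained in
  one piece. -/
  triangle : ∀ (a b c : X) (A B C : Set X), IsGeodesicSegment A a b → IsGeodesicSegment B b c →
    IsGeodesicSegment C c a → A ∩ B = {b} → B ∩ C = {c} → C ∩ A = {a} →
    ∃ P ∈ 𝓟, A ∪ B ∪ C ⊆ P

/-- The transversal tree `T_x`: the points which can be joined to `x` by a path that meets each
piece in at most one point. -/
def transversalTree {X : Type u} [MetricSpace X] (𝓟 : Set (Set X)) (x : X) : Set X :=
  {y | ∃ σ : Path x y, ∀ P ∈ 𝓟, (range σ ∩ P).Subsingleton}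

/-- All transversal trees are trivial. -/
def TrivialTransversalTrees {X : Type u} [MetricSpace X] (𝓟 : Set (Set X)) : Prop :=
  ∀ x : X, transversalTree 𝓟 x = {x}

/-! ### P-geodesics and their initial patterns -/

/-- A P-geodesic with range the family of pointed metric spaces `(P i, r i)`. The pair `a = (p, q)`
stands for the closed-open interval `[p, q)`; `ivl` is the associated almost filling of `[0, len]`
and `pt a` is the constant value of the P-geodesic on the interval `a ∈ ivl` (the values of `pt`
elsewhere are irrelevant). The index selector is `a ↦ (pt a).1`. -/
structure PGeodesic {I : Type u} {P : I → Type u} [∀ i, MetricSpace (P i)] (r : ∀ i, P i) where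
  len : ℝ
  len_pos : 0 < len
  ivl : Set (ℝ × ℝ)
  nonneg : ∀ a ∈ ivl, 0 ≤ a.1
  lt : ∀ a ∈ ivl, a.1 < a.2
  le_len : ∀ a ∈ ivl, a.2 ≤ len
  disj : ∀ a ∈ ivl, ∀ b ∈ ivl, a ≠ b → Disjoint (Ico a.1 a.2) (Ico b.1 b.2)
  dense : Icc 0 len ⊆ closure (⋃ a ∈ ivl, Ico a.1 a.2)
  pt : ℝ × ℝ → Σ i, P i
  dist_pt : ∀ a ∈ ivl, dist (r (pt a).1) (pt a).2 = a.2 - a.1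

/-- `Γ` and `Γ'` have the same P-pattern until `x`. -/
def SamePatternUntil {I : Type u} {P : I → Type u} [∀ i, MetricSpace (P i)] {r : ∀ i, P i}
    (Γ Γ' : PGeodesic r) (x : ℝ) : Prop :=
  {a ∈ Γ.ivl | a.2 ≤ x} = {a ∈ Γ'.ivl | a.2 ≤ x} ∧
  (∀ a ∈ Γ.ivl, a.2 ≤ x → Γ.pt a = Γ'.pt a) ∧
  (∀ a ∈ Γ.ivl, a.1 < x → x < a.2 →
    ∃ a' ∈ Γ'.ivl, a'.1 < x ∧ x < a'.2 ∧ (Γ.pt a).1 = (Γ'.pt a').1)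

/-- `Γ` and `Γ'` have the same initial P-pattern. -/
def SameInitialPattern {I : Type u} {P : I → Type u} [∀ i, MetricSpace (P i)] {r : ∀ i, P i}
    (Γ Γ' : PGeodesic r) : Prop :=
  ∃ x > 0, SamePatternUntil Γ Γ' x

/-- The set of equivalence classes of P-geodesics with range `(P i, r i)` with the same initial
P-pattern. -/
def PatternClass {I : Type u} {P : I → Type u} [∀ i, MetricSpace (P i)] (r : ∀ i, P i) : Type u :=
  Quot (SameInitialPattern (r := r))

/-! ### Geodesic germs in a tree-graded space, charts, and the germ counts -/

/-- Non-trivial geodesics starting from `p`, parametrized by arc length. -/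
structure GeodesicFrom {X : Type u} [MetricSpace X] (p : X) where
  len : ℝ
  len_pos : 0 < len
  toFun : ℝ → X
  start : toFun 0 = p
  isGeodesic : IsGeodesicOn toFun len

/-- Two geodesics starting from `p` have the same initial pattern if, at some time `x > 0`, they
lie in a common piece. -/
def SameGerm {X : Type u} [MetricSpace X] (𝓟 : Set (Set X)) {p : X} (γ γ' : GeodesicFrom p) :
    Prop :=
  ∃ x, 0 < x ∧ x ≤ γ.len ∧ x ≤ γ'.len ∧ ∃ P ∈ 𝓟, γ.toFun x ∈ P ∧ γ'.toFun x ∈ P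

/-- The quotient of the set of geodesics starting from `p` by the relation of having the same
initial pattern. -/
def Germ {X : Type u} [MetricSpace X] (𝓟 : Set (Set X)) (p : X) : Type u :=
  Quot (SameGerm 𝓟 (p := p))

/-- A choice of charts: for each piece `A` and each point `x ∈ A`, an isometry between `A` and some
`P i` which sends `x` to `r i`. -/
structure Charts {X : Type u} [MetricSpace X] (𝓟 : Set (Set X))
    {I : Type u} {P : I → Type u} [∀ i, MetricSpace (P i)] (r : ∀ i, P i) where
  idx : ∀ A ∈ 𝓟, A → I
  iso : ∀ (A : Set X) (hA : A ∈ 𝓟) (x : A), A ≃ᵢ P (idx A hA x)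
  iso_base : ∀ (A : Set X) (hA : A ∈ 𝓟) (x : A), iso A hA x x = r (idx A hA x)

/-- The closed-open interval `[a.1, a.2)` is a non-trivial subinterval of `[0, l]` mapped by `γ`
into one piece. -/
def InOnePiece {X : Type u} [MetricSpace X] (𝓟 : Set (Set X)) (γ : ℝ → X) (l : ℝ) (a : ℝ × ℝ) :
    Prop :=
  0 ≤ a.1 ∧ a.1 < a.2 ∧ a.2 ≤ l ∧ ∃ A ∈ 𝓟, ∀ t ∈ Ico a.1 a.2, γ t ∈ A

/-- `Γ` is the P-geodesic induced by the geodesic `γ`: its intervals are the maximal closed-open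
intervals which `γ` maps into one piece, and its value on such an interval is the image of the exit
point under the chart of the piece at the entrance point. -/
def Induces {X : Type u} [MetricSpace X] {𝓟 : Set (Set X)}
    {I : Type u} {P : I → Type u} [∀ i, MetricSpace (P i)] {r : ∀ i, P i} (c : Charts 𝓟 r)
    {p : X} (γ : GeodesicFrom p) (Γ : PGeodesic r) : Prop :=
  Γ.len = γ.len ∧
  Γ.ivl = {a | InOnePiece 𝓟 γ.toFun γ.len a ∧
    ∀ b, InOnePiece 𝓟 γ.toFun γ.len b → Ico a.1 a.2 ⊆ Ico b.1 b.2 → b = a} ∧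
  ∀ a ∈ Γ.ivl, ∃ (A : Set X) (hA : A ∈ 𝓟) (hx : γ.toFun a.1 ∈ A) (hy : γ.toFun a.2 ∈ A),
    (∀ t ∈ Ico a.1 a.2, γ.toFun t ∈ A) ∧
    Γ.pt a = ⟨c.idx A hA ⟨γ.toFun a.1, hx⟩, c.iso A hA ⟨γ.toFun a.1, hx⟩ ⟨γ.toFun a.2, hy⟩⟩

/-- The number `H_{X,p}(w)` of germs of geodesics at `p` whose induced P-geodesic has initial
P-pattern `w`, i.e. the cardinality of the fibre over `w` of the map from germs to pattern classes
sending the germ of `γ` to the class of the P-geodesic induced by `γ`. -/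
def germCount {X : Type u} [MetricSpace X] {𝓟 : Set (Set X)}
    {I : Type u} {P : I → Type u} [∀ i, MetricSpace (P i)] {r : ∀ i, P i} (c : Charts 𝓟 r)
    (p : X) (w : PatternClass r) : Cardinal.{u} :=
  Cardinal.mk {y : Germ 𝓟 p // ∃ (γ : GeodesicFrom p) (Γ : PGeodesic r),
    y = Quot.mk _ γ ∧ Induces c γ Γ ∧ w = Quot.mk _ Γ}

/-! ### Replacing the model spaces by bilipschitz equivalent ones -/

/-- A family `f_j : Q_j → P_{i(j)}` of `k`-bilipschitz equivalences which preserve base points. -/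
structure BilipFamily {J : Type u} {Q : J → Type u} [∀ j, MetricSpace (Q j)] (s : ∀ j, Q j)
    {I : Type u} {P : I → Type u} [∀ i, MetricSpace (P i)] (r : ∀ i, P i) (k : ℝ) where
  idx : J → I
  map : ∀ j, Q j ≃ P (idx j)
  map_base : ∀ j, map j (s j) = r (idx j)
  one_le : 1 ≤ k
  bilip : ∀ j, IsBilipschitz k (map j)

section Psi

variable {J : Type u} {Q : J → Type u} [∀ j, MetricSpace (Q j)] {s : ∀ j, Q j}
  {I : Type u} {P : I → Type u} [∀ i, MetricSpace (P i)] {r : ∀ i, P i} {k : ℝ}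

/-- The image of a point of the disjoint union of the `Q j` in that of the `P i`. -/
def BilipFamily.push (f : BilipFamily s r k) (z : Σ j, Q j) : Σ i, P i :=
  ⟨f.idx z.1, f.map z.1 z.2⟩

/-- The length `d(r_{i(j)}, f_j(z))` of the interval that replaces one with value `z ∈ Q_j`. -/
def BilipFamily.newLen (f : BilipFamily s r k) (z : Σ j, Q j) : ℝ :=
  dist (r (f.idx z.1)) (f.map z.1 z.2)

/-- The stretching function `s_Γ`, at those points `t` which do not lie in the interior of an
interval of `Γ`: the sum of the new lengths of the intervals to the left of `t` plus the Lebesgue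
measure of what these leave uncovered in `[0, t]`. -/
def stretch (f : BilipFamily s r k) (Γ : PGeodesic s) (t : ℝ) : ℝ :=
  (∑' b : ℝ × ℝ, indicator {b ∈ Γ.ivl | b.2 ≤ t} (fun b => f.newLen (Γ.pt b)) b) +
    volume.real (Icc 0 t \ ⋃ b ∈ {b ∈ Γ.ivl | b.2 ≤ t}, Ico b.1 b.2)

/-- Length of `[b.1, b.2) ∩ [0, t]`. -/
def cutLen (b : ℝ × ℝ) (t : ℝ) : ℝ := max 0 (min b.2 t - b.1)

/-- Measure of the part of `[0, t]` outside the intervals of `Γ`. -/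
def gapLen (Γ : PGeodesic s) (t : ℝ) : ℝ := volume.real (Icc 0 t \ ⋃ b ∈ Γ.ivl, Ico b.1 b.2)

/-- The stretching function `s_Γ` at all points: linear on each interval of `Γ`. -/
def stretchAll (f : BilipFamily s r k) (Γ : PGeodesic s) (t : ℝ) : ℝ :=
  (∑' b : ℝ × ℝ, indicator Γ.ivl
    (fun b => f.newLen (Γ.pt b) / (b.2 - b.1) * cutLen b t) b) + gapLen Γ t


theorem PGeodesic.order (Γ : PGeodesic s) {a b : ℝ × ℝ} (ha : a ∈ Γ.ivl) (hb : b ∈ Γ.ivl)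
    (hab : a ≠ b) : a.2 ≤ b.1 ∨ b.2 ≤ a.1 := by
  have h := Ico_disjoint_Ico.1 (Γ.disj a ha b hb hab)
  have h1 := Γ.lt a ha
  have h2 := Γ.lt b hb
  rcases min_le_iff.1 h with h | h <;> rcases le_max_iff.1 h with h | h
  · linarith
  · exact Or.inl h
  · exact Or.inr h
  · linarith

theorem PGeodesic.countable (Γ : PGeodesic s) : Γ.ivl.Countable := by
  have h : (Γ.ivl).PairwiseDisjoint (fun a : ℝ × ℝ => Ioo a.1 a.2) := by
    intro a ha b hb hab
    exact (Γ.disj a ha b hb hab).mono Ioo_subset_Ico_self Ioo_subset_Ico_self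
  exact h.countable_of_isOpen (fun a _ => isOpen_Ioo) (fun a ha => nonempty_Ioo.2 (Γ.lt a ha))

theorem BilipFamily.newLen_bounds (f : BilipFamily s r k) (Γ : PGeodesic s) {a : ℝ × ℝ}
    (ha : a ∈ Γ.ivl) : k⁻¹ * (a.2 - a.1) ≤ f.newLen (Γ.pt a) ∧
      f.newLen (Γ.pt a) ≤ k * (a.2 - a.1) := by
  have h := f.bilip (Γ.pt a).1 (s (Γ.pt a).1) (Γ.pt a).2
  rw [f.map_base, Γ.dist_pt a ha] at h
  exact h

theorem BilipFamily.newLen_pos (f : BilipFamily s r k) (Γ : PGeodesic s) {a : ℝ × ℝ}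
    (ha : a ∈ Γ.ivl) : 0 < f.newLen (Γ.pt a) :=
  lt_of_lt_of_le (mul_pos (inv_pos.2 (by linarith [f.one_le])) (by linarith [Γ.lt a ha]))
    (f.newLen_bounds Γ ha).1

theorem cutLen_mono (b : ℝ × ℝ) : Monotone (cutLen b) := by
  intro x t h
  unfold cutLen
  gcongr

theorem volume_Ico_inter (b : ℝ × ℝ) (hb : 0 ≤ b.1) (t : ℝ) :
    volume (Icc 0 t ∩ Ico b.1 b.2) = ENNReal.ofReal (cutLen b t) := by
  apply le_antisymm
  · calc volume (Icc 0 t ∩ Ico b.1 b.2) ≤ volume (Icc b.1 (min b.2 t)) := by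
          apply measure_mono
          rintro y ⟨⟨_, h2⟩, h3, h4⟩
          exact ⟨h3, le_min h4.le h2⟩
      _ = ENNReal.ofReal (min b.2 t - b.1) := Real.volume_Icc
      _ ≤ _ := ENNReal.ofReal_le_ofReal (le_max_right _ _)
  · calc ENNReal.ofReal (cutLen b t) = ENNReal.ofReal (min b.2 t - b.1) := by
          unfold cutLen
          rcases le_total 0 (min b.2 t - b.1) with h | h
          · rw [max_eq_right h]
          · rw [max_eq_left h, ENNReal.ofReal_of_nonpos h, ENNReal.ofReal_zero]
      _ = volume (Ioo b.1 (min b.2 t)) := Real.volume_Ioo.symm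
      _ ≤ _ := by
          apply measure_mono
          rintro y ⟨h1, h2⟩
          exact ⟨⟨by linarith, (lt_min_iff.1 h2).2.le⟩, h1.le, (lt_min_iff.1 h2).1⟩

theorem hasSum_cutLen (Γ : PGeodesic s) {t : ℝ} (ht : 0 ≤ t) :
    HasSum (indicator Γ.ivl (fun b => cutLen b t)) (t - gapLen Γ t) := by
  have hm : MeasurableSet (⋃ b ∈ Γ.ivl, Ico b.1 b.2 : Set ℝ) :=
    MeasurableSet.biUnion Γ.countable (fun b _ => measurableSet_Ico)
  have hc : Countable Γ.ivl := Γ.countable.to_subtype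
  have h1 : volume (Icc 0 t ∩ ⋃ b ∈ Γ.ivl, Ico b.1 b.2)
      = ∑' b : Γ.ivl, ENNReal.ofReal (cutLen b t) := by
    rw [biUnion_eq_iUnion, inter_iUnion, measure_iUnion]
    · exact tsum_congr fun b => volume_Ico_inter b (Γ.nonneg b b.2) t
    · intro a b hab
      exact (Γ.disj a a.2 b b.2 (fun h => hab (Subtype.ext h))).mono inter_subset_right
        inter_subset_right
    · exact fun b => measurableSet_Icc.inter measurableSet_Ico
  have hfin : volume (Icc 0 t ∩ ⋃ b ∈ Γ.ivl, Ico b.1 b.2) ≠ ⊤ :=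
    ne_top_of_le_ne_top (by simp) (measure_mono inter_subset_left)
  have h2 := ENNReal.hasSum_toReal (h1 ▸ hfin)
  rw [← ENNReal.tsum_toReal_eq (fun _ => ENNReal.ofReal_ne_top), ← h1] at h2
  have h3 := measureReal_inter_add_sdiff (μ := volume) (s := Icc 0 t) hm
    (by rw [Real.volume_Icc]; exact ENNReal.ofReal_ne_top)
  rw [Real.volume_real_Icc_of_le ht] at h3
  have h4 : (volume (Icc 0 t ∩ ⋃ b ∈ Γ.ivl, Ico b.1 b.2)).toReal = t - gapLen Γ t := by
    have : volume.real (Icc 0 t ∩ ⋃ b ∈ Γ.ivl, Ico b.1 b.2) = t - gapLen Γ t := by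
      unfold gapLen; linarith
    exact this
  rw [h4] at h2
  rw [← hasSum_subtype_iff_indicator]
  convert h2 using 2 with b
  exact (ENNReal.toReal_ofReal (le_max_left _ _)).symm

theorem gapLen_mono (Γ : PGeodesic s) : Monotone (gapLen Γ) := by
  intro x t h
  unfold gapLen
  apply measureReal_mono
  · exact sdiff_subset_sdiff_left (Icc_subset_Icc_right h)
  · exact ne_top_of_le_ne_top (by simp) (measure_mono sdiff_subset)

theorem hasSum_stretchAll (f : BilipFamily s r k) (Γ : PGeodesic s) {t : ℝ} (ht : 0 ≤ t) :
    HasSum (indicator Γ.ivl (fun b => f.newLen (Γ.pt b) / (b.2 - b.1) * cutLen b t))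
      (stretchAll f Γ t - gapLen Γ t) := by
  have : Summable (indicator Γ.ivl
      (fun b => f.newLen (Γ.pt b) / (b.2 - b.1) * cutLen b t)) := by
    refine Summable.of_nonneg_of_le (fun b => ?_) (fun b => ?_)
      ((hasSum_cutLen Γ ht).summable.mul_left k)
    · refine indicator_nonneg (fun b hb => ?_) b
      exact mul_nonneg (div_nonneg (f.newLen_pos Γ hb).le (by linarith [Γ.lt b hb]))
        (le_max_left _ _)
    · by_cases hb : b ∈ Γ.ivl
      · rw [indicator_of_mem hb, indicator_of_mem hb]
        refine mul_le_mul_of_nonneg_right ?_ (le_max_left _ _)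
        rw [div_le_iff₀ (by linarith [Γ.lt b hb])]
        exact (f.newLen_bounds Γ hb).2
      · simp [indicator_of_notMem hb]
  have h := this.hasSum
  convert h using 1
  unfold stretchAll
  ring

theorem stretchAll_bounds (f : BilipFamily s r k) (Γ : PGeodesic s) {x t : ℝ} (hx : 0 ≤ x)
    (hxt : x ≤ t) : k⁻¹ * (t - x) ≤ stretchAll f Γ t - stretchAll f Γ x ∧
      stretchAll f Γ t - stretchAll f Γ x ≤ k * (t - x) := by
  have ht := hx.trans hxt
  have hk := f.one_le
  have hk' : k⁻¹ ≤ 1 := inv_le_one_of_one_le₀ hk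
  have h1 := (hasSum_cutLen Γ ht).sub (hasSum_cutLen Γ hx)
  have h2 := (hasSum_stretchAll f Γ ht).sub (hasSum_stretchAll f Γ hx)
  have hg := gapLen_mono Γ hxt
  have lo := hasSum_le (fun b => ?_) (h1.mul_left k⁻¹) h2
  have hi := hasSum_le (fun b => ?_) h2 (h1.mul_left k)
  · constructor <;> nlinarith
  all_goals
    by_cases hb : b ∈ Γ.ivl
    · simp only [indicator_of_mem hb]
      rw [← mul_sub]
      have := cutLen_mono b hxt
      refine mul_le_mul_of_nonneg_right ?_ (by linarith)
      have hl : 0 < b.2 - b.1 := by linarith [Γ.lt b hb]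
      first
        | (rw [div_le_iff₀ hl]; exact (f.newLen_bounds Γ hb).2)
        | (rw [le_div_iff₀ hl]; exact (f.newLen_bounds Γ hb).1)
    · simp [indicator_of_notMem hb]

theorem stretchAll_lt (f : BilipFamily s r k) (Γ : PGeodesic s) {x t : ℝ} (hx : 0 ≤ x)
    (hxt : x < t) : stretchAll f Γ x < stretchAll f Γ t := by
  have h := (stretchAll_bounds f Γ hx hxt.le).1
  have : 0 < k⁻¹ * (t - x) := mul_pos (inv_pos.2 (by linarith [f.one_le])) (by linarith)
  linarith

theorem stretchAll_lt_iff (f : BilipFamily s r k) (Γ : PGeodesic s) {x t : ℝ} (hx : 0 ≤ x)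
    (ht : 0 ≤ t) : stretchAll f Γ x < stretchAll f Γ t ↔ x < t := by
  refine ⟨fun h => ?_, stretchAll_lt f Γ hx⟩
  by_contra h'
  rcases (not_lt.1 h').lt_or_eq with h2 | h2
  · exact lt_asymm h (stretchAll_lt f Γ ht h2)
  · rw [h2] at h; exact lt_irrefl _ h

theorem stretchAll_le_iff (f : BilipFamily s r k) (Γ : PGeodesic s) {x t : ℝ} (hx : 0 ≤ x)
    (ht : 0 ≤ t) : stretchAll f Γ x ≤ stretchAll f Γ t ↔ x ≤ t := by
  rw [← not_lt, ← not_lt, stretchAll_lt_iff f Γ ht hx]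

theorem gapLen_zero (Γ : PGeodesic s) : gapLen Γ 0 = 0 := by
  have : gapLen Γ 0 ≤ volume.real (Icc (0 : ℝ) 0) := by
    unfold gapLen
    exact measureReal_mono sdiff_subset (by simp)
  rw [Real.volume_real_Icc_of_le le_rfl, sub_self] at this
  exact le_antisymm this measureReal_nonneg

theorem stretchAll_zero (f : BilipFamily s r k) (Γ : PGeodesic s) : stretchAll f Γ 0 = 0 := by
  unfold stretchAll
  rw [gapLen_zero, add_zero]
  convert tsum_zero with b
  by_cases hb : b ∈ Γ.ivl
  · rw [indicator_of_mem hb]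
    have : cutLen b 0 = 0 := by
      unfold cutLen
      refine max_eq_left ?_
      have := min_le_right b.2 0
      have := Γ.nonneg b hb
      linarith
    rw [this, mul_zero]
  · rw [indicator_of_notMem hb]

theorem stretchAll_continuousOn (f : BilipFamily s r k) (Γ : PGeodesic s) :
    ContinuousOn (stretchAll f Γ) (Icc 0 Γ.len) := by
  have hk := f.one_le
  have : LipschitzOnWith (Real.toNNReal k) (stretchAll f Γ) (Icc 0 Γ.len) := by
    refine LipschitzOnWith.of_dist_le_mul fun x hx t ht => ?_
    rw [Real.coe_toNNReal k (by linarith)]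
    have key : ∀ x t, 0 ≤ x → x ≤ t →
        dist (stretchAll f Γ x) (stretchAll f Γ t) ≤ k * dist x t := by
      intro x t hx hxt
      have h := stretchAll_bounds f Γ hx hxt
      have h0 : 0 ≤ k⁻¹ * (t - x) := mul_nonneg (inv_nonneg.2 (by linarith)) (by linarith)
      rw [dist_comm, dist_comm x, Real.dist_eq, Real.dist_eq, abs_of_nonneg (h0.trans h.1),
        abs_of_nonneg (sub_nonneg.2 hxt)]
      exact h.2
    rcases le_total x t with h | h
    · exact key x t hx.1 h
    · rw [dist_comm, dist_comm x]; exact key t x ht.1 h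
  exact this.continuousOn

/-- At points which are not in the interior of an interval, both formulas agree. -/
theorem stretch_eq (f : BilipFamily s r k) (Γ : PGeodesic s) {t : ℝ}
    (hN : ∀ a ∈ Γ.ivl, ¬ (a.1 < t ∧ t < a.2)) : stretch f Γ t = stretchAll f Γ t := by
  unfold stretch stretchAll
  congr 1
  · refine tsum_congr fun b => ?_
    by_cases hb : b ∈ Γ.ivl
    · rw [indicator_of_mem hb]
      have hl : 0 < b.2 - b.1 := by linarith [Γ.lt b hb]
      by_cases h2 : b.2 ≤ t
      · rw [indicator_of_mem (show b ∈ {b ∈ Γ.ivl | b.2 ≤ t} from ⟨hb, h2⟩)]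
        have : cutLen b t = b.2 - b.1 := by
          unfold cutLen; rw [min_eq_left h2, max_eq_right hl.le]
        rw [this, div_mul_cancel₀ _ hl.ne']
      · rw [indicator_of_notMem (fun h => h2 h.2)]
        have h3 : t ≤ b.1 := by
          by_contra h
          exact hN b hb ⟨not_le.1 h, not_le.1 h2⟩
        have : cutLen b t = 0 := by
          unfold cutLen
          refine max_eq_left ?_
          have := min_le_right b.2 t
          linarith
        rw [this, mul_zero]
    · rw [indicator_of_notMem hb, indicator_of_notMem (fun h => hb h.1)]
  · unfold gapLen
    apply measureReal_congr
    have h0 : ∀ᵐ y : ℝ, y ≠ t := by simp [ae_iff]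
    filter_upwards [h0] with y hy
    apply propext
    refine and_congr_right fun hy1 => not_congr ?_
    simp only [mem_iUnion, exists_prop]
    constructor
    · rintro ⟨b, ⟨hb, _⟩, h⟩
      exact ⟨b, hb, h⟩
    · rintro ⟨b, hb, h⟩
      refine ⟨b, ⟨hb, ?_⟩, h⟩
      by_contra h2
      refine hN b hb ⟨lt_of_le_of_lt h.1 (lt_of_le_of_ne hy1.2 hy), not_le.1 h2⟩

theorem PGeodesic.fst_notInterior (Γ : PGeodesic s) {a : ℝ × ℝ} (ha : a ∈ Γ.ivl) :
    ∀ b ∈ Γ.ivl, ¬ (b.1 < a.1 ∧ a.1 < b.2) := by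
  rintro b hb ⟨h1, h2⟩
  by_cases hab : a = b
  · subst hab; exact lt_irrefl _ h1
  · have := Γ.lt a ha
    rcases Γ.order ha hb hab with h | h <;> linarith

theorem PGeodesic.snd_notInterior (Γ : PGeodesic s) {a : ℝ × ℝ} (ha : a ∈ Γ.ivl) :
    ∀ b ∈ Γ.ivl, ¬ (b.1 < a.2 ∧ a.2 < b.2) := by
  rintro b hb ⟨h1, h2⟩
  by_cases hab : a = b
  · subst hab; exact lt_irrefl _ h2
  · have := Γ.lt a ha
    rcases Γ.order ha hb hab with h | h <;> linarith

theorem PGeodesic.len_notInterior (Γ : PGeodesic s) :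
    ∀ b ∈ Γ.ivl, ¬ (b.1 < Γ.len ∧ Γ.len < b.2) := by
  rintro b hb ⟨_, h2⟩
  exact absurd (Γ.le_len b hb) (not_le.2 h2)

theorem stretchAll_ivl (f : BilipFamily s r k) (Γ : PGeodesic s) {a : ℝ × ℝ} (ha : a ∈ Γ.ivl) :
    stretchAll f Γ a.2 - stretchAll f Γ a.1 = f.newLen (Γ.pt a) := by
  have h0 := Γ.nonneg a ha
  have hlt := Γ.lt a ha
  have hl : 0 < a.2 - a.1 := by linarith
  have h1 := (hasSum_cutLen Γ (h0.trans hlt.le)).sub (hasSum_cutLen Γ h0)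
  have h2 := (hasSum_stretchAll f Γ (h0.trans hlt.le)).sub (hasSum_stretchAll f Γ h0)
  have hz : ∀ b ∈ Γ.ivl, b ≠ a → cutLen b a.2 = cutLen b a.1 := by
    intro b hb hba
    have := Γ.lt b hb
    unfold cutLen
    rcases Γ.order hb ha hba with h | h
    · rw [min_eq_left h, min_eq_left (h.trans hlt.le)]
    · rw [max_eq_left, max_eq_left]
      · have := min_le_right b.2 a.1; linarith
      · have := min_le_right b.2 a.2; linarith
  have ha2 : cutLen a a.2 = a.2 - a.1 := by
    unfold cutLen; rw [min_self, max_eq_right hl.le]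
  have ha1 : cutLen a a.1 = 0 := by
    unfold cutLen; rw [min_eq_right hlt.le, sub_self, max_self]
  have e1 := h1.unique (hasSum_single a fun b hba => by
    by_cases hb : b ∈ Γ.ivl
    · simp [indicator_of_mem hb, hz b hb hba]
    · simp [indicator_of_notMem hb])
  have e2 := h2.unique (hasSum_single a fun b hba => by
    by_cases hb : b ∈ Γ.ivl
    · simp [indicator_of_mem hb, hz b hb hba]
    · simp [indicator_of_notMem hb])
  simp only [indicator_of_mem ha, ha1, ha2, mul_zero, sub_zero] at e1 e2
  rw [div_mul_cancel₀ _ hl.ne'] at e2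
  linarith

/-- The interval `s_Γ([p, q)) = [s_Γ(p), s_Γ(q))`. -/
def newIvl (f : BilipFamily s r k) (Γ : PGeodesic s) (a : ℝ × ℝ) : ℝ × ℝ :=
  (stretch f Γ a.1, stretch f Γ a.2)

theorem newIvl_eq (f : BilipFamily s r k) (Γ : PGeodesic s) {a : ℝ × ℝ} (ha : a ∈ Γ.ivl) :
    newIvl f Γ a = (stretchAll f Γ a.1, stretchAll f Γ a.2) := by
  unfold newIvl
  rw [stretch_eq f Γ (Γ.fst_notInterior ha), stretch_eq f Γ (Γ.snd_notInterior ha)]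

theorem newIvl_injOn (f : BilipFamily s r k) (Γ : PGeodesic s) :
    InjOn (newIvl f Γ) Γ.ivl := by
  intro a ha b hb h
  rw [newIvl_eq f Γ ha, newIvl_eq f Γ hb] at h
  by_contra hab
  have h1 := congrArg Prod.fst h
  have h2 := congrArg Prod.snd h
  simp only at h1 h2
  have ha0 := Γ.nonneg a ha
  have hb0 := Γ.nonneg b hb
  have hal := Γ.lt a ha
  have hbl := Γ.lt b hb
  have e1 := (stretchAll_le_iff f Γ ha0 hb0).1 h1.le
  have e2 := (stretchAll_le_iff f Γ hb0 ha0).1 h1.ge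
  rcases Γ.order ha hb hab with h | h <;> linarith

/-- The P-geodesic `ψ'(Γ)` with range `(P i, r i)`, obtained from the P-geodesic `Γ` with range
`(Q j, s j)`: its intervals are the `s_Γ(I_a)`, and its value on `s_Γ(I_a)` is `f_j(Γ(I_a))`. -/
def stretchGeodesic (f : BilipFamily s r k) (Γ : PGeodesic s) : PGeodesic r where
  len := stretch f Γ Γ.len
  len_pos := by
    rw [stretch_eq f Γ Γ.len_notInterior, ← stretchAll_zero f Γ]
    exact stretchAll_lt f Γ le_rfl Γ.len_pos
  ivl := newIvl f Γ '' Γ.ivl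
  nonneg := by
    rintro _ ⟨a, ha, rfl⟩
    rw [newIvl_eq f Γ ha, ← stretchAll_zero f Γ]
    exact (stretchAll_le_iff f Γ le_rfl (Γ.nonneg a ha)).2 (Γ.nonneg a ha)
  lt := by
    rintro _ ⟨a, ha, rfl⟩
    rw [newIvl_eq f Γ ha]
    exact stretchAll_lt f Γ (Γ.nonneg a ha) (Γ.lt a ha)
  le_len := by
    rintro _ ⟨a, ha, rfl⟩
    rw [newIvl_eq f Γ ha, stretch_eq f Γ Γ.len_notInterior]
    exact (stretchAll_le_iff f Γ ((Γ.nonneg a ha).trans (Γ.lt a ha).le) Γ.len_pos.le).2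
      (Γ.le_len a ha)
  disj := by
    rintro _ ⟨a, ha, rfl⟩ _ ⟨b, hb, rfl⟩ hab
    have hab' : a ≠ b := fun h => hab (by rw [h])
    rw [newIvl_eq f Γ ha, newIvl_eq f Γ hb, Ico_disjoint_Ico]
    have ha0 := Γ.nonneg a ha
    have hb0 := Γ.nonneg b hb
    rcases Γ.order ha hb hab' with h | h
    · exact (min_le_left _ _).trans (((stretchAll_le_iff f Γ
        (ha0.trans (Γ.lt a ha).le) hb0).2 h).trans (le_max_right _ _))
    · exact (min_le_right _ _).trans (((stretchAll_le_iff f Γ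
        (hb0.trans (Γ.lt b hb).le) ha0).2 h).trans (le_max_left _ _))
  dense := by
    intro y hy
    rw [stretch_eq f Γ Γ.len_notInterior] at hy
    have hc := stretchAll_continuousOn f Γ
    obtain ⟨t, ht, rfl⟩ := intermediate_value_Icc Γ.len_pos.le hc
      (show y ∈ Icc (stretchAll f Γ 0) (stretchAll f Γ Γ.len) by rwa [stretchAll_zero])
    have hU : (⋃ a ∈ Γ.ivl, Ico a.1 a.2) ⊆ Icc 0 Γ.len := by
      refine iUnion₂_subset fun a ha z hz => ?_
      exact ⟨(Γ.nonneg a ha).trans hz.1, hz.2.le.trans (Γ.le_len a ha)⟩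
    have h1 := ((hc t ht).mono hU).mem_closure_image (Γ.dense ht)
    refine closure_mono ?_ h1
    rintro _ ⟨z, hz, rfl⟩
    simp only [mem_iUnion, exists_prop] at hz ⊢
    obtain ⟨a, ha, hz⟩ := hz
    refine ⟨_, ⟨a, ha, rfl⟩, ?_⟩
    rw [newIvl_eq f Γ ha]
    have ha0 := Γ.nonneg a ha
    exact ⟨(stretchAll_le_iff f Γ ha0 (ha0.trans hz.1)).2 hz.1,
      stretchAll_lt f Γ (ha0.trans hz.1) hz.2⟩
  pt := fun J => f.push (Γ.pt (Function.invFunOn (newIvl f Γ) Γ.ivl J))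
  dist_pt := by
    rintro _ ⟨a, ha, rfl⟩
    rw [(newIvl_injOn f Γ).leftInvOn_invFunOn ha, newIvl_eq f Γ ha]
    exact (stretchAll_ivl f Γ ha).symm

theorem stretchGeodesic_pt (f : BilipFamily s r k) (Γ : PGeodesic s) {a : ℝ × ℝ}
    (ha : a ∈ Γ.ivl) : (stretchGeodesic f Γ).pt (newIvl f Γ a) = f.push (Γ.pt a) := by
  change f.push (Γ.pt (Function.invFunOn (newIvl f Γ) Γ.ivl (newIvl f Γ a))) = _
  rw [(newIvl_injOn f Γ).leftInvOn_invFunOn ha]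

theorem stretch_congr (f : BilipFamily s r k) (Γ Γ' : PGeodesic s) {x t : ℝ} (htx : t ≤ x)
    (h1 : {a ∈ Γ.ivl | a.2 ≤ x} = {a ∈ Γ'.ivl | a.2 ≤ x})
    (h2 : ∀ a ∈ Γ.ivl, a.2 ≤ x → Γ.pt a = Γ'.pt a) : stretch f Γ t = stretch f Γ' t := by
  have h3 : {a ∈ Γ.ivl | a.2 ≤ t} = {a ∈ Γ'.ivl | a.2 ≤ t} := by
    ext a
    have := Set.ext_iff.1 h1 a
    simp only [mem_ofPred_eq] at this ⊢
    constructor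
    · exact fun h => ⟨(this.1 ⟨h.1, h.2.trans htx⟩).1, h.2⟩
    · exact fun h => ⟨(this.2 ⟨h.1, h.2.trans htx⟩).1, h.2⟩
  unfold stretch
  rw [← h3]
  congr 1
  refine tsum_congr fun b => ?_
  by_cases hb : b ∈ {a ∈ Γ.ivl | a.2 ≤ t}
  · rw [indicator_of_mem hb, indicator_of_mem hb, h2 b hb.1 (hb.2.trans htx)]
  · rw [indicator_of_notMem hb, indicator_of_notMem hb]

/-- The pattern of `ψ'(Γ)` up to a time not in the interior of an interval is determined by the
pattern of `Γ`. -/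
theorem stretchGeodesic_pattern (f : BilipFamily s r k) (Γ Γ' : PGeodesic s) {x : ℝ} (hx : 0 < x)
    (hN : ∀ a ∈ Γ.ivl, ¬ (a.1 < x ∧ x < a.2))
    (h1 : {a ∈ Γ.ivl | a.2 ≤ x} = {a ∈ Γ'.ivl | a.2 ≤ x})
    (h2 : ∀ a ∈ Γ.ivl, a.2 ≤ x → Γ.pt a = Γ'.pt a)
    (hN' : ∀ a ∈ Γ'.ivl, ¬ (a.1 < x ∧ x < a.2)) :
    SameInitialPattern (stretchGeodesic f Γ) (stretchGeodesic f Γ') := by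
  have hs : ∀ t ≤ x, stretch f Γ t = stretch f Γ' t := fun t ht => stretch_congr f Γ Γ' ht h1 h2
  have hiv : ∀ a ∈ Γ.ivl, a.2 ≤ x → newIvl f Γ a = newIvl f Γ' a := fun a ha ha2 => by
    unfold newIvl
    rw [hs _ ha2, hs _ ((Γ.lt a ha).le.trans ha2)]
  have hle : ∀ (Γ : PGeodesic s), (∀ a ∈ Γ.ivl, ¬ (a.1 < x ∧ x < a.2)) →
      ∀ a ∈ Γ.ivl, (newIvl f Γ a).2 ≤ stretch f Γ x ↔ a.2 ≤ x := by
    intro Γ hN a ha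
    rw [newIvl_eq f Γ ha, stretch_eq f Γ hN]
    exact stretchAll_le_iff f Γ ((Γ.nonneg a ha).trans (Γ.lt a ha).le) hx.le
  have hmem : ∀ a, (a ∈ Γ.ivl ∧ a.2 ≤ x) ↔ (a ∈ Γ'.ivl ∧ a.2 ≤ x) := fun a => Set.ext_iff.1 h1 a
  refine ⟨stretch f Γ x, ?_, ?_, ?_, ?_⟩
  · rw [stretch_eq f Γ hN, ← stretchAll_zero f Γ]
    exact stretchAll_lt f Γ le_rfl hx
  · ext J
    constructor
    · rintro ⟨⟨a, ha, rfl⟩, hJ⟩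
      have ha2 := (hle Γ hN a ha).1 hJ
      exact ⟨⟨a, ((hmem a).1 ⟨ha, ha2⟩).1, (hiv a ha ha2).symm⟩, hJ⟩
    · rintro ⟨⟨a, ha, rfl⟩, hJ⟩
      rw [hs x le_rfl] at hJ
      have ha2 := (hle Γ' hN' a ha).1 hJ
      have ha' := ((hmem a).2 ⟨ha, ha2⟩).1
      refine ⟨⟨a, ha', hiv a ha' ha2⟩, ?_⟩
      rw [hs x le_rfl]
      exact hJ
  · rintro _ ⟨a, ha, rfl⟩ hJ
    have ha2 := (hle Γ hN a ha).1 hJ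
    rw [stretchGeodesic_pt f Γ ha, hiv a ha ha2, stretchGeodesic_pt f Γ' ((hmem a).1 ⟨ha, ha2⟩).1,
      h2 a ha ha2]
  · rintro _ ⟨a, ha, rfl⟩ hl hr
    rw [newIvl_eq f Γ ha, stretch_eq f Γ hN] at hl hr
    have ha0 := Γ.nonneg a ha
    exact absurd ⟨(stretchAll_lt_iff f Γ ha0 hx.le).1 hl,
      (stretchAll_lt_iff f Γ hx.le (ha0.trans (Γ.lt a ha).le)).1 hr⟩ (hN a ha)

theorem PGeodesic.exists_ivl_between (Γ : PGeodesic s) {x y : ℝ} (hx : 0 ≤ x) (hxy : x < y)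
    (hy : y ≤ Γ.len) : ∃ b ∈ Γ.ivl, ∃ z, x < z ∧ z < y ∧ b.1 ≤ z ∧ z < b.2 := by
  have hm : (x + y) / 2 ∈ closure (⋃ a ∈ Γ.ivl, Ico a.1 a.2) :=
    Γ.dense ⟨by linarith, by linarith⟩
  obtain ⟨z, hz, hz'⟩ := mem_closure_iff.1 hm (Ioo x y) isOpen_Ioo ⟨by linarith, by linarith⟩
  simp only [mem_iUnion, exists_prop] at hz'
  obtain ⟨a, ha, hza⟩ := hz'
  exact ⟨a, ha, z, hz.1, hz.2, hza.1, hza.2⟩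

theorem fst_le_of_pattern (Γ Γ' : PGeodesic s) {x : ℝ}
    (h1 : ∀ a, (a ∈ Γ.ivl ∧ a.2 ≤ x) → (a ∈ Γ'.ivl ∧ a.2 ≤ x))
    {a : ℝ × ℝ} (ha : a ∈ Γ.ivl) (hax : a.1 < x)
    {a' : ℝ × ℝ} (ha' : a' ∈ Γ'.ivl) (hxa' : x < a'.2) : a.1 ≤ a'.1 := by
  by_contra hlt
  rw [not_le] at hlt
  obtain ⟨b, hb, z, hz1, hz2, hz3, hz4⟩ := Γ.exists_ivl_between (Γ'.nonneg a' ha') hlt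
    ((Γ.lt a ha).le.trans (Γ.le_len a ha))
  have hba : b ≠ a := by rintro rfl; linarith
  have hb2 : b.2 ≤ a.1 := by
    rcases Γ.order hb ha hba with h | h
    · exact h
    · have := Γ.lt a ha; linarith
  have hb' := (h1 b ⟨hb, by linarith⟩).1
  have hba' : b ≠ a' := by rintro rfl; linarith
  rcases Γ'.order hb' ha' hba' with h | h <;> linarith

theorem le_newIvl_of_first (f : BilipFamily s r k) (Γ : PGeodesic s) {a b : ℝ × ℝ}
    (ha : a ∈ Γ.ivl) (h0 : 0 = a.1) (hb : b ∈ Γ.ivl) :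
    b = a ∨ (newIvl f Γ a).2 ≤ (newIvl f Γ b).1 := by
  by_cases hab : b = a
  · exact Or.inl hab
  · refine Or.inr ?_
    rw [newIvl_eq f Γ ha, newIvl_eq f Γ hb]
    refine (stretchAll_le_iff f Γ ((Γ.nonneg a ha).trans (Γ.lt a ha).le) (Γ.nonneg b hb)).2 ?_
    have := Γ.lt b hb
    have := Γ.nonneg b hb
    rcases Γ.order hb ha hab with h | h
    · linarith
    · exact h

theorem stretchGeodesic_sameInitialPattern (f : BilipFamily s r k) (Γ Γ' : PGeodesic s)
    (h : SameInitialPattern Γ Γ') :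
    SameInitialPattern (stretchGeodesic f Γ) (stretchGeodesic f Γ') := by
  obtain ⟨x, hx, h1, h2, h3⟩ := h
  have hmem : ∀ a, (a ∈ Γ.ivl ∧ a.2 ≤ x) ↔ (a ∈ Γ'.ivl ∧ a.2 ≤ x) := fun a => Set.ext_iff.1 h1 a
  have restrict : ∀ y ≤ x, {a ∈ Γ.ivl | a.2 ≤ y} = {a ∈ Γ'.ivl | a.2 ≤ y} := by
    intro y hy
    ext a
    exact ⟨fun h => ⟨((hmem a).1 ⟨h.1, h.2.trans hy⟩).1, h.2⟩,
      fun h => ⟨((hmem a).2 ⟨h.1, h.2.trans hy⟩).1, h.2⟩⟩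
  by_cases hc : ∃ a ∈ Γ.ivl, a.1 < x ∧ x < a.2
  · obtain ⟨a, ha, hax, hxa⟩ := hc
    obtain ⟨a', ha', hax', hxa', hidx⟩ := h3 a ha hax hxa
    -- both intervals have the same left endpoint
    have hfst : a.1 = a'.1 :=
      le_antisymm (fst_le_of_pattern Γ Γ' (fun a => (hmem a).1) ha hax ha' hxa')
        (fst_le_of_pattern Γ' Γ (fun a => (hmem a).2) ha' hax' ha hxa)
    rcases (Γ.nonneg a ha).lt_or_eq with h0 | h0
    · refine stretchGeodesic_pattern f Γ Γ' h0 (Γ.fst_notInterior ha) (restrict _ hax.le)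
        (fun b hb hb2 => h2 b hb (hb2.trans hax.le)) ?_
      rw [hfst]
      exact Γ'.fst_notInterior ha'
    · -- both start with an interval at `0`
      have h0' : 0 = a'.1 := h0.trans hfst
      have hJ := (stretchGeodesic f Γ).lt _ ⟨a, ha, rfl⟩
      have hJ0 := (stretchGeodesic f Γ).nonneg _ ⟨a, ha, rfl⟩
      have hJ' := (stretchGeodesic f Γ').lt _ ⟨a', ha', rfl⟩
      have hJ0' := (stretchGeodesic f Γ').nonneg _ ⟨a', ha', rfl⟩
      have hz : (newIvl f Γ' a').1 = 0 := by
        rw [newIvl_eq f Γ' ha', ← h0', stretchAll_zero]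
      set m := min (newIvl f Γ a).2 (newIvl f Γ' a').2 with hm
      have hm0 : 0 < m := lt_min (lt_of_le_of_lt hJ0 hJ) (lt_of_le_of_lt hJ0' hJ')
      have hm1 : m ≤ (newIvl f Γ a).2 := min_le_left _ _
      have hm2 : m ≤ (newIvl f Γ' a').2 := min_le_right _ _
      have hno : ∀ b ∈ Γ.ivl, ¬ (newIvl f Γ b).2 ≤ m / 2 := by
        intro b hb hle
        have := (stretchGeodesic f Γ).lt _ ⟨b, hb, rfl⟩
        rcases le_newIvl_of_first f Γ ha h0 hb with h | h
        · subst h; linarith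
        · linarith
      have hno' : ∀ b ∈ Γ'.ivl, ¬ (newIvl f Γ' b).2 ≤ m / 2 := by
        intro b hb hle
        have := (stretchGeodesic f Γ').lt _ ⟨b, hb, rfl⟩
        rcases le_newIvl_of_first f Γ' ha' h0' hb with h | h
        · subst h; linarith
        · linarith
      refine ⟨m / 2, by positivity, ?_, ?_, ?_⟩
      · ext J
        constructor
        · rintro ⟨⟨b, hb, rfl⟩, h⟩; exact absurd h (hno b hb)
        · rintro ⟨⟨b, hb, rfl⟩, h⟩; exact absurd h (hno' b hb)
      · rintro _ ⟨b, hb, rfl⟩ h; exact absurd h (hno b hb)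
      · rintro _ ⟨b, hb, rfl⟩ hl hr
        rcases le_newIvl_of_first f Γ ha h0 hb with h | h
        · subst h
          refine ⟨_, ⟨a', ha', rfl⟩, by linarith, by linarith, ?_⟩
          rw [stretchGeodesic_pt f Γ hb, stretchGeodesic_pt f Γ' ha']
          exact congrArg f.idx hidx
        · linarith
  · have hNx : ∀ a ∈ Γ.ivl, ¬ (a.1 < min x Γ.len ∧ min x Γ.len < a.2) := by
      rintro a ha ⟨hl, hr⟩
      rcases min_choice x Γ.len with h | h
      · rw [h] at hl hr; exact hc ⟨a, ha, hl, hr⟩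
      · rw [h] at hl hr; exact Γ.len_notInterior a ha ⟨hl, hr⟩
    refine stretchGeodesic_pattern f Γ Γ' (lt_min hx Γ.len_pos) hNx
      (restrict _ (min_le_left _ _)) (fun b hb hb2 => h2 b hb (hb2.trans (min_le_left _ _))) ?_
    rintro a' ha' ⟨hl, hr⟩
    obtain ⟨b, hb, z, hz1, hz2, hz3, hz4⟩ := Γ.exists_ivl_between (Γ'.nonneg a' ha') hl
      (min_le_right _ _)
    have hb2 : b.2 ≤ min x Γ.len := by
      by_contra h
      exact hNx b hb ⟨lt_of_le_of_lt hz3 hz2, not_le.1 h⟩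
    have hb' := ((hmem b).1 ⟨hb, hb2.trans (min_le_left _ _)⟩).1
    have hba' : b ≠ a' := by rintro rfl; linarith
    rcases Γ'.order hb' ha' hba' with h | h <;> linarith

/-- The map `ψ` induced by `ψ'` on classes of P-geodesics with the same initial P-pattern. -/
def psi (f : BilipFamily s r k) : PatternClass s → PatternClass r :=
  Quot.map (stretchGeodesic f) (stretchGeodesic_sameInitialPattern f)

end Psi

/-! ### Universal tree-graded spaces -/

/-- `X`, with the pieces `𝓟`, is a universal tree-graded space `F_α` for the family `(P i, r i)`:
a homogeneous tree-graded space with trivial transversal trees and pieces isometric to the `P i`,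
such that at each point `p`, for some choice of charts, the germ counts are given by `α`. -/
structure IsUniversal {I : Type u} {P : I → Type u} [∀ i, MetricSpace (P i)] (r : ∀ i, P i)
    (α : PatternClass r → Cardinal.{u}) {X : Type u} [MetricSpace X] (𝓟 : Set (Set X)) :
    Prop where
  nonempty : Nonempty X
  treeGraded : IsTreeGraded 𝓟
  homogeneous : IsHomogeneous X
  trivial_trees : TrivialTransversalTrees 𝓟
  pieces : ∀ A ∈ 𝓟, ∃ i, Nonempty (A ≃ᵢ P i)
  germCount_eq : ∀ p : X, ∃ c : Charts 𝓟 r, ∀ w, germCount c p w = α w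

end TreeGr

end

noncomputable section

namespace TreeGr

/-! ### Betweenness and geodesics -/

section Basic

variable {X : Type u} [MetricSpace X]

/-! The map is grown as a graph `R` in `F × G` by Zorn's lemma. In a tree-graded space the germs of
geodesics at `p` are the directions at `p` (`germ_eq_iff`), and if two points lie in different
directions from `p`, then every geodesic between them passes through `p`
(`IsTreeGraded.sep_mem_geodesic`). So distances add across `p`, and `k`-bilipschitz bijections
between sets through `p` can be glued at `p` without any loss in `k`, provided that they occupy
different directions on both sides (`PartialEquiv.wedge`).

An `Admissible` graph is a `k`-bilipschitz bijection between saturated sets which preserves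
separation and which, at each of its points, shows either at most two directions (`Thin`) or all of
them (`Full`; on the side of `G` only when surjectivity is wanted). Unions of chains and closures of
admissible graphs are admissible, so a maximal one is closed. If missing directions can always be
added at a thin point, the maximal graph is full everywhere. A closed saturated set that meets every
direction at each of its points is the whole space (`Saturated.eq_univ`): the domain is `F`, and in
the surjective case the range is `G`.

Directions are added by counting (`exists_fibrewise`). At a thin point only finitely many germs are
in use. For each pattern class `w`, the hypothesis compares the germs at `p.1` whose class is sent
to `w` by `psi` with the germs at `p.2` of class `w`; it speaks of every `w` since `psi` is onto
(`psi_surjective`). The second set is infinite, so deleting finitely many germs does not matter: the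
unused germs inject into the unused ones, bijectively in case of equality, with matching classes.

Two germs with matching classes carry a partial equivalence, a `Branch` (`exists_branch`). If the
geodesics start inside pieces, some `f_j` read in charts maps one piece onto the other. Otherwise
the stretching function matches the pieces along short initial segments together with their entrance
and exit points, and the maps `f_j` read in charts fit together on the union of these pieces
(`GeodesicMatch.branch`). A branch shows at most two directions at each of its points, so attaching
branches preserves admissibility (`Admissible.extend`). -/

/-- `y` lies metrically between `x` and `z`. -/
def Btw (x y z : X) : Prop := dist x y + dist y z = dist x z

theorem Btw.symm {x y z : X} (h : Btw x y z) : Btw z y x := by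
  unfold Btw at *
  rw [dist_comm z y, dist_comm y x, dist_comm z x]; linarith

theorem btw_left (x y : X) : Btw x x y := by simp [Btw]

theorem btw_right (x y : X) : Btw x y y := by simp [Btw]

/-- If `w` is between `x, z` and `v` is between `x, w`, then `v` is between `x, z`. -/
theorem Btw.trans_left {x v w z : X} (h : Btw x w z) (h' : Btw x v w) : Btw x v z := by
  unfold Btw at *
  have := dist_triangle v w z
  have := dist_triangle x v z
  linarith

theorem Btw.trans_right {x v w z : X} (h : Btw x w z) (h' : Btw x v w) : Btw v w z := by
  unfold Btw at *
  have := dist_triangle v w z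
  have := dist_triangle x v z
  linarith

theorem Btw.eq_of_dist {x y z : X} (h : Btw x y z) (h' : dist x y = dist x z) : y = z := by
  unfold Btw at h
  exact dist_eq_zero.1 (by linarith)

theorem Btw.dist_le {x y z : X} (h : Btw x y z) : dist x y ≤ dist x z := by
  unfold Btw at h
  have : 0 ≤ dist y z := dist_nonneg
  linarith

theorem Btw.antisymm {x y z : X} (h : Btw x y z) (h' : Btw x z y) : y = z :=
  h.eq_of_dist (le_antisymm h.dist_le h'.dist_le)

theorem btw_self_iff {x y : X} : Btw x y x ↔ y = x := by
  constructor
  · intro h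
    have := h.dist_le
    rw [dist_self] at this
    exact (dist_le_zero.1 this).symm
  · rintro rfl; exact btw_left _ _

theorem IsGeodesicOn.dist_le {γ : ℝ → X} {l u v : ℝ} (h : IsGeodesicOn γ l) (hu : 0 ≤ u)
    (huv : u ≤ v) (hv : v ≤ l) : dist (γ u) (γ v) = v - u := by
  rw [h.2 u ⟨hu, huv.trans hv⟩ v ⟨hu.trans huv, hv⟩, abs_sub_comm, abs_of_nonneg (by linarith)]

theorem IsGeodesicOn.dist_zero {γ : ℝ → X} {l v : ℝ} (h : IsGeodesicOn γ l)
    (hv0 : 0 ≤ v) (hv : v ≤ l) : dist (γ 0) (γ v) = v := by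
  rw [h.dist_le le_rfl hv0 hv, sub_zero]

theorem IsGeodesicOn.btw {γ : ℝ → X} {l u v w : ℝ} (h : IsGeodesicOn γ l) (hu : 0 ≤ u)
    (huv : u ≤ v) (hvw : v ≤ w) (hw : w ≤ l) : Btw (γ u) (γ v) (γ w) := by
  unfold Btw
  rw [h.dist_le hu huv (hvw.trans hw), h.dist_le (hu.trans huv) hvw hw,
    h.dist_le hu (huv.trans hvw) hw]
  ring

theorem IsGeodesicOn.injOn {γ : ℝ → X} {l : ℝ} (h : IsGeodesicOn γ l) : InjOn γ (Icc 0 l) := by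
  intro t ht t' ht' heq
  have := h.2 t ht t' ht'
  rw [heq, dist_self] at this
  linarith [abs_eq_zero.1 this.symm]

theorem IsGeodesicOn.eq_time {γ σ : ℝ → X} {l m t t' : ℝ} (h : IsGeodesicOn γ l)
    (h' : IsGeodesicOn σ m) (h0 : γ 0 = σ 0) (ht : t ∈ Icc 0 l) (ht' : t' ∈ Icc 0 m)
    (heq : γ t = σ t') : t = t' := by
  rw [← h.dist_zero ht.1 ht.2, ← h'.dist_zero ht'.1 ht'.2, heq, h0]

theorem IsGeodesicOn.continuousOn {γ : ℝ → X} {l : ℝ} (h : IsGeodesicOn γ l) :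
    ContinuousOn γ (Icc 0 l) := by
  have : LipschitzOnWith 1 γ (Icc 0 l) := by
    refine LipschitzOnWith.of_dist_le_mul fun x hx y hy => ?_
    rw [h.2 x hx y hy, NNReal.coe_one, one_mul, Real.dist_eq]
  exact this.continuousOn

theorem IsGeodesicOn.mono {γ : ℝ → X} {l m : ℝ} (h : IsGeodesicOn γ l) (hm : 0 ≤ m) (hml : m ≤ l) :
    IsGeodesicOn γ m :=
  ⟨hm, fun t ht t' ht' => h.2 t ⟨ht.1, ht.2.trans hml⟩ t' ⟨ht'.1, ht'.2.trans hml⟩⟩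

theorem IsGeodesicOn.shift {γ : ℝ → X} {l u v : ℝ} (h : IsGeodesicOn γ l) (hu : 0 ≤ u)
    (huv : u ≤ v) (hv : v ≤ l) : IsGeodesicOn (fun t => γ (u + t)) (v - u) := by
  refine ⟨by linarith, fun t ht t' ht' => ?_⟩
  rw [h.2 _ ⟨by linarith [ht.1], by linarith [ht.2]⟩ _ ⟨by linarith [ht'.1], by linarith [ht'.2]⟩]
  congr 1; ring

theorem IsGeodesicOn.reverse {γ : ℝ → X} {l : ℝ} (h : IsGeodesicOn γ l) :
    IsGeodesicOn (fun t => γ (l - t)) l := by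
  refine ⟨h.1, fun t ht t' ht' => ?_⟩
  rw [h.2 _ ⟨by linarith [ht.2], by linarith [ht.1]⟩ _ ⟨by linarith [ht'.2], by linarith [ht'.1]⟩,
    abs_sub_comm]
  congr 1; ring

theorem IsGeodesicOn.segment {γ : ℝ → X} {l u v : ℝ} (h : IsGeodesicOn γ l) (hu : 0 ≤ u)
    (huv : u ≤ v) (hv : v ≤ l) : IsGeodesicSegment (γ '' Icc u v) (γ u) (γ v) := by
  refine ⟨_, _, h.shift hu huv hv, by simp, by simp, ?_⟩
  ext y
  constructor
  · rintro ⟨t, ht, rfl⟩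
    exact ⟨t - u, ⟨by linarith [ht.1], by linarith [ht.2]⟩, by simp⟩
  · rintro ⟨t, ht, rfl⟩
    exact ⟨u + t, ⟨by linarith [ht.1], by linarith [ht.2]⟩, rfl⟩

theorem IsGeodesicSegment.symm {S : Set X} {x y : X} (h : IsGeodesicSegment S x y) :
    IsGeodesicSegment S y x := by
  obtain ⟨γ, l, hγ, rfl, rfl, rfl⟩ := h
  refine ⟨_, _, hγ.reverse, by simp, by simp, ?_⟩
  ext y
  constructor
  · rintro ⟨t, ht, rfl⟩
    exact ⟨l - t, ⟨by linarith [ht.2], by linarith [ht.1]⟩, by simp⟩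
  · rintro ⟨t, ht, rfl⟩
    exact ⟨l - t, ⟨by linarith [ht.2], by linarith [ht.1]⟩, rfl⟩

theorem IsGeodesicSegment.exists_param {S : Set X} {x y : X} (h : IsGeodesicSegment S x y) :
    ∃ γ : ℝ → X, IsGeodesicOn γ (dist x y) ∧ γ 0 = x ∧ γ (dist x y) = y ∧
      S = γ '' Icc 0 (dist x y) := by
  obtain ⟨γ, l, hγ, rfl, rfl, rfl⟩ := h
  have : dist (γ 0) (γ l) = l := hγ.dist_zero hγ.1 le_rfl
  rw [this]
  exact ⟨γ, hγ, rfl, rfl, rfl⟩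

/-- A closed set of reals missing `m` but meeting both sides has a complementary interval around
`m`. -/
theorem exists_gap {E : Set ℝ} (hE : IsClosed E) {u₀ m v₀ : ℝ} (hu : u₀ ∈ E) (hv : v₀ ∈ E)
    (hum : u₀ ≤ m) (hmv : m ≤ v₀) (hm : m ∉ E) :
    ∃ u ∈ E, ∃ v ∈ E, u₀ ≤ u ∧ u < m ∧ m < v ∧ v ≤ v₀ ∧ ∀ t ∈ Ioo u v, t ∉ E := by
  obtain ⟨u, ⟨hu1, hu2⟩, hu3⟩ := (isCompact_Icc.inter_right hE : IsCompact (Icc u₀ m ∩ E)).exists_isGreatest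
    ⟨u₀, ⟨le_rfl, hum⟩, hu⟩
  obtain ⟨v, ⟨hv1, hv2⟩, hv3⟩ := (isCompact_Icc.inter_right hE : IsCompact (Icc m v₀ ∩ E)).exists_isLeast
    ⟨v₀, ⟨hmv, le_rfl⟩, hv⟩
  have h1 : u < m := lt_of_le_of_ne hu1.2 (fun h => hm (h ▸ hu2))
  have h2 : m < v := lt_of_le_of_ne hv1.1 (fun h => hm (h ▸ hv2))
  refine ⟨u, hu2, v, hv2, hu1.1, h1, h2, hv1.2, fun t ht htE => ?_⟩
  rcases le_total t m with h | h
  · exact absurd (hu3 ⟨⟨hu1.1.trans ht.1.le, h⟩, htE⟩) (not_le.2 ht.1)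
  · exact absurd (hv3 ⟨⟨h, ht.2.le.trans hv1.2⟩, htE⟩) (not_le.2 ht.2)

end Basic

/-! ### Convexity of pieces, bigons and gates. -/

namespace IsTreeGraded

variable {X : Type u} [MetricSpace X] {𝓟 : Set (Set X)}

theorem exists_geodesic (h : IsTreeGraded 𝓟) (x y : X) :
    ∃ γ : ℝ → X, IsGeodesicOn γ (dist x y) ∧ γ 0 = x ∧ γ (dist x y) = y := by
  obtain ⟨S, -, hS⟩ := h.geodesic x (mem_univ x) y (mem_univ y)
  obtain ⟨γ, h1, h2, h3, -⟩ := hS.exists_param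
  exact ⟨γ, h1, h2, h3⟩

/-- Equality in the triangle inequality makes the concatenation of two geodesics a geodesic.
Geodesics are not unique, and this lets a metrically intermediate point be treated as a time on one
of them. -/
theorem exists_geodesic_through (h : IsTreeGraded 𝓟) {x w y : X} (hw : Btw x w y) :
    ∃ γ : ℝ → X, IsGeodesicOn γ (dist x y) ∧ γ 0 = x ∧ γ (dist x w) = w ∧ γ (dist x y) = y := by
  obtain ⟨γ₁, h1, h10, h11⟩ := h.exists_geodesic x w
  obtain ⟨γ₂, h2, h20, h21⟩ := h.exists_geodesic w y
  set d := dist x w with hd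
  have hd0 : 0 ≤ d := dist_nonneg
  have he0 : 0 ≤ dist w y := dist_nonneg
  have hw' : d + dist w y = dist x y := hw
  let γ : ℝ → X := fun t => if t ≤ d then γ₁ t else γ₂ (t - d)
  have hγ1 : ∀ t, t ≤ d → γ t = γ₁ t := fun t ht => if_pos ht
  have hγ2 : ∀ t, d ≤ t → γ t = γ₂ (t - d) := by
    intro t ht
    rcases ht.eq_or_lt with h | h
    · rw [hγ1 t h.ge, ← h, sub_self, h20, h11]
    · exact if_neg (not_le.2 h)
  have key : ∀ t t', 0 ≤ t → t ≤ t' → t' ≤ dist x y → dist (γ t) (γ t') = t' - t := by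
    intro t t' ht htt ht'
    rcases le_total t' d with h3 | h3
    · rw [hγ1 t (htt.trans h3), hγ1 t' h3, h1.dist_le ht htt h3]
    rcases le_total d t with h4 | h4
    · rw [hγ2 t h4, hγ2 t' h3, h2.dist_le (by linarith) (by linarith) (by linarith)]; ring
    rw [hγ1 t h4, hγ2 t' h3]
    have e1 := h1.dist_le ht h4 le_rfl
    have e2 := h2.dist_le le_rfl (sub_nonneg.2 h3) (by linarith)
    have e3 := h1.dist_le le_rfl ht h4
    have e4 := h2.dist_le (sub_nonneg.2 h3) (by linarith) le_rfl
    rw [h11] at e1; rw [h20] at e2; rw [h10] at e3; rw [h21] at e4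
    have i1 := dist_triangle (γ₁ t) w (γ₂ (t' - d))
    have i2 := dist_triangle x (γ₁ t) y
    have i3 := dist_triangle (γ₁ t) (γ₂ (t' - d)) y
    linarith
  refine ⟨γ, ⟨dist_nonneg, fun t ht t' ht' => ?_⟩, ?_, ?_, ?_⟩
  · rcases le_total t t' with h3 | h3
    · rw [key t t' ht.1 h3 ht'.2, abs_sub_comm, abs_of_nonneg (by linarith)]
    · rw [dist_comm, key t' t ht'.1 h3 ht.2, abs_of_nonneg (by linarith)]
  · rw [hγ1 0 hd0, h10]
  · rw [hγ1 d le_rfl, h11]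
  · rw [hγ2 _ (by linarith), ← hw', add_sub_cancel_left, h21]

theorem exists_btw (h : IsTreeGraded 𝓟) (x y : X) {m : ℝ} (h0 : 0 ≤ m) (hm : m ≤ dist x y) :
    ∃ w, Btw x w y ∧ dist x w = m := by
  obtain ⟨γ, h1, h2, h3⟩ := h.exists_geodesic x y
  refine ⟨γ m, ?_, ?_⟩
  · have := h1.btw le_rfl h0 hm le_rfl
    rwa [h2, h3] at this
  · have := h1.dist_zero h0 hm
    rwa [h2] at this

theorem exists_piece (h : IsTreeGraded 𝓟) (x : X) : ∃ A ∈ 𝓟, x ∈ A := by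
  have : x ∈ ⋃₀ 𝓟 := by rw [h.cover]; trivial
  exact this

theorem piece_eq (h : IsTreeGraded 𝓟) {A B : Set X} (hA : A ∈ 𝓟) (hB : B ∈ 𝓟) {x y : X}
    (hxy : x ≠ y) (hxA : x ∈ A) (hyA : y ∈ A) (hxB : x ∈ B) (hyB : y ∈ B) : A = B := by
  by_contra hne
  exact hxy (h.inter_subsingleton A hA B hB hne ⟨hxA, hxB⟩ ⟨hyA, hyB⟩)

/-- The midpoint of `γ₂` serves as a third vertex, which turns the bigon into a simple triangle.
Geodesics with a common origin can only meet at equal times, so `hne` is enough to keep the sides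
apart. -/
theorem simple_bigon (h : IsTreeGraded 𝓟) {γ₁ γ₂ : ℝ → X} {l : ℝ} (hl : 0 < l)
    (h1 : IsGeodesicOn γ₁ l) (h2 : IsGeodesicOn γ₂ l) (h0 : γ₁ 0 = γ₂ 0) (he : γ₁ l = γ₂ l)
    (hne : ∀ t ∈ Ioo 0 l, γ₁ t ≠ γ₂ t) :
    ∃ A ∈ 𝓟, ∀ t ∈ Icc 0 l, γ₁ t ∈ A ∧ γ₂ t ∈ A := by
  have hl2 : 0 < l / 2 := by linarith
  have hend : ∀ t ∈ Icc 0 l, γ₁ t = γ₂ t → t = 0 ∨ t = l := by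
    intro t ht h
    by_contra hc
    rw [not_or] at hc
    exact hne t ⟨lt_of_le_of_ne ht.1 (Ne.symm hc.1), lt_of_le_of_ne ht.2 hc.2⟩ h
  have s1 := h1.segment le_rfl hl.le le_rfl
  have s2 := (h2.segment hl2.le (by linarith : l / 2 ≤ l) le_rfl).symm
  have s3 := (h2.segment le_rfl hl2.le (by linarith : l / 2 ≤ l)).symm
  rw [← he] at s2
  rw [← h0] at s3
  refine Exists.elim (h.triangle _ _ _ _ _ _ s1 s2 s3 ?_ ?_ ?_) ?_
  pick_goal 4
  · rintro A ⟨hA, hsub⟩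
    refine ⟨A, hA, fun t ht => ⟨hsub (Or.inl (Or.inl ⟨t, ht, rfl⟩)), ?_⟩⟩
    rcases le_total t (l / 2) with h | h
    · exact hsub (Or.inr ⟨t, ⟨ht.1, h⟩, rfl⟩)
    · exact hsub (Or.inl (Or.inr ⟨t, ⟨h, ht.2⟩, rfl⟩))
  · refine Subset.antisymm ?_ ?_
    · rintro _ ⟨⟨t, ht, rfl⟩, ⟨t', ht', heq⟩⟩
      have := h1.eq_time h2 h0 ht ⟨by linarith [ht'.1], ht'.2⟩ heq.symm
      subst this
      rcases hend t ht heq.symm with h | h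
      · linarith [ht'.1]
      · rw [h]; rfl
    · rintro _ rfl
      exact ⟨⟨l, ⟨hl.le, le_rfl⟩, rfl⟩, ⟨l, ⟨by linarith, le_rfl⟩, he.symm⟩⟩
  · refine Subset.antisymm ?_ ?_
    · rintro _ ⟨⟨t, ht, rfl⟩, ⟨t', ht', heq⟩⟩
      have := h2.injOn ⟨ht'.1, by linarith [ht'.2]⟩ ⟨by linarith [ht.1], ht.2⟩ heq
      have : t = l / 2 := by linarith [ht.1, ht'.2]
      rw [this]; rfl
    · rintro _ rfl
      exact ⟨⟨l / 2, ⟨le_rfl, by linarith⟩, rfl⟩, ⟨l / 2, ⟨hl2.le, le_rfl⟩, rfl⟩⟩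
  · refine Subset.antisymm ?_ ?_
    · rintro _ ⟨⟨t', ht', rfl⟩, ⟨t, ht, heq⟩⟩
      have := h1.eq_time h2 h0 ht ⟨ht'.1, by linarith [ht'.2]⟩ heq
      subst this
      rcases hend t ht heq with h | h
      · rw [h, ← h0]; rfl
      · linarith [ht'.2]
    · rintro _ rfl
      exact ⟨⟨0, ⟨le_rfl, hl2.le⟩, h0.symm⟩, ⟨0, ⟨le_rfl, hl.le⟩, rfl⟩⟩

/-- Pieces are convex. -/
theorem piece_convex (h : IsTreeGraded 𝓟) {A : Set X} (hA : A ∈ 𝓟) {x y z : X} (hx : x ∈ A)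
    (hz : z ∈ A) (hy : Btw x y z) : y ∈ A := by
  obtain ⟨γ, hγ, h0, hm, hl⟩ := h.exists_geodesic_through hy
  by_contra hyA
  have hE : IsClosed (Icc 0 (dist x z) ∩ γ ⁻¹' A) :=
    hγ.continuousOn.preimage_isClosed_of_isClosed isClosed_Icc (h.piece_closed A hA)
  obtain ⟨u, ⟨hu, huA⟩, v, ⟨hv, hvA⟩, -, hum, hmv, -, hgap⟩ := exists_gap hE (u₀ := 0)
    (m := dist x y) (v₀ := dist x z) ⟨⟨le_rfl, dist_nonneg⟩, by rwa [mem_preimage, h0]⟩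
    ⟨⟨dist_nonneg, le_rfl⟩, by rwa [mem_preimage, hl]⟩ dist_nonneg hy.dist_le
    (fun hc => hyA (by have := hc.2; rwa [mem_preimage, hm] at this))
  have huv : u < v := hum.trans hmv
  -- Between `u` and `v` the geodesic avoids `A`, so with a geodesic inside `A` it bounds a simple
  -- bigon. The piece containing this bigon shares two points with `A`, hence equals `A`.
  obtain ⟨S, hSA, hS⟩ := h.piece_geodesic A hA _ huA _ hvA
  obtain ⟨σ, hσ, hσ0, hσ1, rfl⟩ := hS.exists_param
  have hd := hγ.dist_le hu.1 huv.le hv.2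
  rw [hd] at hσ hσ1 hSA
  obtain ⟨B, hB, hsub⟩ := h.simple_bigon (by linarith) (hγ.shift hu.1 huv.le hv.2) hσ
    (by simp [hσ0]) (by simp [hσ1]) (by
      intro t ht heq
      refine hgap (u + t) ⟨by linarith [ht.1], by linarith [ht.2]⟩
        ⟨⟨by linarith [ht.1, hu.1], by linarith [ht.2, hv.2]⟩, ?_⟩
      exact hSA ⟨t, ⟨ht.1.le, ht.2.le⟩, heq.symm⟩)
  have e1 := (hsub 0 ⟨le_rfl, by linarith⟩).1
  have e2 := (hsub (v - u) ⟨by linarith, le_rfl⟩).1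
  have e3 := (hsub (dist x y - u) ⟨by linarith, by linarith⟩).1
  simp only [add_zero, add_sub_cancel, hm] at e1 e2 e3
  have hne : γ u ≠ γ v := fun heq => huv.ne (hγ.injOn hu hv heq)
  rw [h.piece_eq hA hB hne huA hvA e1 e2] at hyA
  exact hyA e3

/-- Points at the same time on two geodesics with the same endpoints lie in a common piece. -/
theorem bigon (h : IsTreeGraded 𝓟) {p e y z : X} (hy : Btw p y e) (hz : Btw p z e)
    (hd : dist p y = dist p z) : ∃ A ∈ 𝓟, y ∈ A ∧ z ∈ A := by
  by_cases hyz : y = z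
  · subst hyz
    obtain ⟨A, hA, hyA⟩ := h.exists_piece y
    exact ⟨A, hA, hyA, hyA⟩
  obtain ⟨γ, hγ, h0, hm, hl⟩ := h.exists_geodesic_through hy
  obtain ⟨σ, hσ, h0', hm', hl'⟩ := h.exists_geodesic_through hz
  rw [← hd] at hm'
  -- A complementary interval of the set of coincidence times, around `dist p y`, cuts out a simple
  -- bigon.
  have hE : IsClosed (Icc 0 (dist p e) ∩ (fun t => dist (γ t) (σ t)) ⁻¹' {0}) :=
    (continuous_dist.comp_continuousOn (hγ.continuousOn.prodMk hσ.continuousOn)).preimage_isClosed_of_isClosed isClosed_Icc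
      isClosed_singleton
  obtain ⟨u, ⟨hu, huA⟩, v, ⟨hv, hvA⟩, -, hum, hmv, -, hgap⟩ := exists_gap hE (u₀ := 0)
    (m := dist p y) (v₀ := dist p e) ⟨⟨le_rfl, dist_nonneg⟩, by simp [h0, h0']⟩
    ⟨⟨dist_nonneg, le_rfl⟩, by simp [hl, hl']⟩ dist_nonneg hy.dist_le
    (fun hc => hyz (by have := hc.2; simpa [hm, hm'] using this))
  have huv : u < v := hum.trans hmv
  obtain ⟨B, hB, hsub⟩ := h.simple_bigon (by linarith) (hγ.shift hu.1 huv.le hv.2)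
    (hσ.shift hu.1 huv.le hv.2)
    (by simpa using huA) (by simpa using hvA) (by
      intro t ht heq
      refine hgap (u + t) ⟨by linarith [ht.1], by linarith [ht.2]⟩
        ⟨⟨by linarith [ht.1, hu.1], by linarith [ht.2, hv.2]⟩, ?_⟩
      simpa using heq)
  have e3 := hsub (dist p y - u) ⟨by linarith, by linarith⟩
  simp only [add_sub_cancel, hm, hm'] at e3
  exact ⟨B, hB, e3⟩

/-- Two geodesics from `x` hit a piece for the first time at the same point. -/
theorem first_hit_unique (h : IsTreeGraded 𝓟) {A : Set X} (hA : A ∈ 𝓟) {σ₁ σ₂ : ℝ → X} {l₁ l₂ : ℝ}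
    (h1 : IsGeodesicOn σ₁ l₁) (h2 : IsGeodesicOn σ₂ l₂) (h0 : σ₁ 0 = σ₂ 0)
    (ha : σ₁ l₁ ∈ A) (hb : σ₂ l₂ ∈ A) (ha' : ∀ t ∈ Icc 0 l₁, σ₁ t ∈ A → t = l₁)
    (hb' : ∀ t ∈ Icc 0 l₂, σ₂ t ∈ A → t = l₂) : σ₁ l₁ = σ₂ l₂ := by
  by_contra hne
  have hc : IsCompact (σ₂ '' Icc 0 l₂) := isCompact_Icc.image_of_continuousOn h2.continuousOn
  have hE : IsClosed (Icc 0 l₁ ∩ σ₁ ⁻¹' (σ₂ '' Icc 0 l₂)) :=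
    h1.continuousOn.preimage_isClosed_of_isClosed isClosed_Icc hc.isClosed
  have hE' : IsCompact (Icc 0 l₁ ∩ σ₁ ⁻¹' (σ₂ '' Icc 0 l₂)) :=
    isCompact_Icc.of_isClosed_subset hE inter_subset_left
  -- After the last time `t` at which `σ₁` is on `σ₂`, the two remaining arcs and a geodesic inside
  -- `A` form a simple triangle. Its piece shares two points with `A`, hence equals `A`, but
  -- contains `σ₁ t ∉ A`.
  obtain ⟨t, ⟨ht, ⟨t', ht', heq⟩⟩, hmax⟩ := hE'.exists_isGreatest
    ⟨0, ⟨le_rfl, h1.1⟩, ⟨0, ⟨le_rfl, h2.1⟩, h0.symm⟩⟩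
  have := h1.eq_time h2 h0 ht ht' heq.symm
  subst this
  have htA : σ₁ t ∉ A := by
    intro hA'
    have e1 := ha' t ht hA'
    rw [← heq] at hA'
    have e2 := hb' t ht' hA'
    exact hne (by rw [← e1, ← e2, heq])
  have ht1 : t < l₁ := lt_of_le_of_ne ht.2 (fun hc => htA (hc ▸ ha))
  obtain ⟨S, hSA, hS⟩ := h.piece_geodesic A hA _ ha _ hb
  have s1 := h1.segment ht.1 ht.2 le_rfl
  have s3 := (h2.segment ht'.1 ht'.2 le_rfl).symm
  rw [heq] at s3
  obtain ⟨x1, x2, hx⟩ : σ₁ l₁ ∈ S ∧ σ₂ l₂ ∈ S ∧ True := by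
    obtain ⟨σ, hσ, hσ0, hσ1, rfl⟩ := hS.exists_param
    exact ⟨⟨0, ⟨le_rfl, dist_nonneg⟩, hσ0⟩, ⟨_, ⟨dist_nonneg, le_rfl⟩, hσ1⟩, trivial⟩
  refine Exists.elim (h.triangle _ _ _ _ _ _ s1 hS s3 ?_ ?_ ?_) ?_
  pick_goal 4
  · rintro B ⟨hB, hsub⟩
    have b1 : σ₁ l₁ ∈ B := hsub (Or.inl (Or.inr x1))
    have b2 : σ₂ l₂ ∈ B := hsub (Or.inl (Or.inr x2))
    have b3 : σ₁ t ∈ B := hsub (Or.inl (Or.inl ⟨t, ⟨le_rfl, ht.2⟩, rfl⟩))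
    rw [h.piece_eq hA hB hne ha hb b1 b2] at htA
    exact htA b3
  · refine Subset.antisymm ?_ ?_
    · rintro _ ⟨⟨τ, hτ, rfl⟩, hS'⟩
      rw [ha' τ ⟨ht.1.trans hτ.1, hτ.2⟩ (hSA hS')]; rfl
    · rintro _ rfl
      exact ⟨⟨l₁, ⟨ht.2, le_rfl⟩, rfl⟩, x1⟩
  · refine Subset.antisymm ?_ ?_
    · rintro _ ⟨hS', ⟨τ, hτ, rfl⟩⟩
      rw [hb' τ ⟨ht.1.trans hτ.1, hτ.2⟩ (hSA hS')]; rfl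
    · rintro _ rfl
      exact ⟨x2, ⟨l₂, ⟨ht'.2, le_rfl⟩, rfl⟩⟩
  · refine Subset.antisymm ?_ ?_
    · rintro _ ⟨⟨τ', hτ', rfl⟩, ⟨τ, hτ, heq'⟩⟩
      have hτm : τ ∈ Icc 0 l₁ := ⟨ht.1.trans hτ.1, hτ.2⟩
      have hτ'm : τ' ∈ Icc 0 l₂ := ⟨ht.1.trans hτ'.1, hτ'.2⟩
      have := hmax ⟨hτm, ⟨τ', hτ'm, heq'.symm⟩⟩
      rw [← heq', le_antisymm this hτ.1]; rfl
    · rintro _ rfl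
      exact ⟨⟨t, ⟨le_rfl, ht'.2⟩, heq⟩, ⟨t, ⟨le_rfl, ht.2⟩, rfl⟩⟩

theorem exists_first_hit (h : IsTreeGraded 𝓟) {A : Set X} (hA : A ∈ 𝓟) {σ : ℝ → X} {l : ℝ}
    (hσ : IsGeodesicOn σ l) (hl : σ l ∈ A) :
    ∃ t ∈ Icc 0 l, σ t ∈ A ∧ ∀ t' ∈ Icc 0 t, σ t' ∈ A → t' = t := by
  have hE : IsClosed (Icc 0 l ∩ σ ⁻¹' A) :=
    hσ.continuousOn.preimage_isClosed_of_isClosed isClosed_Icc (h.piece_closed A hA)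
  obtain ⟨t, ⟨ht, htA⟩, hmin⟩ := (isCompact_Icc.of_isClosed_subset hE
    inter_subset_left).exists_isLeast ⟨l, ⟨hσ.1, le_rfl⟩, hl⟩
  exact ⟨t, ht, htA, fun t' ht' hA' =>
    le_antisymm ht'.2 (hmin ⟨⟨ht'.1, ht'.2.trans ht.2⟩, hA'⟩)⟩

/-- `e` is the gate of `x` in the piece `A`: each geodesic from `x` to `A` enters `A` at `e`. -/
def _root_.TreeGr.IsGate (A : Set X) (x e : X) : Prop :=
  e ∈ A ∧ (∀ a ∈ A, Btw x e a) ∧ ∀ a ∈ A, ∀ w, Btw x w a → w ∈ A ∨ Btw x w e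

/-- By `first_hit_unique` a geodesic to a point of `A`, chosen to run through `w`, enters `A` at `σ
l`. If `w` comes later it is in `A` by convexity, otherwise it lies on the part before the entrance.
-/
theorem isGate_of_geodesic (h : IsTreeGraded 𝓟) {A : Set X} (hA : A ∈ 𝓟) {σ : ℝ → X} {l : ℝ}
    (hσ : IsGeodesicOn σ l) (hl : σ l ∈ A) (hl' : ∀ t ∈ Icc 0 l, σ t ∈ A → t = l) :
    IsGate A (σ 0) (σ l) := by
  have key : ∀ a ∈ A, ∀ w, Btw (σ 0) w a → Btw (σ 0) (σ l) a ∧ (w ∈ A ∨ Btw (σ 0) w (σ l)) := by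
    intro a ha w hw
    obtain ⟨γ, hγ, h0, hm, hγl⟩ := h.exists_geodesic_through hw
    obtain ⟨t, ht, htA, hmin⟩ := h.exists_first_hit hA hγ (by rwa [hγl])
    have := h.first_hit_unique hA (hγ.mono ht.1 ht.2) hσ h0 htA hl hmin hl'
    rw [← this]
    refine ⟨?_, ?_⟩
    · have := hγ.btw le_rfl ht.1 ht.2 le_rfl
      rwa [h0, hγl] at this
    rcases le_total t (dist (σ 0) w) with h2 | h2
    · left
      have := hγ.btw ht.1 h2 hw.dist_le le_rfl
      rw [hγl, hm] at this
      exact h.piece_convex hA htA ha this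
    · right
      have := hγ.btw le_rfl dist_nonneg h2 ht.2
      rwa [h0, hm] at this
  exact ⟨hl, fun a ha => (key a ha _ (btw_left _ _)).1, fun a ha w hw => (key a ha w hw).2⟩

theorem exists_gate (h : IsTreeGraded 𝓟) {A : Set X} (hA : A ∈ 𝓟) (hne : A.Nonempty) (x : X) :
    ∃ e, IsGate A x e := by
  obtain ⟨a, ha⟩ := hne
  obtain ⟨σ, hσ, h0, hl⟩ := h.exists_geodesic x a
  obtain ⟨t, ht, htA, hmin⟩ := h.exists_first_hit hA hσ (by rwa [hl])
  have := h.isGate_of_geodesic hA (hσ.mono ht.1 ht.2) htA hmin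
  rw [h0] at this
  exact ⟨_, this⟩

end IsTreeGraded

/-! ### Directions -/

/-- `y` and `z` lie in the same direction from `p`. -/
def SameDir {X : Type u} [MetricSpace X] (𝓟 : Set (Set X)) (p y z : X) : Prop :=
  ∃ y' z', y' ≠ p ∧ Btw p y' y ∧ Btw p z' z ∧ dist p y' = dist p z' ∧ ∃ A ∈ 𝓟, y' ∈ A ∧ z' ∈ A

/-- `p` separates `y` from `z`. -/
def Sep {X : Type u} [MetricSpace X] (𝓟 : Set (Set X)) (p y z : X) : Prop :=
  y ≠ p ∧ z ≠ p ∧ ¬ SameDir 𝓟 p y z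

namespace IsTreeGraded

variable {X : Type u} [MetricSpace X] {𝓟 : Set (Set X)}

/-- Suppose that `σ` misses `p`. The part of `σ` from its last point on a geodesic from `p` to `y`
up to the next point on a geodesic from `p` to `z` closes up to a simple triangle with vertex `p`.
The piece containing it has points of both geodesics at the same small distance from `p`, so the
directions agree. -/
theorem sep_mem_geodesic (h : IsTreeGraded 𝓟) {p y z : X} (hs : Sep 𝓟 p y z) {σ : ℝ → X} {l : ℝ}
    (hσ : IsGeodesicOn σ l) (h0 : σ 0 = y) (hl : σ l = z) : ∃ t ∈ Icc 0 l, σ t = p := by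
  by_contra hp
  push Not at hp
  obtain ⟨hy, hz, hsd⟩ := hs
  obtain ⟨γ₁, g1, g10, g11⟩ := h.exists_geodesic p y
  obtain ⟨γ₂, g2, g20, g21⟩ := h.exists_geodesic p z
  have hsd' : ∀ t, 0 < t → t ≤ dist p y → t ≤ dist p z → ∀ A ∈ 𝓟, γ₁ t ∈ A → γ₂ t ∈ A → False := by
    intro t ht h1 h2 A hA hA1 hA2
    have e1 := g1.dist_zero ht.le h1
    have e2 := g2.dist_zero ht.le h2
    have e3 := g1.btw le_rfl ht.le h1 le_rfl
    have e4 := g2.btw le_rfl ht.le h2 le_rfl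
    rw [g10] at e1 e3; rw [g20] at e2 e4; rw [g11] at e3; rw [g21] at e4
    refine hsd ⟨γ₁ t, γ₂ t, ?_, e3, e4, by rw [e1, e2], A, hA, hA1, hA2⟩
    intro hc
    rw [hc, dist_self] at e1
    linarith
  have hmeet : ∀ t ∈ Icc 0 (dist p y), ∀ t' ∈ Icc 0 (dist p z), γ₁ t = γ₂ t' → t = 0 ∧ t' = 0 := by
    intro t ht t' ht' heq
    have := g1.eq_time g2 (by rw [g10, g20]) ht ht' heq
    subst this
    by_contra hne
    obtain ⟨A, hA, hA'⟩ := h.exists_piece (γ₁ t)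
    exact hsd' t (lt_of_le_of_ne ht.1 (fun h => hne ⟨h.symm, h.symm⟩)) ht.2 ht'.2 A hA hA'
      (heq ▸ hA')
  have hc1 : IsCompact (γ₁ '' Icc 0 (dist p y)) := isCompact_Icc.image_of_continuousOn g1.continuousOn
  have hc2 : IsCompact (γ₂ '' Icc 0 (dist p z)) := isCompact_Icc.image_of_continuousOn g2.continuousOn
  have hE1 : IsClosed (Icc 0 l ∩ σ ⁻¹' (γ₁ '' Icc 0 (dist p y))) :=
    hσ.continuousOn.preimage_isClosed_of_isClosed isClosed_Icc hc1.isClosed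
  obtain ⟨s₁, ⟨hs1, ⟨t₁, ht1, heq1⟩⟩, hmax⟩ := (isCompact_Icc.of_isClosed_subset hE1
    inter_subset_left).exists_isGreatest
      ⟨0, ⟨le_rfl, hσ.1⟩, ⟨_, ⟨dist_nonneg, le_rfl⟩, by rw [g11, h0]⟩⟩
  have hE2 : IsClosed (Icc 0 l ∩ σ ⁻¹' (γ₂ '' Icc 0 (dist p z))) :=
    hσ.continuousOn.preimage_isClosed_of_isClosed isClosed_Icc hc2.isClosed
  obtain ⟨s₂, ⟨hs12, ⟨hs2, ⟨t₂, ht2, heq2⟩⟩⟩, hmin⟩ :=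
    (isCompact_Icc.inter_right hE2 : IsCompact (Icc s₁ l ∩ _)).exists_isLeast
      ⟨l, ⟨hs1.2, le_rfl⟩, ⟨hσ.1, le_rfl⟩, ⟨_, ⟨dist_nonneg, le_rfl⟩, by rw [g21, hl]⟩⟩
  have ht10 : t₁ ≠ 0 := fun hc => hp s₁ hs1 (by rw [← heq1, hc, g10])
  have ht20 : t₂ ≠ 0 := fun hc => hp s₂ hs2 (by rw [← heq2, hc, g20])
  have c1 := g1.segment le_rfl ht1.1 ht1.2
  have c2 := hσ.segment hs1.1 hs12.1 hs2.2
  have c3 := (g2.segment le_rfl ht2.1 ht2.2).symm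
  rw [heq1, g10] at c1
  rw [heq2, g20] at c3
  refine Exists.elim (h.triangle _ _ _ _ _ _ c1 c2 c3 ?_ ?_ ?_) ?_
  pick_goal 4
  · rintro A ⟨hA, hsub⟩
    have hpos1 : 0 < t₁ := lt_of_le_of_ne ht1.1 (Ne.symm ht10)
    have hpos2 : 0 < t₂ := lt_of_le_of_ne ht2.1 (Ne.symm ht20)
    refine hsd' (min t₁ t₂) (lt_min hpos1 hpos2) ((min_le_left _ _).trans ht1.2)
      ((min_le_right _ _).trans ht2.2) A hA ?_ ?_
    · exact hsub (Or.inl (Or.inl ⟨_, ⟨(lt_min hpos1 hpos2).le, min_le_left _ _⟩, rfl⟩))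
    · exact hsub (Or.inr ⟨_, ⟨(lt_min hpos1 hpos2).le, min_le_right _ _⟩, rfl⟩)
  · refine Subset.antisymm ?_ ?_
    · rintro _ ⟨⟨t, ht, rfl⟩, ⟨τ, hτ, heq⟩⟩
      have := hmax ⟨⟨hs1.1.trans hτ.1, hτ.2.trans hs2.2⟩, ⟨t, ⟨ht.1, ht.2.trans ht1.2⟩, heq.symm⟩⟩
      rw [← heq, le_antisymm this hτ.1]; rfl
    · rintro _ rfl
      exact ⟨⟨t₁, ⟨ht1.1, le_rfl⟩, heq1⟩, ⟨s₁, ⟨le_rfl, hs12.1⟩, rfl⟩⟩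
  · refine Subset.antisymm ?_ ?_
    · rintro _ ⟨⟨τ, hτ, rfl⟩, ⟨t, ht, heq⟩⟩
      have := hmin ⟨⟨hτ.1, hτ.2.trans hs2.2⟩, ⟨hs1.1.trans hτ.1, hτ.2.trans hs2.2⟩,
        ⟨t, ⟨ht.1, ht.2.trans ht2.2⟩, heq⟩⟩
      rw [le_antisymm hτ.2 this]; rfl
    · rintro _ rfl
      exact ⟨⟨s₂, ⟨hs12.1, le_rfl⟩, rfl⟩, ⟨t₂, ⟨ht2.1, le_rfl⟩, heq2⟩⟩
  · refine Subset.antisymm ?_ ?_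
    · rintro _ ⟨⟨t', ht', rfl⟩, ⟨t, ht, heq⟩⟩
      have := hmeet t ⟨ht.1, ht.2.trans ht1.2⟩ t' ⟨ht'.1, ht'.2.trans ht2.2⟩ heq
      rw [this.2, g20]; rfl
    · rintro _ rfl
      exact ⟨⟨0, ⟨le_rfl, ht2.1⟩, g20⟩, ⟨0, ⟨le_rfl, ht1.1⟩, g10⟩⟩

theorem sep_btw (h : IsTreeGraded 𝓟) {p y z : X} (hs : Sep 𝓟 p y z) : Btw y p z := by
  obtain ⟨σ, hσ, h0, hl⟩ := h.exists_geodesic y z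
  obtain ⟨t, ht, rfl⟩ := h.sep_mem_geodesic hs hσ h0 hl
  have := hσ.btw le_rfl ht.1 ht.2 le_rfl
  rwa [h0, hl] at this

/-- Lying in a common piece is transitive among points at equal distance from `p`. -/
theorem common_piece_trans (h : IsTreeGraded 𝓟) {p x y z : X} (hxy : dist p x = dist p y)
    (hyz : dist p y = dist p z) {A B : Set X} (hA : A ∈ 𝓟) (hB : B ∈ 𝓟) (hxA : x ∈ A) (hyA : y ∈ A)
    (hyB : y ∈ B) (hzB : z ∈ B) : ∃ C ∈ 𝓟, x ∈ C ∧ z ∈ C := by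
  by_cases hAB : A = B
  · subst hAB; exact ⟨A, hA, hxA, hzB⟩
  obtain ⟨e, he⟩ := h.exists_gate hA ⟨y, hyA⟩ p
  obtain ⟨e', he'⟩ := h.exists_gate hB ⟨y, hyB⟩ p
  have hxy' : e = y → ∃ C ∈ 𝓟, x ∈ C ∧ z ∈ C := by
    rintro rfl
    have : e = x := (he.2.1 x hxA).eq_of_dist hxy.symm
    exact ⟨B, hB, this ▸ hyB, hzB⟩
  have hzy' : e' = y → ∃ C ∈ 𝓟, x ∈ C ∧ z ∈ C := by
    rintro rfl
    have : e' = z := (he'.2.1 z hzB).eq_of_dist hyz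
    exact ⟨A, hA, hxA, this ▸ hyA⟩
  -- On a geodesic from `p` to `y`, the later of the two gates lies in both pieces, so it is `y`. In
  -- the piece with gate `y`, a point as far from `p` as `y` can only be `y`.
  rcases he.2.2 y hyA e' (he'.2.1 y hyB) with h1 | h1
  · exact hzy' (h.inter_subsingleton A hA B hB hAB ⟨h1, he'.1⟩ ⟨hyA, hyB⟩)
  · have h2 : Btw e' e y := by
      have := he.2.1 y hyA
      exact this.trans_right h1
    have : e ∈ B := h.piece_convex hB he'.1 hyB h2
    exact hxy' (h.inter_subsingleton A hA B hB hAB ⟨he.1, this⟩ ⟨hyA, hyB⟩)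

/-- Lying in a common piece is inherited by earlier points at equal distance from `p`. -/
theorem common_piece_descend (h : IsTreeGraded 𝓟) {p a b y z : X} {A : Set X} (hA : A ∈ 𝓟)
    (ha : a ∈ A) (hb : b ∈ A) (hy : Btw p y a) (hz : Btw p z b) (hd : dist p y = dist p z) :
    ∃ C ∈ 𝓟, y ∈ C ∧ z ∈ C := by
  obtain ⟨e, he⟩ := h.exists_gate hA ⟨a, ha⟩ p
  rcases he.2.2 a ha y hy with h1 | h1 <;> rcases he.2.2 b hb z hz with h2 | h2
  · exact ⟨A, hA, h1, h2⟩
  · have : z = e := h2.eq_of_dist (le_antisymm h2.dist_le (hd ▸ (he.2.1 y h1).dist_le))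
    exact ⟨A, hA, h1, this ▸ he.1⟩
  · have : y = e := h1.eq_of_dist (le_antisymm h1.dist_le (hd ▸ (he.2.1 z h2).dist_le))
    exact ⟨A, hA, this ▸ he.1, h2⟩
  · exact h.bigon h1 h2 hd

/-- If `y, z` are in the same direction from `p`, so are all points close to `p` on geodesics. -/
theorem SameDir.common_piece (h : IsTreeGraded 𝓟) {p y z : X} (hs : SameDir 𝓟 p y z) :
    ∃ m > 0, m ≤ dist p y ∧ m ≤ dist p z ∧ ∀ y' z', Btw p y' y → Btw p z' z → dist p y' ≤ m →
      dist p y' = dist p z' → ∃ A ∈ 𝓟, y' ∈ A ∧ z' ∈ A := by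
  obtain ⟨a, b, hne, ha, hb, hd, A, hA, haA, hbA⟩ := hs
  refine ⟨dist p a, dist_pos.2 hne.symm, ha.dist_le, hd ▸ hb.dist_le, fun y' z' hy' hz' hm hd' => ?_⟩
  -- `y'` and `z'` are linked through `a'` and `b'`, at the same distance from `p` on the way to `a`
  -- and `b`: bigons give the outer links, the piece `A` the middle one.
  obtain ⟨a', ha', hda'⟩ := h.exists_btw p a dist_nonneg hm
  obtain ⟨b', hb', hdb'⟩ := h.exists_btw p b (m := dist p y') dist_nonneg (hd ▸ hm)
  obtain ⟨C, hC, hC1, hC2⟩ := h.common_piece_descend hA haA hbA ha' hb' (by rw [hda', hdb'])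
  obtain ⟨C', hC', hC1', hC2'⟩ := h.bigon hy' (ha.trans_left ha') hda'.symm
  obtain ⟨C'', hC'', hC1'', hC2''⟩ := h.bigon (hb.trans_left hb') hz' (by rw [hdb', hd'])
  obtain ⟨E, hE, hE1, hE2⟩ := h.common_piece_trans (p := p) hda'.symm (by rw [hda', hdb'])
    hC' hC hC1' hC2' hC1 hC2
  exact h.common_piece_trans (p := p) hdb'.symm (by rw [hdb', hd'])
    hE hC'' hE1 hE2 hC1'' hC2''

end IsTreeGraded

section Dir

variable {X : Type u} [MetricSpace X] {𝓟 : Set (Set X)}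

theorem SameDir.symm {p y z : X} (hs : SameDir 𝓟 p y z) : SameDir 𝓟 p z y := by
  obtain ⟨a, b, hne, ha, hb, hd, A, hA, haA, hbA⟩ := hs
  refine ⟨b, a, ?_, hb, ha, hd.symm, A, hA, hbA, haA⟩
  rintro rfl
  rw [dist_self] at hd
  exact hne (dist_eq_zero.1 hd).symm

theorem SameDir.ne_left {p y z : X} (hs : SameDir 𝓟 p y z) : y ≠ p := by
  obtain ⟨a, b, hne, ha, hb, -⟩ := hs
  rintro rfl
  exact hne (btw_self_iff.1 ha)

theorem SameDir.ne_right {p y z : X} (hs : SameDir 𝓟 p y z) : z ≠ p := hs.symm.ne_left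

theorem Sep.symm {p y z : X} (hs : Sep 𝓟 p y z) : Sep 𝓟 p z y :=
  ⟨hs.2.1, hs.1, fun h => hs.2.2 h.symm⟩

theorem not_sep_iff {p y z : X} (hy : y ≠ p) (hz : z ≠ p) : ¬ Sep 𝓟 p y z ↔ SameDir 𝓟 p y z := by
  simp [Sep, hy, hz]

end Dir

namespace IsTreeGraded

variable {X : Type u} [MetricSpace X] {𝓟 : Set (Set X)}

theorem sameDir_of_btw (h : IsTreeGraded 𝓟) {p y z : X} (hy : y ≠ p) (hb : Btw p y z) :
    SameDir 𝓟 p y z := by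
  obtain ⟨A, hA, hA'⟩ := h.exists_piece y
  exact ⟨y, y, hy, btw_right _ _, hb, rfl, A, hA, hA', hA'⟩

theorem sameDir_refl (h : IsTreeGraded 𝓟) {p y : X} (hy : y ≠ p) : SameDir 𝓟 p y y :=
  h.sameDir_of_btw hy (btw_right _ _)

theorem sameDir_trans (h : IsTreeGraded 𝓟) {p x y z : X} (h1 : SameDir 𝓟 p x y)
    (h2 : SameDir 𝓟 p y z) : SameDir 𝓟 p x z := by
  obtain ⟨m, hm, hmx, hmy, H⟩ := SameDir.common_piece h h1
  obtain ⟨m', hm', hmy', hmz, H'⟩ := SameDir.common_piece h h2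
  have hpos : 0 < min m m' := lt_min hm hm'
  have l1 : min m m' ≤ m := min_le_left _ _
  have l2 : min m m' ≤ m' := min_le_right _ _
  obtain ⟨x', hx', dx⟩ := h.exists_btw p x hpos.le (l1.trans hmx)
  obtain ⟨y', hy', dy⟩ := h.exists_btw p y hpos.le (l1.trans hmy)
  obtain ⟨z', hz', dz⟩ := h.exists_btw p z hpos.le (l2.trans hmz)
  obtain ⟨A, hA, hA1, hA2⟩ := H x' y' hx' hy' (dx ▸ l1) (by rw [dx, dy])
  obtain ⟨B, hB, hB1, hB2⟩ := H' y' z' hy' hz' (dy ▸ l2) (by rw [dy, dz])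
  obtain ⟨C, hC, hC1, hC2⟩ := h.common_piece_trans (p := p) (by rw [dx, dy]) (by rw [dy, dz])
    hA hB hA1 hA2 hB1 hB2
  refine ⟨x', z', ?_, hx', hz', by rw [dx, dz], C, hC, hC1, hC2⟩
  rintro rfl
  rw [dist_self] at dx
  linarith

theorem sep_of_sep_sameDir (h : IsTreeGraded 𝓟) {p x y z : X} (h1 : Sep 𝓟 p x y)
    (h2 : SameDir 𝓟 p y z) : Sep 𝓟 p x z :=
  ⟨h1.1, h2.ne_right, fun h3 => h1.2.2 (h.sameDir_trans h3 h2.symm)⟩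

/-- `Sep` depends only on directions. -/
theorem sep_congr (h : IsTreeGraded 𝓟) {p y z y' z' : X} (h1 : SameDir 𝓟 p y y')
    (h2 : SameDir 𝓟 p z z') : Sep 𝓟 p y z ↔ Sep 𝓟 p y' z' :=
  ⟨fun hs => h.sep_of_sep_sameDir (h.sep_of_sep_sameDir hs h2).symm h1 |>.symm,
    fun hs => h.sep_of_sep_sameDir (h.sep_of_sep_sameDir hs h2.symm).symm h1.symm |>.symm⟩

theorem sep_or_sep (h : IsTreeGraded 𝓟) {p x y z : X} (h1 : Sep 𝓟 p x z) (hy : y ≠ p) :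
    Sep 𝓟 p x y ∨ Sep 𝓟 p y z := by
  by_contra hc
  rw [not_or, not_sep_iff h1.1 hy, not_sep_iff hy h1.2.1] at hc
  exact h1.2.2 (h.sameDir_trans hc.1 hc.2)

/-- Otherwise `p` would lie between `y` and `z`, at distance `dist p y` from `y`. Consequently
directions, and with them `Sep`, do not change under small displacements. -/
theorem sameDir_of_dist_lt (h : IsTreeGraded 𝓟) {p y z : X} (hd : dist y z < dist p y) :
    SameDir 𝓟 p y z := by
  have hy : y ≠ p := by
    rintro rfl
    rw [dist_self] at hd
    exact absurd hd (not_lt.2 dist_nonneg)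
  have hz : z ≠ p := by
    rintro rfl
    rw [dist_comm] at hd
    exact lt_irrefl _ hd
  by_contra hc
  have : dist y p + dist p z = dist y z := h.sep_btw ⟨hy, hz, hc⟩
  rw [dist_comm y p] at this
  have : 0 ≤ dist p z := dist_nonneg
  linarith

/-- If the directions differed, `q` would lie between `y` and `z`, hence in `A`; but then initial
points of geodesics from `q` to both lie in `A`, and the directions agree. -/
theorem sameDir_of_mem_piece (h : IsTreeGraded 𝓟) {A : Set X} (hA : A ∈ 𝓟) {q y z : X}
    (hyA : y ∈ A) (hzA : z ∈ A) (hy : y ≠ q) (hz : z ≠ q) : SameDir 𝓟 q y z := by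
  by_contra hc
  have hq : q ∈ A := h.piece_convex hA hyA hzA (h.sep_btw ⟨hy, hz, hc⟩)
  have hpos : 0 < min (dist q y) (dist q z) := lt_min (dist_pos.2 hy.symm) (dist_pos.2 hz.symm)
  obtain ⟨y', hy', dy⟩ := h.exists_btw q y hpos.le (min_le_left _ _)
  obtain ⟨z', hz', dz⟩ := h.exists_btw q z hpos.le (min_le_right _ _)
  refine hc ⟨y', z', ?_, hy', hz', by rw [dy, dz], A, hA, h.piece_convex hA hq hyA hy',
    h.piece_convex hA hq hzA hz'⟩
  rintro rfl
  rw [dist_self] at dy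
  linarith

theorem not_sep_of_mem_piece (h : IsTreeGraded 𝓟) {A : Set X} (hA : A ∈ 𝓟) {q y z : X}
    (hyA : y ∈ A) (hzA : z ∈ A) : ¬ Sep 𝓟 q y z :=
  fun hs => hs.2.2 (h.sameDir_of_mem_piece hA hyA hzA hs.1 hs.2.1)

/-- The gate of `a` in `A` separates `a` from the other points of `A`. -/
theorem gate_sep (h : IsTreeGraded 𝓟) {A : Set X} (hA : A ∈ 𝓟) {a e b : X} (haA : a ∉ A)
    (he : IsGate A a e) (hb : b ∈ A) (hbe : b ≠ e) : Sep 𝓟 e a b := by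
  refine ⟨fun hc => haA (hc ▸ he.1), hbe, ?_⟩
  rintro ⟨a', b', hne, ha', hb', hd, B, hB, haB, hbB⟩
  have hb'A := h.piece_convex hA he.1 hb hb'
  have h1 : Btw a e b' := he.2.1 b' hb'A
  have h2 : Btw a' e b' := h1.trans_right ha'.symm
  have heB := h.piece_convex hB haB hbB h2
  have hb'e : e ≠ b' := by
    rintro rfl
    rw [dist_self] at hd
    exact hne (dist_eq_zero.1 hd).symm
  have := h.piece_eq hA hB hb'e he.1 hb'A heB hbB
  subst this
  exact hne (ha'.symm.antisymm (he.2.1 a' haB))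

theorem sep_sameDir_back (h : IsTreeGraded 𝓟) {p q y : X} (hs : Sep 𝓟 p q y) :
    SameDir 𝓟 q p y :=
  h.sameDir_of_btw hs.1.symm (h.sep_btw hs)

end IsTreeGraded

theorem Btw.trans_inner {X : Type u} [MetricSpace X] {x v w z : X} (h : Btw x v z)
    (h' : Btw v w x) : Btw w v z := by
  unfold Btw at *
  have := dist_triangle x w z
  have := dist_triangle w v z
  rw [dist_comm v x, dist_comm v w, dist_comm w x] at h'
  linarith

/-! ### Saturated subsets -/

section Saturated

variable {X : Type u} [MetricSpace X] {𝓟 : Set (Set X)}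

/-- `D` contains the points separating two of its points and the pieces that it meets in more than
one point. -/
structure Saturated (𝓟 : Set (Set X)) (D : Set X) : Prop where
  cut : ∀ y ∈ D, ∀ z ∈ D, ∀ q, Sep 𝓟 q y z → q ∈ D
  piece : ∀ A ∈ 𝓟, ∀ a ∈ A, ∀ b ∈ A, a ∈ D → b ∈ D → a ≠ b → A ⊆ D

theorem saturated_singleton (h : IsTreeGraded 𝓟) (p : X) : Saturated 𝓟 {p} where
  cut := by
    rintro _ rfl _ rfl q ⟨h1, _, h2⟩
    exact absurd (h.sameDir_refl h1) h2
  piece := by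
    rintro A _ a _ b _ rfl rfl h
    exact absurd rfl h

theorem saturated_of_piece (h : IsTreeGraded 𝓟) {A : Set X} (hA : A ∈ 𝓟) : Saturated 𝓟 A where
  cut := fun _ hy _ hz _ hs => absurd hs (h.not_sep_of_mem_piece hA hy hz)
  piece := fun B hB a ha b hb haA hbA hne => by
    rw [h.piece_eq hB hA hne ha hb haA hbA]

/-- A point `q ≠ p` that separates two points separates one of them from `p`, so only one of the
sets `D i` is involved. No piece can contain points of two different sets away from `p`, as points
of one piece are never separated. -/
theorem saturated_wedge (h : IsTreeGraded 𝓟) {ι : Type*} {D : ι → Set X} {p : X}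
    (hp : ∀ i, p ∈ D i) (hD : ∀ i, Saturated 𝓟 (D i))
    (hs : ∀ i j, i ≠ j → ∀ y ∈ D i, ∀ z ∈ D j, y ≠ p → z ≠ p → Sep 𝓟 p y z) :
    Saturated 𝓟 (⋃ i, D i) where
  cut := by
    intro y hy z hz q hq
    obtain ⟨i, hy⟩ := mem_iUnion.1 hy
    obtain ⟨j, hz⟩ := mem_iUnion.1 hz
    by_cases hqp : q = p
    · subst hqp; exact mem_iUnion.2 ⟨i, hp i⟩
    rcases h.sep_or_sep hq (Ne.symm hqp) with h1 | h1
    · exact mem_iUnion.2 ⟨i, (hD i).cut _ hy _ (hp i) _ h1⟩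
    · exact mem_iUnion.2 ⟨j, (hD j).cut _ (hp j) _ hz _ h1⟩
  piece := by
    intro A hA a haA b hbA ha hb hab
    obtain ⟨i, ha⟩ := mem_iUnion.1 ha
    obtain ⟨j, hb⟩ := mem_iUnion.1 hb
    by_cases hbp : b = p
    · subst hbp
      exact ((hD i).piece A hA a haA b hbA ha (hp i) hab).trans (subset_iUnion D i)
    by_cases hap : a = p
    · subst hap
      exact ((hD j).piece A hA a haA b hbA (hp j) hb hab).trans (subset_iUnion D j)
    by_cases hij : i = j
    · subst hij
      exact ((hD i).piece A hA a haA b hbA ha hb hab).trans (subset_iUnion D i)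
    · exact absurd (hs i j hij a ha b hb hap hbp) (h.not_sep_of_mem_piece hA haA hbA)

theorem exists_approx {D : Set X} {y : X} (hy : y ∈ closure D) {ε : ℝ} (hε : 0 < ε) :
    ∃ z ∈ D, dist y z < ε := Metric.mem_closure_iff.1 hy ε hε

theorem sep_approx (h : IsTreeGraded 𝓟) {q y z y' z' : X} (hy : dist y y' < dist q y)
    (hz : dist z z' < dist q z) : Sep 𝓟 q y z ↔ Sep 𝓟 q y' z' :=
  h.sep_congr (h.sameDir_of_dist_lt hy) (h.sameDir_of_dist_lt hz)

/-- Separation is stable under small displacements, which settles `cut`. For a piece with two points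
in `D'`, the gates of nearby points of `D` are two distinct points of the piece that belong to `D`.
-/
theorem Saturated.closure (h : IsTreeGraded 𝓟) {D D' : Set X} (hD : Saturated 𝓟 D)
    (hDD' : D ⊆ D') (hD' : D' ⊆ closure D) : Saturated 𝓟 D' where
  cut := by
    intro y hy z hz q hq
    obtain ⟨y', hy', hyd⟩ := exists_approx (hD' hy) (dist_pos.2 hq.1.symm)
    obtain ⟨z', hz', hzd⟩ := exists_approx (hD' hz) (dist_pos.2 hq.2.1.symm)
    exact hDD' (hD.cut y' hy' z' hz' q ((sep_approx h hyd hzd).1 hq))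
  piece := by
    intro A hA a haA b hbA ha hb hab
    have hpos : 0 < dist a b / 2 := half_pos (dist_pos.2 hab)
    obtain ⟨a', ha', had⟩ := exists_approx (hD' ha) hpos
    obtain ⟨b', hb', hbd⟩ := exists_approx (hD' hb) hpos
    obtain ⟨e, he⟩ := h.exists_gate hA ⟨a, haA⟩ a'
    obtain ⟨e', he'⟩ := h.exists_gate hA ⟨a, haA⟩ b'
    have hda : dist e a ≤ dist a a' := by
      rw [dist_comm e, dist_comm a a']; exact (he.2.1 a haA).symm.dist_le.trans_eq (dist_comm _ _)
    have hdb : dist e' b ≤ dist b b' := by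
      rw [dist_comm e', dist_comm b b']; exact (he'.2.1 b hbA).symm.dist_le.trans_eq (dist_comm _ _)
    have hne : e ≠ e' := by
      rintro rfl
      have := dist_triangle a e b
      rw [dist_comm a e] at this
      linarith
    -- If `a'` is outside `A`, its gate `e` separates it from `e'`, and `b'` lies in the direction
    -- of `e'` from `e`; so `e` is a cut point between two points of `D`.
    have key : ∀ {a' b' e e' : X}, a' ∈ D → b' ∈ D → IsGate A a' e → IsGate A b' e' → e ≠ e' →
        e ∈ D := by
      intro a' b' e e' ha' hb' he he' hne
      by_cases haA' : a' ∈ A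
      · have := (he.2.1 a' haA')
        rw [btw_self_iff] at this
        rwa [this]
      · have s1 := h.gate_sep hA haA' he he'.1 hne.symm
        have s2 := h.sameDir_of_btw hne.symm (he'.2.1 e he.1).symm
        exact hD.cut _ ha' _ hb' _ (h.sep_of_sep_sameDir s1 s2)
    exact (hD.piece A hA e he.1 e' he'.1 (key ha' hb' he he' hne)
      (key hb' ha' he' he hne.symm) hne).trans hDD'

/-- A saturated set with points in the direction of `y` contains a non-trivial point on the way
to `y`. -/
theorem Saturated.exists_btw (h : IsTreeGraded 𝓟) {D : Set X} (hD : Saturated 𝓟 D) {p y z : X}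
    (hp : p ∈ D) (hz : z ∈ D) (hs : SameDir 𝓟 p y z) : ∃ w ∈ D, w ≠ p ∧ Btw p w y := by
  have case1 : ∀ A ∈ 𝓟, ∀ z' ∈ A, p ∈ A → z' ≠ p → Btw p z' z → A ⊆ D := by
    intro A hA z' hz' hpA hne hb
    by_cases hzA : z ∈ A
    · exact hD.piece A hA p hpA z hzA hp hz hs.ne_right.symm
    obtain ⟨e, he⟩ := h.exists_gate hA ⟨p, hpA⟩ z
    have hep : p ≠ e := by
      rintro rfl
      exact hne ((he.2.1 z' hz').antisymm hb.symm).symm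
    have heD := hD.cut z hz p hp e (h.gate_sep hA hzA he hpA hep)
    exact hD.piece A hA p hpA e he.1 hp heD hep
  obtain ⟨y', z', hne, hy', hz', hd, A, hA, hyA, hzA⟩ := hs
  have hne' : z' ≠ p := by
    rintro rfl
    rw [dist_self] at hd
    exact hne (dist_eq_zero.1 hd).symm
  by_cases hpA : p ∈ A
  · exact ⟨y', case1 A hA z' hzA hpA hne' hz' hyA, hne, hy'⟩
  obtain ⟨e, he⟩ := h.exists_gate hA ⟨y', hyA⟩ p
  have hep : e ≠ p := fun hc => hpA (hc ▸ he.1)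
  have hey : Btw p e y := hy'.trans_left (he.2.1 y' hyA)
  have hez : Btw p e z := hz'.trans_left (he.2.1 z' hzA)
  by_cases hec : e = z'
  -- In this case the gate of `p` is `z'`, which may fail to separate `p` from `z`. Then some piece
  -- `B` through `e` reaches towards both `p` and `z`; either `p` is in `B`, or the gate of `p` in
  -- `B` is a cut point between `p` and `z`.
  · by_cases hsep : Sep 𝓟 e p z
    · exact ⟨e, hD.cut p hp z hz e hsep, hep, hey⟩
    by_cases hze : z = e
    · exact ⟨e, hze ▸ hz, hep, hey⟩
    rw [not_sep_iff hep.symm hze] at hsep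
    obtain ⟨p1, z1, hne1, hp1, hz1, hd1, B, hB, hpB, hzB⟩ := hsep
    have hpe : Btw p1 e z1 :=
      (((hez.trans_inner hp1).symm).trans_inner hz1).symm
    have heB := h.piece_convex hB hpB hzB hpe
    by_cases hpB' : p ∈ B
    · exact ⟨e, case1 B hB e heB hpB' hep hez heB, hep, hey⟩
    obtain ⟨e2, he2⟩ := h.exists_gate hB ⟨e, heB⟩ p
    have hne2 : e ≠ e2 := by
      rintro rfl
      exact hne1 ((he2.2.1 p1 hpB).antisymm hp1.symm).symm
    have hb2 := he2.2.1 e heB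
    have s1 := h.gate_sep hB hpB' he2 heB hne2
    have s2 := h.sameDir_of_btw hne2 (hez.trans_right hb2)
    refine ⟨e2, hD.cut p hp z hz e2 (h.sep_of_sep_sameDir s1 s2), fun hc => hpB' (hc ▸ he2.1), ?_⟩
    exact hey.trans_left hb2
  · have s1 := h.gate_sep hA hpA he hzA (Ne.symm hec)
    have s2 := h.sameDir_of_btw (Ne.symm hec) (hz'.trans_right (he.2.1 z' hzA))
    exact ⟨e, hD.cut p hp z hz e (h.sep_of_sep_sameDir s1 s2), hep, hey⟩

/-- This compensates for the non-uniqueness of geodesics. By `bigon`, `v` and `w` share a piece `C`;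
the set `D` contains `w` and a second point of `C`, namely `p` or the gate of `p`, hence all of `C`.
-/
theorem Saturated.mem_of_btw (h : IsTreeGraded 𝓟) {D : Set X} (hD : Saturated 𝓟 D) {p w v y : X}
    (hp : p ∈ D) (hw : w ∈ D) (hwy : Btw p w y) (hvy : Btw p v y) (hd : dist p v = dist p w) :
    v ∈ D := by
  by_cases hvw : v = w
  · exact hvw ▸ hw
  obtain ⟨C, hC, hvC, hwC⟩ := h.bigon hvy hwy hd
  by_cases hpC : p ∈ C
  · have hpw : p ≠ w := by
      rintro rfl
      rw [dist_self] at hd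
      exact hvw (dist_eq_zero.1 hd).symm
    exact hD.piece C hC p hpC w hwC hp hw hpw hvC
  obtain ⟨f, hf⟩ := h.exists_gate hC ⟨v, hvC⟩ p
  have hfw : w ≠ f := by
    rintro rfl
    exact hvw ((hf.2.1 v hvC).eq_of_dist hd.symm).symm
  have hfD := hD.cut p hp w hw f (h.gate_sep hC hpC hf hwC hfw)
  exact hD.piece C hC f hf.1 w hwC hfD hw hfw.symm hvC

/-- A closed saturated set meeting all directions at its points is the whole space. -/
theorem Saturated.eq_univ (h : IsTreeGraded 𝓟) {D : Set X} (hD : Saturated 𝓟 D) (hc : IsClosed D)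
    (hne : D.Nonempty) (hfull : ∀ p ∈ D, ∀ y, y ≠ p → ∃ z ∈ D, SameDir 𝓟 p z y) : D = univ := by
  obtain ⟨o, ho⟩ := hne
  refine eq_univ_of_forall fun y => ?_
  by_contra hy
  obtain ⟨γ, hγ, h0, hl⟩ := h.exists_geodesic o y
  have hE : IsClosed (Icc 0 (dist o y) ∩ γ ⁻¹' D) :=
    hγ.continuousOn.preimage_isClosed_of_isClosed isClosed_Icc hc
  -- At the last time in `D` the direction of `y` still occurs in `D`, which puts a later point of
  -- the geodesic into `D`.
  obtain ⟨t, ⟨ht, htD⟩, hmax⟩ := (isCompact_Icc.of_isClosed_subset hE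
    inter_subset_left).exists_isGreatest ⟨0, ⟨le_rfl, dist_nonneg⟩, by rwa [mem_preimage, h0]⟩
  have hyt : y ≠ γ t := fun hc => hy (hc ▸ htD)
  obtain ⟨z, hz, hs⟩ := hfull _ htD y hyt
  obtain ⟨w, hw, hwp, hwb⟩ := hD.exists_btw h htD hz hs.symm
  have hd : dist (γ t) y = dist o y - t := by
    have := hγ.dist_le ht.1 ht.2 le_rfl
    rwa [hl] at this
  have hpos : 0 < dist (γ t) w := dist_pos.2 hwp.symm
  have hle := hwb.dist_le
  have hv1 := hγ.dist_le ht.1 (by linarith : t ≤ t + dist (γ t) w) (by linarith)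
  have hv2 := hγ.btw ht.1 (by linarith : t ≤ t + dist (γ t) w) (by linarith) le_rfl
  rw [hl] at hv2
  have hv := hD.mem_of_btw h htD hw hwb hv2 (by linarith)
  have := hmax ⟨⟨by linarith [ht.1], by linarith⟩, hv⟩
  linarith

end Saturated

/-! ### Partial bilipschitz equivalences -/

section Partial

variable {F G : Type u} [MetricSpace F] [MetricSpace G] {𝓕 : Set (Set F)} {𝓖 : Set (Set G)}
  {k : ℝ} {surj : Prop}

/-- `R` is the graph of a `k`-bilipschitz bijection between saturated subsets which preserves
separation. -/
structure PartialEquiv (𝓕 : Set (Set F)) (𝓖 : Set (Set G)) (k : ℝ) (R : Set (F × G)) : Prop where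
  one_le : 1 ≤ k
  bilip : ∀ a ∈ R, ∀ b ∈ R, k⁻¹ * dist a.1 b.1 ≤ dist a.2 b.2 ∧ dist a.2 b.2 ≤ k * dist a.1 b.1
  sep : ∀ p ∈ R, ∀ y ∈ R, ∀ z ∈ R, Sep 𝓕 p.1 y.1 z.1 ↔ Sep 𝓖 p.2 y.2 z.2
  dom : Saturated 𝓕 (Prod.fst '' R)
  ran : Saturated 𝓖 (Prod.snd '' R)

/-- There are at most two directions at `p` in `R`. -/
def Thin (𝓕 : Set (Set F)) (R : Set (F × G)) (p : F × G) : Prop :=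
  ∀ x ∈ R, ∀ y ∈ R, ∀ z ∈ R, ¬ (Sep 𝓕 p.1 x.1 y.1 ∧ Sep 𝓕 p.1 y.1 z.1 ∧ Sep 𝓕 p.1 x.1 z.1)

/-- All directions at `p` occur in `R`; if `surj` holds, on both sides. -/
def Full (𝓕 : Set (Set F)) (𝓖 : Set (Set G)) (surj : Prop) (R : Set (F × G)) (p : F × G) : Prop :=
  (∀ y, y ≠ p.1 → ∃ z ∈ R, SameDir 𝓕 p.1 z.1 y) ∧
    (surj → ∀ y, y ≠ p.2 → ∃ z ∈ R, SameDir 𝓖 p.2 z.2 y)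

/-- The partial equivalences used to build the map. -/
structure Admissible (𝓕 : Set (Set F)) (𝓖 : Set (Set G)) (k : ℝ) (surj : Prop)
    (R : Set (F × G)) : Prop extends PartialEquiv 𝓕 𝓖 k R where
  nonempty : R.Nonempty
  thin_or_full : ∀ p ∈ R, Thin 𝓕 R p ∨ Full 𝓕 𝓖 surj R p

theorem eq_iff_of_bilip (hk : 1 ≤ k) {a b : F × G}
    (h : k⁻¹ * dist a.1 b.1 ≤ dist a.2 b.2 ∧ dist a.2 b.2 ≤ k * dist a.1 b.1) :
    a.1 = b.1 ↔ a.2 = b.2 := by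
  rw [← dist_eq_zero, ← dist_eq_zero (x := a.2)]
  have hk' : 0 < k⁻¹ := inv_pos.2 (by linarith)
  have h0 : 0 ≤ dist a.1 b.1 := dist_nonneg
  have h1 : 0 ≤ dist a.2 b.2 := dist_nonneg
  constructor
  · intro h2; rw [h2] at h; linarith [h.2]
  · intro h2; rw [h2] at h
    exact le_antisymm (nonpos_of_mul_nonpos_right h.1 hk') h0

theorem PartialEquiv.eq_iff {R : Set (F × G)} (hR : PartialEquiv 𝓕 𝓖 k R) {a b : F × G}
    (ha : a ∈ R) (hb : b ∈ R) : a.1 = b.1 ↔ a.2 = b.2 :=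
  eq_iff_of_bilip hR.one_le (hR.bilip a ha b hb)

theorem PartialEquiv.eq_of_fst {R : Set (F × G)} (hR : PartialEquiv 𝓕 𝓖 k R) {a b : F × G}
    (ha : a ∈ R) (hb : b ∈ R) (h : a.1 = b.1) : a = b :=
  Prod.ext h ((hR.eq_iff ha hb).1 h)

/-! ### Gluing partial equivalences at a common point. -/

section Wedge

variable {ι : Type*} {R : ι → Set (F × G)} {p : F × G}

/-- From `q ≠ p` in `R i`, every point of another `R j` is seen in the direction of `p`, on both
sides. So each question about directions at `q` in the union reduces to `R i`, with `p` as a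
substitute. -/
theorem wedge_hat (hF : IsTreeGraded 𝓕) (hG : IsTreeGraded 𝓖)
    (hR : ∀ i, PartialEquiv 𝓕 𝓖 k (R i)) (hp : ∀ i, p ∈ R i)
    (hs : ∀ i j, i ≠ j → ∀ y ∈ R i, ∀ z ∈ R j, y.1 ≠ p.1 → z.1 ≠ p.1 →
      Sep 𝓕 p.1 y.1 z.1 ∧ Sep 𝓖 p.2 y.2 z.2) {i : ι} {q y : F × G} (hq : q ∈ R i)
    (hqp : q.1 ≠ p.1) (hy : y ∈ ⋃ i, R i) :
    ∃ y' ∈ R i, (y.1 = q.1 ↔ y.2 = q.2) ∧ (y'.1 = q.1 ↔ y.1 = q.1) ∧ (y.1 ≠ q.1 →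
      SameDir 𝓕 q.1 y.1 y'.1 ∧ SameDir 𝓖 q.2 y.2 y'.2) := by
  obtain ⟨j, hy⟩ := mem_iUnion.1 hy
  have same : ∀ y ∈ R i, ∃ y' ∈ R i, (y.1 = q.1 ↔ y.2 = q.2) ∧ (y'.1 = q.1 ↔ y.1 = q.1) ∧
      (y.1 ≠ q.1 → SameDir 𝓕 q.1 y.1 y'.1 ∧ SameDir 𝓖 q.2 y.2 y'.2) := fun y hy =>
    ⟨y, hy, (hR i).eq_iff hy hq, Iff.rfl, fun hne => ⟨hF.sameDir_refl hne,
      hG.sameDir_refl (mt ((hR i).eq_iff hy hq).2 hne)⟩⟩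
  by_cases hij : i = j
  · subst hij; exact same y hy
  by_cases hyp : y.1 = p.1
  · rw [(hR j).eq_of_fst hy (hp j) hyp]; exact same p (hp i)
  obtain ⟨s1, s2⟩ := hs i j hij q hq y hy hqp hyp
  have d1 := hF.sep_sameDir_back s1
  have d2 := hG.sep_sameDir_back s2
  refine ⟨p, hp i, ?_, ?_, fun _ => ⟨d1.symm, d2.symm⟩⟩
  · exact ⟨fun h => absurd h d1.ne_right, fun h => absurd h d2.ne_right⟩
  · exact ⟨fun h => absurd h.symm hqp, fun h => absurd h d1.ne_right⟩

/-- Between points of different members `p` lies in the middle on both sides, so distances are sums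
and the bounds with the same `k` add up. -/
theorem PartialEquiv.wedge (hF : IsTreeGraded 𝓕) (hG : IsTreeGraded 𝓖) (i₀ : ι)
    (hR : ∀ i, PartialEquiv 𝓕 𝓖 k (R i)) (hp : ∀ i, p ∈ R i)
    (hs : ∀ i j, i ≠ j → ∀ y ∈ R i, ∀ z ∈ R j, y.1 ≠ p.1 → z.1 ≠ p.1 →
      Sep 𝓕 p.1 y.1 z.1 ∧ Sep 𝓖 p.2 y.2 z.2) : PartialEquiv 𝓕 𝓖 k (⋃ i, R i) := by
  have hbil : ∀ a ∈ ⋃ i, R i, ∀ b ∈ ⋃ i, R i,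
      k⁻¹ * dist a.1 b.1 ≤ dist a.2 b.2 ∧ dist a.2 b.2 ≤ k * dist a.1 b.1 := by
    intro a ha b hb
    obtain ⟨i, ha⟩ := mem_iUnion.1 ha
    obtain ⟨j, hb⟩ := mem_iUnion.1 hb
    by_cases hij : i = j
    · subst hij; exact (hR i).bilip a ha b hb
    by_cases hap : a.1 = p.1
    · rw [(hR i).eq_of_fst ha (hp i) hap]; exact (hR j).bilip p (hp j) b hb
    by_cases hbp : b.1 = p.1
    · rw [(hR j).eq_of_fst hb (hp j) hbp]; exact (hR i).bilip a ha p (hp i)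
    obtain ⟨s1, s2⟩ := hs i j hij a ha b hb hap hbp
    have e1 : _ + _ = _ := hF.sep_btw s1
    have e2 : _ + _ = _ := hG.sep_btw s2
    have b1 := (hR i).bilip a ha p (hp i)
    have b2 := (hR j).bilip p (hp j) b hb
    rw [← e1, ← e2, mul_add, mul_add]
    exact ⟨add_le_add b1.1 b2.1, add_le_add b1.2 b2.2⟩
  refine ⟨(hR i₀).one_le, hbil, ?_, ?_, ?_⟩
  · intro q hq y hy z hz
    by_cases hyq : y.1 = q.1
    · have := (eq_iff_of_bilip (hR i₀).one_le (hbil y hy q hq)).1 hyq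
      exact ⟨fun h => absurd hyq h.1, fun h => absurd this h.1⟩
    by_cases hzq : z.1 = q.1
    · have := (eq_iff_of_bilip (hR i₀).one_le (hbil z hz q hq)).1 hzq
      exact ⟨fun h => absurd hzq h.2.1, fun h => absurd this h.2.1⟩
    obtain ⟨i, hq'⟩ := mem_iUnion.1 hq
    by_cases hqp : q.1 = p.1
    · obtain rfl := (hR i).eq_of_fst hq' (hp i) hqp
      obtain ⟨j, hy⟩ := mem_iUnion.1 hy
      obtain ⟨l, hz⟩ := mem_iUnion.1 hz
      by_cases hjl : j = l
      · subst hjl; exact (hR j).sep q (hp j) y hy z hz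
      · have := hs j l hjl y hy z hz hyq hzq
        exact ⟨fun _ => this.2, fun _ => this.1⟩
    obtain ⟨y', hy', -, -, hyd⟩ := wedge_hat hF hG hR hp hs hq' hqp hy
    obtain ⟨z', hz', -, -, hzd⟩ := wedge_hat hF hG hR hp hs hq' hqp hz
    rw [hF.sep_congr (hyd hyq).1 (hzd hzq).1, hG.sep_congr (hyd hyq).2 (hzd hzq).2]
    exact (hR i).sep q hq' y' hy' z' hz'
  · rw [image_iUnion]
    refine saturated_wedge hF (p := p.1) (fun i => ⟨p, hp i, rfl⟩) (fun i => (hR i).dom) ?_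
    rintro i j hij _ ⟨y, hy, rfl⟩ _ ⟨z, hz, rfl⟩ hyp hzp
    exact (hs i j hij y hy z hz hyp hzp).1
  · rw [image_iUnion]
    refine saturated_wedge hG (p := p.2) (fun i => ⟨p, hp i, rfl⟩) (fun i => (hR i).ran) ?_
    rintro i j hij _ ⟨y, hy, rfl⟩ _ ⟨z, hz, rfl⟩ hyp hzp
    exact (hs i j hij y hy z hz (mt ((hR i).eq_iff hy (hp i)).1 hyp)
      (mt ((hR j).eq_iff hz (hp j)).1 hzp)).2

theorem Thin.wedge (hF : IsTreeGraded 𝓕) (hG : IsTreeGraded 𝓖)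
    (hR : ∀ i, PartialEquiv 𝓕 𝓖 k (R i)) (hp : ∀ i, p ∈ R i)
    (hs : ∀ i j, i ≠ j → ∀ y ∈ R i, ∀ z ∈ R j, y.1 ≠ p.1 → z.1 ≠ p.1 →
      Sep 𝓕 p.1 y.1 z.1 ∧ Sep 𝓖 p.2 y.2 z.2) {i : ι} {q : F × G} (hq : q ∈ R i)
    (hqp : q.1 ≠ p.1) (ht : Thin 𝓕 (R i) q) : Thin 𝓕 (⋃ i, R i) q := by
  rintro x hx y hy z hz ⟨h1, h2, h3⟩
  obtain ⟨x', hx', -, -, hxd⟩ := wedge_hat hF hG hR hp hs hq hqp hx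
  obtain ⟨y', hy', -, -, hyd⟩ := wedge_hat hF hG hR hp hs hq hqp hy
  obtain ⟨z', hz', -, -, hzd⟩ := wedge_hat hF hG hR hp hs hq hqp hz
  have hx1 := (hxd h1.1).1
  have hy1 := (hyd h2.1).1
  have hz1 := (hzd h2.2.1).1
  exact ht x' hx' y' hy' z' hz' ⟨(hF.sep_congr hx1 hy1).1 h1, (hF.sep_congr hy1 hz1).1 h2,
    (hF.sep_congr hx1 hz1).1 h3⟩

end Wedge

theorem Full.mono {R R' : Set (F × G)} {p : F × G} (h : Full 𝓕 𝓖 surj R p) (hRR' : R ⊆ R') :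
    Full 𝓕 𝓖 surj R' p := by
  refine ⟨fun y hy => ?_, fun hs y hy => ?_⟩
  · obtain ⟨z, hz, hd⟩ := h.1 y hy
    exact ⟨z, hRR' hz, hd⟩
  · obtain ⟨z, hz, hd⟩ := h.2 hs y hy
    exact ⟨z, hRR' hz, hd⟩

theorem Admissible.singleton (hF : IsTreeGraded 𝓕) (hG : IsTreeGraded 𝓖) (hk : 1 ≤ k) (p : F × G) :
    Admissible 𝓕 𝓖 k surj {p} where
  one_le := hk
  bilip := by rintro _ rfl _ rfl; simp
  sep := by
    rintro _ rfl _ rfl _ rfl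
    exact ⟨fun h => absurd rfl h.1, fun h => absurd rfl h.1⟩
  dom := by rw [image_singleton]; exact saturated_singleton hF _
  ran := by rw [image_singleton]; exact saturated_singleton hG _
  nonempty := singleton_nonempty p
  thin_or_full := by
    rintro _ rfl
    left
    rintro _ rfl _ _ _ _ h
    exact h.1.1 rfl

/-- Each condition except fullness rests on at most four points of the graph, which lie in one
member of the chain; fullness passes to larger sets. -/
theorem Admissible.sUnion {c : Set (Set (F × G))}
    (hc : ∀ R ∈ c, Admissible 𝓕 𝓖 k surj R) (hch : IsChain (· ⊆ ·) c) (hne : c.Nonempty) :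
    Admissible 𝓕 𝓖 k surj (⋃₀ c) := by
  obtain ⟨R₀, hR₀⟩ := hne
  have two : ∀ a ∈ ⋃₀ c, ∀ b ∈ ⋃₀ c, ∃ R ∈ c, a ∈ R ∧ b ∈ R := by
    rintro a ⟨R, hR, ha⟩ b ⟨R', hR', hb⟩
    rcases hch.total hR hR' with h | h
    · exact ⟨R', hR', h ha, hb⟩
    · exact ⟨R, hR, ha, h hb⟩
  have add : ∀ R ∈ c, ∀ a ∈ ⋃₀ c, ∃ R' ∈ c, R ⊆ R' ∧ a ∈ R' := by
    rintro R hR a ⟨R', hR', ha⟩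
    rcases hch.total hR hR' with h | h
    · exact ⟨R', hR', h, ha⟩
    · exact ⟨R, hR, Subset.rfl, h ha⟩
  have three : ∀ a ∈ ⋃₀ c, ∀ b ∈ ⋃₀ c, ∀ d ∈ ⋃₀ c, ∃ R ∈ c, a ∈ R ∧ b ∈ R ∧ d ∈ R := by
    intro a ha b hb d hd
    obtain ⟨R, hR, ha, hb⟩ := two a ha b hb
    obtain ⟨R', hR', hs, hd⟩ := add R hR d hd
    exact ⟨R', hR', hs ha, hs hb, hd⟩
  refine ⟨⟨(hc R₀ hR₀).one_le, ?_, ?_, ⟨?_, ?_⟩, ⟨?_, ?_⟩⟩, ?_, ?_⟩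
  · intro a ha b hb
    obtain ⟨R, hR, ha, hb⟩ := two a ha b hb
    exact (hc R hR).bilip a ha b hb
  · intro p hp y hy z hz
    obtain ⟨R, hR, hp, hy, hz⟩ := three p hp y hy z hz
    exact (hc R hR).sep p hp y hy z hz
  · rintro _ ⟨y, hy, rfl⟩ _ ⟨z, hz, rfl⟩ q hq
    obtain ⟨R, hR, hy, hz⟩ := two y hy z hz
    exact image_mono (subset_sUnion_of_mem hR)
      ((hc R hR).dom.cut _ ⟨y, hy, rfl⟩ _ ⟨z, hz, rfl⟩ q hq)
  · rintro A hA a haA b hbA ⟨y, hy, rfl⟩ ⟨z, hz, rfl⟩ hne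
    obtain ⟨R, hR, hy, hz⟩ := two y hy z hz
    exact ((hc R hR).dom.piece A hA _ haA _ hbA ⟨y, hy, rfl⟩ ⟨z, hz, rfl⟩ hne).trans
      (image_mono (subset_sUnion_of_mem hR))
  · rintro _ ⟨y, hy, rfl⟩ _ ⟨z, hz, rfl⟩ q hq
    obtain ⟨R, hR, hy, hz⟩ := two y hy z hz
    exact image_mono (subset_sUnion_of_mem hR)
      ((hc R hR).ran.cut _ ⟨y, hy, rfl⟩ _ ⟨z, hz, rfl⟩ q hq)
  · rintro A hA a haA b hbA ⟨y, hy, rfl⟩ ⟨z, hz, rfl⟩ hne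
    obtain ⟨R, hR, hy, hz⟩ := two y hy z hz
    exact ((hc R hR).ran.piece A hA _ haA _ hbA ⟨y, hy, rfl⟩ ⟨z, hz, rfl⟩ hne).trans
      (image_mono (subset_sUnion_of_mem hR))
  · obtain ⟨a, ha⟩ := (hc R₀ hR₀).nonempty
    exact ⟨a, R₀, hR₀, ha⟩
  · intro p hp
    -- If no member is full at `p`, all members through `p` are thin there, and a violation of
    -- thinness would already occur in one of them.
    by_cases hfull : ∃ R ∈ c, Full 𝓕 𝓖 surj R p
    · obtain ⟨R, hR, hf⟩ := hfull
      exact Or.inr (hf.mono (subset_sUnion_of_mem hR))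
    · left
      intro x hx y hy z hz
      obtain ⟨R, hR, hx, hy, hz⟩ := three x hx y hy z hz
      obtain ⟨R', hR', hs, hp⟩ := add R hR p hp
      rcases (hc R' hR').thin_or_full p hp with h | h
      · exact h x (hs hx) y (hs hy) z (hs hz)
      · exact absurd ⟨R', hR', h⟩ hfull

theorem PartialEquiv.approx {R : Set (F × G)} {y : F × G} (hy : y ∈ closure R) {ε ε' : ℝ}
    (hε : 0 < ε) (hε' : 0 < ε') : ∃ z ∈ R, dist y.1 z.1 < ε ∧ dist y.2 z.2 < ε' := by
  obtain ⟨z, hz, hd⟩ := Metric.mem_closure_iff.1 hy (min ε ε') (lt_min hε hε')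
  rw [Prod.dist_eq, max_lt_iff, lt_min_iff, lt_min_iff] at hd
  exact ⟨z, hz, hd.1.1, hd.2.2⟩

/-- Points of the closure can be moved into `R` without changing their directions. A point that
separates two of them is a cut point of the saturated domain or range of `R`, so it is already in
`R`. Each new point therefore shows at most one direction and is thin. -/
theorem admissible_closure (hF : IsTreeGraded 𝓕) (hG : IsTreeGraded 𝓖) {R : Set (F × G)}
    (hR : Admissible 𝓕 𝓖 k surj R) : Admissible 𝓕 𝓖 k surj (closure R) := by
  have hk := hR.one_le
  have hbil : ∀ a ∈ closure R, ∀ b ∈ closure R,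
      k⁻¹ * dist a.1 b.1 ≤ dist a.2 b.2 ∧ dist a.2 b.2 ≤ k * dist a.1 b.1 := by
    intro a ha b hb
    have hcl : IsClosed {x : (F × G) × (F × G) | k⁻¹ * dist x.1.1 x.2.1 ≤ dist x.1.2 x.2.2 ∧
        dist x.1.2 x.2.2 ≤ k * dist x.1.1 x.2.1} := by
      apply IsClosed.inter
      · exact isClosed_le (f := fun x : (F × G) × (F × G) => k⁻¹ * dist x.1.1 x.2.1)
          (g := fun x => dist x.1.2 x.2.2) (by fun_prop) (by fun_prop)
      · exact isClosed_le (f := fun x : (F × G) × (F × G) => dist x.1.2 x.2.2)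
          (g := fun x => k * dist x.1.1 x.2.1) (by fun_prop) (by fun_prop)
    have hsub : R ×ˢ R ⊆ {x : (F × G) × (F × G) | k⁻¹ * dist x.1.1 x.2.1 ≤ dist x.1.2 x.2.2 ∧
        dist x.1.2 x.2.2 ≤ k * dist x.1.1 x.2.1} := fun x hx => hR.bilip _ hx.1 _ hx.2
    have := closure_minimal hsub hcl
    rw [closure_prod_eq] at this
    exact this (show (a, b) ∈ _ from ⟨ha, hb⟩)
  have hfst : Prod.fst '' closure R ⊆ closure (Prod.fst '' R) :=
    image_closure_subset_closure_image continuous_fst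
  have hsnd : Prod.snd '' closure R ⊆ closure (Prod.snd '' R) :=
    image_closure_subset_closure_image continuous_snd
  have approx : ∀ p ∈ closure R, ∀ y ∈ closure R, y.1 ≠ p.1 → ∃ y' ∈ R,
      SameDir 𝓕 p.1 y.1 y'.1 ∧ SameDir 𝓖 p.2 y.2 y'.2 := by
    intro p hp y hy hne
    have hne' : y.2 ≠ p.2 := mt (eq_iff_of_bilip hk (hbil y hy p hp)).2 hne
    obtain ⟨y', hy', h1, h2⟩ := PartialEquiv.approx hy (dist_pos.2 hne.symm) (dist_pos.2 hne'.symm)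
    exact ⟨y', hy', hF.sameDir_of_dist_lt h1, hG.sameDir_of_dist_lt h2⟩
  refine ⟨⟨hk, hbil, ?_, ?_, ?_⟩, ?_, ?_⟩
  · intro p hp y hy z hz
    by_cases hyp : y.1 = p.1
    · have := (eq_iff_of_bilip hk (hbil y hy p hp)).1 hyp
      exact ⟨fun h => absurd hyp h.1, fun h => absurd this h.1⟩
    by_cases hzp : z.1 = p.1
    · have := (eq_iff_of_bilip hk (hbil z hz p hp)).1 hzp
      exact ⟨fun h => absurd hzp h.2.1, fun h => absurd this h.2.1⟩
    obtain ⟨y', hy', hy1, hy2⟩ := approx p hp y hy hyp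
    obtain ⟨z', hz', hz1, hz2⟩ := approx p hp z hz hzp
    rw [hF.sep_congr hy1 hz1, hG.sep_congr hy2 hz2]
    constructor
    · intro h
      obtain ⟨p', hp', hpp⟩ := hR.dom.cut _ ⟨y', hy', rfl⟩ _ ⟨z', hz', rfl⟩ _ h
      have := (eq_iff_of_bilip hk (hbil p' (subset_closure hp') p hp)).1 hpp
      rw [← hpp, hR.sep p' hp' y' hy' z' hz', this] at h
      exact h
    · intro h
      obtain ⟨p', hp', hpp⟩ := hR.ran.cut _ ⟨y', hy', rfl⟩ _ ⟨z', hz', rfl⟩ _ h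
      have := (eq_iff_of_bilip hk (hbil p' (subset_closure hp') p hp)).2 hpp
      rw [← hpp, ← hR.sep p' hp' y' hy' z' hz', this] at h
      exact h
  · exact hR.dom.closure hF (image_mono subset_closure) hfst
  · exact hR.ran.closure hG (image_mono subset_closure) hsnd
  · exact hR.nonempty.mono subset_closure
  · intro p hp
    have hsep : ∀ x ∈ closure R, ∀ y ∈ closure R, Sep 𝓕 p.1 x.1 y.1 → p ∈ R := by
      intro x hx y hy h
      obtain ⟨x', hx', hx1, -⟩ := approx p hp x hx h.1
      obtain ⟨y', hy', hy1, -⟩ := approx p hp y hy h.2.1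
      rw [hF.sep_congr hx1 hy1] at h
      obtain ⟨p', hp', hpp⟩ := hR.dom.cut _ ⟨x', hx', rfl⟩ _ ⟨y', hy', rfl⟩ _ h
      have := (eq_iff_of_bilip hk (hbil p' (subset_closure hp') p hp)).1 hpp
      rwa [← Prod.ext hpp this]
    by_cases hpR : p ∈ R
    · rcases hR.thin_or_full p hpR with h | h
      · left
        rintro x hx y hy z hz ⟨h1, h2, h3⟩
        obtain ⟨x', hx', hx1, -⟩ := approx p hp x hx h1.1
        obtain ⟨y', hy', hy1, -⟩ := approx p hp y hy h2.1
        obtain ⟨z', hz', hz1, -⟩ := approx p hp z hz h2.2.1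
        exact h x' hx' y' hy' z' hz' ⟨(hF.sep_congr hx1 hy1).1 h1, (hF.sep_congr hy1 hz1).1 h2,
          (hF.sep_congr hx1 hz1).1 h3⟩
      · exact Or.inr (h.mono subset_closure)
    · left
      rintro x hx y hy z hz ⟨h1, -⟩
      exact hpR (hsep x hx y hy h1)

/-- On the complete set `R` both projections are uniformly continuous and antilipschitz, so their
ranges are closed. -/
theorem PartialEquiv.isClosed (hF : IsTreeGraded 𝓕) (hG : IsTreeGraded 𝓖) {R : Set (F × G)}
    (hR : PartialEquiv 𝓕 𝓖 k R) (hc : IsClosed R) :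
    IsClosed (Prod.fst '' R) ∧ IsClosed (Prod.snd '' R) := by
  have := hF.complete
  have := hG.complete
  have : CompleteSpace R := hc.completeSpace_coe
  have hk := hR.one_le
  have hK : ((Real.toNNReal k : NNReal) : ℝ) = k := Real.coe_toNNReal k (by linarith)
  have r1 : Prod.fst '' R = range (fun a : R => a.1.1) := by ext; simp
  have r2 : Prod.snd '' R = range (fun a : R => a.1.2) := by ext; simp
  rw [r1, r2]
  constructor
  · refine AntilipschitzWith.isClosed_range (K := Real.toNNReal k) ?_
      (uniformContinuous_fst.comp uniformContinuous_subtype_val)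
    refine AntilipschitzWith.of_le_mul_dist fun a b => ?_
    rw [hK, Subtype.dist_eq, Prod.dist_eq]
    refine max_le ?_ (hR.bilip a a.2 b b.2).2
    exact le_mul_of_one_le_left dist_nonneg hk
  · refine AntilipschitzWith.isClosed_range (K := Real.toNNReal k) ?_
      (uniformContinuous_snd.comp uniformContinuous_subtype_val)
    refine AntilipschitzWith.of_le_mul_dist fun a b => ?_
    rw [hK, Subtype.dist_eq, Prod.dist_eq]
    refine max_le ?_ (le_mul_of_one_le_left dist_nonneg hk)
    have := (hR.bilip a a.2 b b.2).1
    rwa [inv_mul_le_iff₀ (by linarith)] at this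

/-- If each admissible partial equivalence which is thin at a point extends to one which is full
there, there is a bilipschitz embedding, onto if `surj` holds. -/
theorem exists_bilipschitz (hF : IsTreeGraded 𝓕) (hG : IsTreeGraded 𝓖) (hk : 1 ≤ k)
    [Nonempty F] [Nonempty G]
    (hext : ∀ R, Admissible 𝓕 𝓖 k surj R → ∀ p ∈ R, Thin 𝓕 R p →
      ∃ R', Admissible 𝓕 𝓖 k surj R' ∧ R ⊆ R' ∧ Full 𝓕 𝓖 surj R' p) :
    ∃ h : F → G, IsBilipschitz k h ∧ Function.Injective h ∧ (surj → Function.Surjective h) := by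
  obtain ⟨o⟩ := (inferInstance : Nonempty F)
  obtain ⟨o'⟩ := (inferInstance : Nonempty G)
  obtain ⟨R, -, hmax⟩ := zorn_subset_nonempty {R | Admissible 𝓕 𝓖 k surj R}
    (fun c hc hch hne => ⟨⋃₀ c, Admissible.sUnion hc hch hne, fun s hs => subset_sUnion_of_mem hs⟩)
    {(o, o')} (Admissible.singleton hF hG hk _)
  have hR : Admissible 𝓕 𝓖 k surj R := hmax.prop
  have hcl : IsClosed R := by
    have : R = closure R := hmax.eq_of_subset (admissible_closure hF hG hR) subset_closure
    rw [this]; exact isClosed_closure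
  have hfull : ∀ p ∈ R, Full 𝓕 𝓖 surj R p := by
    intro p hp
    rcases hR.thin_or_full p hp with h | h
    · obtain ⟨R', hR', hsub, hf⟩ := hext R hR p hp h
      rwa [← hmax.eq_of_subset hR' hsub] at hf
    · exact h
  obtain ⟨c1, c2⟩ := hR.isClosed hF hG hcl
  have hdom : Prod.fst '' R = univ := by
    refine hR.dom.eq_univ hF c1 (hR.nonempty.image _) ?_
    rintro _ ⟨p, hp, rfl⟩ y hy
    obtain ⟨z, hz, hd⟩ := (hfull p hp).1 y hy
    exact ⟨_, ⟨z, hz, rfl⟩, hd⟩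
  have hex : ∀ x : F, ∃ y : G, (x, y) ∈ R := by
    intro x
    obtain ⟨⟨x', y⟩, hy, rfl⟩ : x ∈ Prod.fst '' R := by rw [hdom]; trivial
    exact ⟨y, hy⟩
  choose φ hφ using hex
  have hinj : Function.Injective φ := fun x y hxy => (hR.eq_iff (hφ x) (hφ y)).2 hxy
  refine ⟨φ, fun x y => hR.bilip _ (hφ x) _ (hφ y), hinj, fun hs y => ?_⟩
  have hran : Prod.snd '' R = univ := by
    refine hR.ran.eq_univ hG c2 (hR.nonempty.image _) ?_
    rintro _ ⟨p, hp, rfl⟩ y hy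
    obtain ⟨z, hz, hd⟩ := (hfull p hp).2 hs y hy
    exact ⟨_, ⟨z, hz, rfl⟩, hd⟩
  obtain ⟨⟨x, y'⟩, hy, rfl⟩ : y ∈ Prod.snd '' R := by rw [hran]; trivial
  exact ⟨x, (hR.eq_iff (hφ x) hy).1 rfl⟩

end Partial

/-! ### The union of the pieces along a geodesic -/

section Hull

variable {X : Type u} [MetricSpace X] {𝓟 : Set (Set X)} {γ : ℝ → X} {l : ℝ}

/-- The time `t` is not interior to an interval that the geodesic spends in one piece. -/
def Transit (𝓟 : Set (Set X)) (γ : ℝ → X) (l t : ℝ) : Prop :=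
  t ∈ Icc 0 l ∧ ∀ A ∈ 𝓟, ∀ u v, 0 ≤ u → u < t → t < v → v ≤ l → γ u ∈ A → γ v ∈ A → False

/-- `[u, v]` is the non-trivial interval of times that the geodesic spends in the piece `A`. -/
structure PieceIvl (𝓟 : Set (Set X)) (γ : ℝ → X) (l : ℝ) (A : Set X) (u v : ℝ) : Prop where
  mem : A ∈ 𝓟
  nonneg : 0 ≤ u
  lt : u < v
  le : v ≤ l
  mem_iff : ∀ t ∈ Icc 0 l, γ t ∈ A ↔ t ∈ Icc u v

theorem PieceIvl.left_mem {A : Set X} {u v : ℝ} (h : PieceIvl 𝓟 γ l A u v) : γ u ∈ A :=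
  (h.mem_iff u ⟨h.nonneg, h.lt.le.trans h.le⟩).2 ⟨le_rfl, h.lt.le⟩

theorem PieceIvl.right_mem {A : Set X} {u v : ℝ} (h : PieceIvl 𝓟 γ l A u v) : γ v ∈ A :=
  (h.mem_iff v ⟨h.nonneg.trans h.lt.le, h.le⟩).2 ⟨h.lt.le, le_rfl⟩

theorem PieceIvl.ne (hγ : IsGeodesicOn γ l) {A : Set X} {u v : ℝ} (h : PieceIvl 𝓟 γ l A u v) :
    γ u ≠ γ v := fun heq =>
  h.lt.ne (hγ.injOn ⟨h.nonneg, h.lt.le.trans h.le⟩ ⟨h.nonneg.trans h.lt.le, h.le⟩ heq)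

/-- The times spent in `A` form a compact set because `A` is closed, and an interval because `A` is
convex. -/
theorem exists_pieceIvl (h : IsTreeGraded 𝓟) (hγ : IsGeodesicOn γ l) {A : Set X} (hA : A ∈ 𝓟)
    {u v : ℝ} (hu : 0 ≤ u) (huv : u < v) (hv : v ≤ l) (huA : γ u ∈ A) (hvA : γ v ∈ A) :
    ∃ u' v', PieceIvl 𝓟 γ l A u' v' ∧ u' ≤ u ∧ v ≤ v' := by
  have hE : IsClosed (Icc 0 l ∩ γ ⁻¹' A) :=
    hγ.continuousOn.preimage_isClosed_of_isClosed isClosed_Icc (h.piece_closed A hA)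
  have hE' : IsCompact (Icc 0 l ∩ γ ⁻¹' A) := isCompact_Icc.of_isClosed_subset hE inter_subset_left
  have hne : (Icc 0 l ∩ γ ⁻¹' A).Nonempty := ⟨u, ⟨hu, huv.le.trans hv⟩, huA⟩
  obtain ⟨u', ⟨hu', huA'⟩, hmin⟩ := hE'.exists_isLeast hne
  obtain ⟨v', ⟨hv', hvA'⟩, hmax⟩ := hE'.exists_isGreatest hne
  have h1 : u' ≤ u := hmin ⟨⟨hu, huv.le.trans hv⟩, huA⟩
  have h2 : v ≤ v' := hmax ⟨⟨hu.trans huv.le, hv⟩, hvA⟩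
  refine ⟨u', v', ⟨hA, hu'.1, by linarith, hv'.2, fun t ht => ⟨fun htA => ?_, fun ht' => ?_⟩⟩, h1, h2⟩
  · exact ⟨hmin ⟨ht, htA⟩, hmax ⟨ht, htA⟩⟩
  · exact h.piece_convex hA huA' hvA' (hγ.btw hu'.1 ht'.1 ht'.2 hv'.2)

/-- If a piece `B` contained the geodesic on both sides of `u`, it would share `γ u` and a slightly
later point with `A`. Then `B = A`, against the minimality of `u`. -/
theorem PieceIvl.transit_left (h : IsTreeGraded 𝓟) (hγ : IsGeodesicOn γ l) {A : Set X} {u v : ℝ}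
    (hi : PieceIvl 𝓟 γ l A u v) : Transit 𝓟 γ l u := by
  refine ⟨⟨hi.nonneg, hi.lt.le.trans hi.le⟩, fun B hB a b ha hau hub hb haB hbB => ?_⟩
  have hlt := hi.lt
  have hle := hi.le
  have hmin : u < min v b := lt_min hi.lt hub
  have huB := h.piece_convex hB haB hbB (hγ.btw ha hau.le hub.le hb)
  have hmB := h.piece_convex hB haB hbB (hγ.btw ha (hau.le.trans hmin.le) (min_le_right v b) hb)
  have hm0 : 0 ≤ min v b := hi.nonneg.trans hmin.le
  have hml : min v b ≤ l := (min_le_right v b).trans hb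
  have hmA := (hi.mem_iff _ ⟨hm0, hml⟩).2 ⟨hmin.le, min_le_left _ _⟩
  have hne : γ u ≠ γ (min v b) := fun heq =>
    hmin.ne (hγ.injOn ⟨hi.nonneg, hlt.le.trans hle⟩ ⟨hm0, hml⟩ heq)
  have := h.piece_eq hi.mem hB hne hi.left_mem hmA huB hmB
  subst this
  exact absurd ((hi.mem_iff a ⟨ha, by linarith⟩).1 haB).1 (not_le.2 hau)

theorem PieceIvl.transit_right (h : IsTreeGraded 𝓟) (hγ : IsGeodesicOn γ l) {A : Set X} {u v : ℝ}
    (hi : PieceIvl 𝓟 γ l A u v) : Transit 𝓟 γ l v := by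
  refine ⟨⟨hi.nonneg.trans hi.lt.le, hi.le⟩, fun B hB a b ha hav hvb hb haB hbB => ?_⟩
  have hlt := hi.lt
  have hle := hi.le
  have hmax : max u a < v := max_lt hi.lt hav
  have hvB := h.piece_convex hB haB hbB (hγ.btw ha hav.le hvb.le hb)
  have hmB := h.piece_convex hB haB hbB (hγ.btw ha (le_max_right u a) (hmax.le.trans hvb.le) hb)
  have hm0 : 0 ≤ max u a := ha.trans (le_max_right u a)
  have hml : max u a ≤ l := hmax.le.trans hle
  have hmA := (hi.mem_iff _ ⟨hm0, hml⟩).2 ⟨le_max_left _ _, hmax.le⟩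
  have hne : γ (max u a) ≠ γ v := fun heq =>
    hmax.ne (hγ.injOn ⟨hm0, hml⟩ ⟨hi.nonneg.trans hlt.le, hle⟩ heq)
  have := h.piece_eq hi.mem hB hne hmA hi.right_mem hmB hvB
  subst this
  exact absurd ((hi.mem_iff b ⟨by linarith, hb⟩).1 hbB).2 (not_le.2 hvb)

theorem PieceIvl.gate_right (h : IsTreeGraded 𝓟) (hγ : IsGeodesicOn γ l) {A : Set X} {u v t : ℝ}
    (hi : PieceIvl 𝓟 γ l A u v) (hvt : v ≤ t) (ht : t ≤ l) : IsGate A (γ t) (γ v) := by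
  have h0 := hi.nonneg.trans hi.lt.le
  have hr := ((hγ.mono (h0.trans hvt) ht).reverse).mono (m := t - v) (by linarith) (by linarith)
  have := h.isGate_of_geodesic hi.mem hr (by simpa using hi.right_mem) (by
    intro τ hτ hτA
    have := ((hi.mem_iff _ ⟨by linarith [hτ.2], by linarith [hτ.1]⟩).1 hτA).2
    linarith [hτ.2])
  simpa using this

theorem PieceIvl.gate_left (h : IsTreeGraded 𝓟) (hγ : IsGeodesicOn γ l) {A : Set X} {u v t : ℝ}
    (hi : PieceIvl 𝓟 γ l A u v) (ht : 0 ≤ t) (htu : t ≤ u) : IsGate A (γ t) (γ u) := by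
  have := h.isGate_of_geodesic hi.mem (hγ.shift ht htu (hi.lt.le.trans hi.le))
    (by simpa using hi.left_mem) (by
      intro τ hτ hτA
      have := ((hi.mem_iff _ ⟨by linarith [hτ.1], by linarith [hτ.2, hi.lt, hi.le]⟩).1 hτA).1
      linarith [hτ.2])
  simpa using this

theorem PieceIvl.not_transit {A : Set X} {u v t : ℝ} (hi : PieceIvl 𝓟 γ l A u v)
    (ht : Transit 𝓟 γ l t) : v ≤ t ∨ t ≤ u := by
  by_contra hc
  rw [not_or, not_le, not_le] at hc
  exact ht.2 A hi.mem u v hi.nonneg hc.2 hc.1 hi.le hi.left_mem hi.right_mem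

theorem exists_pieceIvl_of_not_transit (h : IsTreeGraded 𝓟) (hγ : IsGeodesicOn γ l) {t : ℝ}
    (ht : t ∈ Icc 0 l) (hn : ¬ Transit 𝓟 γ l t) : ∃ A u v, PieceIvl 𝓟 γ l A u v ∧ u < t ∧ t < v := by
  unfold Transit at hn
  push Not at hn
  obtain ⟨A, hA, u, v, hu, hut, htv, hv, huA, hvA, -⟩ := hn ht
  obtain ⟨u', v', hi, h1, h2⟩ := exists_pieceIvl h hγ hA hu (hut.trans htv) hv huA hvA
  exact ⟨A, u', v', hi, by linarith, by linarith⟩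

theorem transit_zero (hl : 0 ≤ l) : Transit 𝓟 γ l 0 :=
  ⟨⟨le_rfl, hl⟩, fun _ _ _ _ hu hu' => absurd hu (not_le.2 hu')⟩

theorem transit_last (hl : 0 ≤ l) : Transit 𝓟 γ l l :=
  ⟨⟨hl, le_rfl⟩, fun _ _ _ _ _ _ hv hv' => absurd hv' (not_le.2 hv)⟩

/-- If the two ends were in the same direction, `γ (t - m)` and `γ (t + m)` would share a piece for
some small `m`, and `t` would be interior to the time spent there. -/
theorem Transit.sep (h : IsTreeGraded 𝓟) (hγ : IsGeodesicOn γ l) {t : ℝ} (ht : Transit 𝓟 γ l t)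
    (h0 : 0 < t) (hl : t < l) : Sep 𝓟 (γ t) (γ 0) (γ l) := by
  have hz : (0 : ℝ) ∈ Icc 0 l := ⟨le_rfl, by linarith⟩
  have hll : l ∈ Icc 0 l := ⟨by linarith, le_rfl⟩
  refine ⟨fun heq => h0.ne (hγ.injOn hz ht.1 heq), fun heq => hl.ne' (hγ.injOn hll ht.1 heq),
    fun hs => ?_⟩
  obtain ⟨m, hm, hm1, hm2, H⟩ := IsTreeGraded.SameDir.common_piece h hs
  have d1 := hγ.dist_le le_rfl h0.le hl.le
  have d2 := hγ.dist_le h0.le hl.le le_rfl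
  rw [dist_comm] at d1
  have e1 := hγ.dist_le (u := t - m) (v := t) (by linarith) (by linarith) hl.le
  have e2 := hγ.dist_le (u := t) (v := t + m) h0.le (by linarith) (by linarith)
  rw [dist_comm] at e1
  obtain ⟨A, hA, hA1, hA2⟩ := H (γ (t - m)) (γ (t + m))
    (hγ.btw (u := 0) (v := t - m) (w := t) le_rfl (by linarith) (by linarith) hl.le).symm
    (hγ.btw (u := t) (v := t + m) (w := l) h0.le (by linarith) (by linarith) le_rfl)
    (by linarith) (by linarith)
  exact ht.2 A hA _ _ (by linarith) (by linarith) (by linarith) (by linarith) hA1 hA2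

/-- `x` is a point of the union of the pieces along the geodesic, attached to the interval
`[u, v]` of times. -/
def HullPt (𝓟 : Set (Set X)) (γ : ℝ → X) (l u v : ℝ) (x : X) : Prop :=
  (u = v ∧ Transit 𝓟 γ l u ∧ x = γ u) ∨ ∃ A, PieceIvl 𝓟 γ l A u v ∧ x ∈ A

theorem Transit.hullPt {t : ℝ} (ht : Transit 𝓟 γ l t) : HullPt 𝓟 γ l t t (γ t) :=
  Or.inl ⟨rfl, ht, rfl⟩

theorem PieceIvl.hullPt {A : Set X} {u v : ℝ} (hi : PieceIvl 𝓟 γ l A u v) {x : X} (hx : x ∈ A) :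
    HullPt 𝓟 γ l u v x :=
  Or.inr ⟨A, hi, hx⟩

theorem HullPt.le {u v : ℝ} {x : X} (hx : HullPt 𝓟 γ l u v x) : u ≤ v := by
  rcases hx with ⟨h, -⟩ | ⟨A, hi, -⟩
  · exact h.le
  · exact hi.lt.le

theorem HullPt.transit_left (h : IsTreeGraded 𝓟) (hγ : IsGeodesicOn γ l) {u v : ℝ} {x : X}
    (hx : HullPt 𝓟 γ l u v x) : Transit 𝓟 γ l u := by
  rcases hx with ⟨_, ht, -⟩ | ⟨A, hi, -⟩
  · exact ht
  · exact hi.transit_left h hγ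

theorem HullPt.transit_right (h : IsTreeGraded 𝓟) (hγ : IsGeodesicOn γ l) {u v : ℝ} {x : X}
    (hx : HullPt 𝓟 γ l u v x) : Transit 𝓟 γ l v := by
  rcases hx with ⟨rfl, ht, -⟩ | ⟨A, hi, -⟩
  · exact ht
  · exact hi.transit_right h hγ

theorem HullPt.le_or_le {u v t : ℝ} {x : X} (hx : HullPt 𝓟 γ l u v x) (ht : Transit 𝓟 γ l t) :
    v ≤ t ∨ t ≤ u := by
  rcases hx with ⟨rfl, -, -⟩ | ⟨A, hi, -⟩
  · exact le_total _ _
  · exact hi.not_transit ht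

/-- The ends of either interval are transit times, so they cannot be interior to the other one. -/
theorem HullPt.compare (h : IsTreeGraded 𝓟) (hγ : IsGeodesicOn γ l) {u v u' v' : ℝ} {x x' : X}
    (hx : HullPt 𝓟 γ l u v x) (hx' : HullPt 𝓟 γ l u' v' x') :
    (u = u' ∧ v = v') ∨ v ≤ u' ∨ v' ≤ u := by
  have h1 := hx.le_or_le (hx'.transit_left h hγ)
  have h2 := hx.le_or_le (hx'.transit_right h hγ)
  have h3 := hx'.le_or_le (hx.transit_left h hγ)
  have h4 := hx'.le_or_le (hx.transit_right h hγ)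
  have := hx.le
  have := hx'.le
  by_cases h5 : v ≤ u'
  · exact Or.inr (Or.inl h5)
  by_cases h6 : v' ≤ u
  · exact Or.inr (Or.inr h6)
  left
  simp only [h5, h6, false_or, or_false] at h1 h2 h3 h4
  exact ⟨le_antisymm h3 h1, le_antisymm h2 h4⟩

/-- A point attached before `t` sees `γ t` through its gate `γ v`, which is on the way from `γ t` to
`γ 0`. If `v = t`, the point shares a piece with the earlier `γ u` instead. -/
theorem HullPt.dir_left (h : IsTreeGraded 𝓟) (hγ : IsGeodesicOn γ l) {u v t : ℝ} {x : X}
    (hx : HullPt 𝓟 γ l u v x) (ht : Transit 𝓟 γ l t) (hvt : v ≤ t) (hne : x ≠ γ t) :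
    0 < t ∧ SameDir 𝓟 (γ t) x (γ 0) := by
  have hu := (hx.transit_left h hγ).1
  have hv := (hx.transit_right h hγ).1
  have earlier : ∀ τ, 0 ≤ τ → τ < t → SameDir 𝓟 (γ t) (γ τ) (γ 0) := by
    intro τ h0 h1
    refine h.sameDir_of_btw (fun heq => ?_) (hγ.btw le_rfl h0 h1.le ht.1.2).symm
    exact h1.ne (hγ.injOn ⟨h0, h1.le.trans ht.1.2⟩ ht.1 heq)
  rcases hx with ⟨rfl, -, rfl⟩ | ⟨A, hi, hxA⟩
  · have : u < t := lt_of_le_of_ne hvt (fun hc => hne (by rw [hc]))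
    exact ⟨by linarith [hu.1], earlier u hu.1 this⟩
  · refine ⟨by linarith [hi.nonneg, hi.lt], ?_⟩
    rcases hvt.lt_or_eq with h1 | rfl
    · have hne' : γ v ≠ γ t := fun heq => h1.ne (hγ.injOn hv ht.1 heq)
      have := h.sameDir_of_btw hne' ((hi.gate_right h hγ hvt ht.1.2).2.1 x hxA)
      exact h.sameDir_trans this.symm (earlier v hv.1 h1)
    · exact h.sameDir_trans (h.sameDir_of_mem_piece hi.mem hxA hi.left_mem hne (hi.ne hγ))
        (earlier u hu.1 hi.lt)

theorem HullPt.dir_right (h : IsTreeGraded 𝓟) (hγ : IsGeodesicOn γ l) {u v t : ℝ} {x : X}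
    (hx : HullPt 𝓟 γ l u v x) (ht : Transit 𝓟 γ l t) (htu : t ≤ u) (hne : x ≠ γ t) :
    t < l ∧ SameDir 𝓟 (γ t) x (γ l) := by
  have hu := (hx.transit_left h hγ).1
  have hv := (hx.transit_right h hγ).1
  have later : ∀ τ, τ ≤ l → t < τ → SameDir 𝓟 (γ t) (γ τ) (γ l) := by
    intro τ h0 h1
    refine h.sameDir_of_btw (fun heq => ?_) (hγ.btw ht.1.1 h1.le h0 le_rfl)
    exact h1.ne' (hγ.injOn ⟨ht.1.1.trans h1.le, h0⟩ ht.1 heq)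
  rcases hx with ⟨rfl, -, rfl⟩ | ⟨A, hi, hxA⟩
  · have : t < u := lt_of_le_of_ne htu (fun hc => hne (by rw [hc]))
    exact ⟨by linarith [hu.2], later u hu.2 this⟩
  · refine ⟨by linarith [hi.le, hi.lt], ?_⟩
    rcases htu.lt_or_eq with h1 | rfl
    · have hne' : γ u ≠ γ t := fun heq => h1.ne' (hγ.injOn hu ht.1 heq)
      have := h.sameDir_of_btw hne' ((hi.gate_left h hγ ht.1.1 htu).2.1 x hxA)
      exact h.sameDir_trans this.symm (later u hu.2 h1)
    · exact h.sameDir_trans (h.sameDir_of_mem_piece hi.mem hxA hi.right_mem hne (hi.ne hγ).symm)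
        (later v hv.2 hi.lt)

theorem HullPt.sep (h : IsTreeGraded 𝓟) (hγ : IsGeodesicOn γ l) {u v u' v' t : ℝ} {x x' : X}
    (hx : HullPt 𝓟 γ l u v x) (hx' : HullPt 𝓟 γ l u' v' x') (ht : Transit 𝓟 γ l t) (hvt : v ≤ t)
    (htu : t ≤ u') (hne : x ≠ γ t) (hne' : x' ≠ γ t) : Sep 𝓟 (γ t) x x' := by
  obtain ⟨h1, h2⟩ := hx.dir_left h hγ ht hvt hne
  obtain ⟨h3, h4⟩ := hx'.dir_right h hγ ht htu hne'
  exact (h.sep_congr h2 h4).2 (ht.sep h hγ h1 h3)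

theorem HullPt.btw (h : IsTreeGraded 𝓟) (hγ : IsGeodesicOn γ l) {u v u' v' t : ℝ} {x x' : X}
    (hx : HullPt 𝓟 γ l u v x) (hx' : HullPt 𝓟 γ l u' v' x') (ht : Transit 𝓟 γ l t) (hvt : v ≤ t)
    (htu : t ≤ u') : Btw x (γ t) x' := by
  by_cases hne : x = γ t
  · rw [hne]; exact btw_left _ _
  by_cases hne' : x' = γ t
  · rw [hne']; exact btw_right _ _
  exact h.sep_btw (hx.sep h hγ hx' ht hvt htu hne hne')

/-- Both `γ v` and `γ u'` lie on the way from `x` to `x'`. The distance thus splits into a part in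
each of two pieces and a time difference, terms which can be compared separately in the other space.
-/
theorem HullPt.dist (h : IsTreeGraded 𝓟) (hγ : IsGeodesicOn γ l) {u v u' v' : ℝ} {x x' : X}
    (hx : HullPt 𝓟 γ l u v x) (hx' : HullPt 𝓟 γ l u' v' x') (hvu : v ≤ u') :
    dist x x' = dist x (γ v) + (u' - v) + dist (γ u') x' := by
  have h1 := hx.transit_right h hγ
  have h2 := hx'.transit_left h hγ
  have e1 : _ + _ = _ := hx.btw h hγ hx' h1 le_rfl hvu
  have e2 : _ + _ = _ := h1.hullPt.btw h hγ hx' h2 hvu le_rfl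
  rw [hγ.dist_le h1.1.1 hvu h2.1.2] at e2
  linarith

theorem HullPt.mem_piece {u v : ℝ} {x : X} (hx : HullPt 𝓟 γ l u v x) (hne : x ≠ γ u ∨ x ≠ γ v) :
    ∃ A, PieceIvl 𝓟 γ l A u v ∧ x ∈ A := by
  rcases hx with ⟨rfl, -, rfl⟩ | h
  · rcases hne with h | h <;> exact absurd rfl h
  · exact h

/-- At a point of a piece which is not on the geodesic there is only one direction. -/
theorem PieceIvl.dir (h : IsTreeGraded 𝓟) (hγ : IsGeodesicOn γ l) {A : Set X} {u v u' v' : ℝ}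
    {q y : X} (hi : PieceIvl 𝓟 γ l A u v) (hq : q ∈ A) (hqu : q ≠ γ u) (hqv : q ≠ γ v)
    (hy : HullPt 𝓟 γ l u' v' y) (hyq : y ≠ q) : SameDir 𝓟 q y (γ u) := by
  have huv := h.sameDir_of_mem_piece hi.mem (q := q) hi.left_mem hi.right_mem hqu.symm hqv.symm
  rcases (hi.hullPt hq).compare h hγ hy with ⟨rfl, rfl⟩ | h1 | h1
  · by_cases hyu : y = γ u
    · rw [hyu]; exact h.sameDir_refl hqu.symm
    obtain ⟨B, hB, hyB⟩ := hy.mem_piece (Or.inl hyu)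
    rw [← h.piece_eq hi.mem hB.mem (hi.ne hγ) hi.left_mem hi.right_mem hB.left_mem hB.right_mem]
      at hyB
    exact h.sameDir_of_mem_piece hi.mem hyB hi.left_mem hyq hqu.symm
  · have := (hi.hullPt hq).btw h hγ hy (hi.transit_right h hγ) le_rfl h1
    exact h.sameDir_trans (h.sameDir_of_btw hqv.symm this).symm huv.symm
  · have := hy.btw h hγ (hi.hullPt hq) (hi.transit_left h hγ) h1 le_rfl
    exact (h.sameDir_of_btw hqu.symm this.symm).symm

theorem exists_hullPt (h : IsTreeGraded 𝓟) (hγ : IsGeodesicOn γ l) {t : ℝ} (ht : t ∈ Icc 0 l) :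
    ∃ u v, HullPt 𝓟 γ l u v (γ t) := by
  by_cases hn : Transit 𝓟 γ l t
  · exact ⟨t, t, hn.hullPt⟩
  · obtain ⟨A, u, v, hi, h1, h2⟩ := exists_pieceIvl_of_not_transit h hγ ht hn
    exact ⟨u, v, hi.hullPt ((hi.mem_iff t ht).2 ⟨h1.le, h2.le⟩)⟩

/-- A cut point between hull points also separates the points of the geodesic in their pieces, hence
lies on the geodesic. A piece with two hull points contains, by convexity, the points of the
geodesic between them: it is one of their own pieces or meets the geodesic in a non-trivial
interval. -/
theorem saturated_hull (h : IsTreeGraded 𝓟) (hγ : IsGeodesicOn γ l) :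
    Saturated 𝓟 {x | ∃ u v, HullPt 𝓟 γ l u v x} where
  cut := by
    rintro y ⟨u, v, hy⟩ z ⟨u', v', hz⟩ q hq
    have near : ∀ {u v : ℝ} {y : X}, HullPt 𝓟 γ l u v y → ¬ Sep 𝓟 q y (γ v) ∧
        ¬ Sep 𝓟 q (γ u) y := by
      rintro u v y (⟨rfl, -, rfl⟩ | ⟨A, hi, hyA⟩)
      · exact ⟨fun hs => hs.2.2 (h.sameDir_refl hs.1), fun hs => hs.2.2 (h.sameDir_refl hs.1)⟩
      · exact ⟨h.not_sep_of_mem_piece hi.mem hyA hi.right_mem,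
          h.not_sep_of_mem_piece hi.mem hi.left_mem hyA⟩
    have key : ∀ {u v u' v' : ℝ} {y z : X}, HullPt 𝓟 γ l u v y → HullPt 𝓟 γ l u' v' z → v ≤ u' →
        Sep 𝓟 q y z → ∃ u v, HullPt 𝓟 γ l u v q := by
      intro u v u' v' y z hy hz hvu hq
      have h1 := hy.transit_right h hγ
      have h2 := hz.transit_left h hγ
      by_cases hqv : γ v = q
      · rw [← hqv]; exact ⟨v, v, h1.hullPt⟩
      by_cases hqu : γ u' = q
      · rw [← hqu]; exact ⟨u', u', h2.hullPt⟩
      have hs := (h.sep_or_sep hq hqv).resolve_left (near hy).1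
      have hs := (h.sep_or_sep hs hqu).resolve_right (near hz).2
      obtain ⟨t, ht, rfl⟩ := h.sep_mem_geodesic hs (hγ.shift h1.1.1 hvu h2.1.2) (by simp) (by simp)
      exact exists_hullPt h hγ ⟨by linarith [ht.1, h1.1.1], by linarith [ht.2, h2.1.2]⟩
    rcases hy.compare h hγ hz with ⟨rfl, rfl⟩ | h1 | h1
    · exfalso
      rcases hy with ⟨rfl, -, rfl⟩ | ⟨A, hi, hyA⟩
      · exact (near hz).2 hq
      · by_cases hzu : z = γ u
        · rw [hzu] at hq
          exact h.not_sep_of_mem_piece hi.mem hyA hi.left_mem hq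
        obtain ⟨B, hB, hzB⟩ := hz.mem_piece (Or.inl hzu)
        rw [← h.piece_eq hi.mem hB.mem (hi.ne hγ) hi.left_mem hi.right_mem hB.left_mem hB.right_mem]
          at hzB
        exact h.not_sep_of_mem_piece hi.mem hyA hzB hq
    · exact key hy hz h1 hq
    · exact key hz hy h1 hq.symm
  piece := by
    have key : ∀ B ∈ 𝓟, ∀ {u v u' v' : ℝ} {y z : X}, HullPt 𝓟 γ l u v y → HullPt 𝓟 γ l u' v' z →
        v ≤ u' → y ∈ B → z ∈ B → y ≠ z → B ⊆ {x | ∃ u v, HullPt 𝓟 γ l u v x} := by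
      intro B hB u v u' v' y z hy hz hvu hyB hzB hne
      have h1 := hy.transit_right h hγ
      have h2 := hz.transit_left h hγ
      have hvB := h.piece_convex hB hyB hzB (hy.btw h hγ hz h1 le_rfl hvu)
      have huB := h.piece_convex hB hyB hzB (hy.btw h hγ hz h2 hvu le_rfl)
      by_cases hyv : y = γ v
      · by_cases hzu : z = γ u'
        · have hlt : v < u' := lt_of_le_of_ne hvu (fun hc => hne (by rw [hyv, hzu, hc]))
          obtain ⟨a, b, hi, -, -⟩ := exists_pieceIvl h hγ hB h1.1.1 hlt h2.1.2 hvB huB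
          exact fun x hx => ⟨a, b, hi.hullPt hx⟩
        · obtain ⟨A, hi, hzA⟩ := hz.mem_piece (Or.inl hzu)
          rw [h.piece_eq hB hi.mem hzu hzB huB hzA hi.left_mem]
          exact fun x hx => ⟨u', v', hi.hullPt hx⟩
      · obtain ⟨A, hi, hyA⟩ := hy.mem_piece (Or.inr hyv)
        rw [h.piece_eq hB hi.mem hyv hyB hvB hyA hi.right_mem]
        exact fun x hx => ⟨u, v, hi.hullPt hx⟩
    rintro B hB y hyB z hzB ⟨u, v, hy⟩ ⟨u', v', hz⟩ hne
    rcases hy.compare h hγ hz with ⟨rfl, rfl⟩ | h1 | h1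
    · by_cases huv : u = v
      · exact key B hB hy hz huv.ge hyB hzB hne
      · have hp : ∀ {x : X}, HullPt 𝓟 γ l u v x → ∃ A, PieceIvl 𝓟 γ l A u v ∧ x ∈ A := by
          rintro x (⟨h1, -⟩ | h1)
          · exact absurd h1 huv
          · exact h1
        obtain ⟨A, hi, hyA⟩ := hp hy
        obtain ⟨C, hC, hzC⟩ := hp hz
        rw [← h.piece_eq hi.mem hC.mem (hi.ne hγ) hi.left_mem hi.right_mem hC.left_mem hC.right_mem]
          at hzC
        rw [h.piece_eq hB hi.mem hne hyB hzB hyA hzC]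
        exact fun x hx => ⟨u, v, hi.hullPt hx⟩
    · exact key B hB hy hz h1 hyB hzB hne
    · exact key B hB hz hy h1 hzB hyB hne.symm

end Hull

/-! ### Branches: partial equivalences along one direction -/

section Branch

variable {F G : Type u} [MetricSpace F] [MetricSpace G] {𝓕 : Set (Set F)} {𝓖 : Set (Set G)}
  {k : ℝ}

/-- `Φ` is the graph of a `k`-bilipschitz bijection from `A` onto `A'`. -/
structure PieceMap (k : ℝ) (A : Set F) (A' : Set G) (Φ : Set (F × G)) : Prop where
  fst : Prod.fst '' Φ = A
  snd : Prod.snd '' Φ = A'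
  bilip : ∀ a ∈ Φ, ∀ b ∈ Φ, k⁻¹ * dist a.1 b.1 ≤ dist a.2 b.2 ∧ dist a.2 b.2 ≤ k * dist a.1 b.1

theorem PieceMap.fst_mem {A : Set F} {A' : Set G} {Φ : Set (F × G)} (h : PieceMap k A A' Φ)
    {a : F × G} (ha : a ∈ Φ) : a.1 ∈ A := h.fst ▸ ⟨a, ha, rfl⟩

theorem PieceMap.snd_mem {A : Set F} {A' : Set G} {Φ : Set (F × G)} (h : PieceMap k A A' Φ)
    {a : F × G} (ha : a ∈ Φ) : a.2 ∈ A' := h.snd ▸ ⟨a, ha, rfl⟩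

/-- A partial equivalence `T` all of whose points are in the direction of `x` from `p.1`, and in
the direction of `x'` from `p.2`. -/
structure Branch (𝓕 : Set (Set F)) (𝓖 : Set (Set G)) (k : ℝ) (p : F × G) (x : F) (x' : G)
    (T : Set (F × G)) : Prop extends PartialEquiv 𝓕 𝓖 k T where
  base : p ∈ T
  dir : ∀ y ∈ T, y.1 ≠ p.1 → SameDir 𝓕 p.1 y.1 x ∧ SameDir 𝓖 p.2 y.2 x'
  nontrivial : ∃ y ∈ T, y.1 ≠ p.1
  thin : ∀ q ∈ T, Thin 𝓕 T q

/-- This is the branch for a germ that starts inside a piece. Points of one piece are never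
separated, so preservation of separation and thinness are vacuous. -/
theorem PieceMap.branch (hF : IsTreeGraded 𝓕) (hG : IsTreeGraded 𝓖) (hk : 1 ≤ k) {A : Set F}
    {A' : Set G} (hA : A ∈ 𝓕) (hA' : A' ∈ 𝓖) {T : Set (F × G)} (hT : PieceMap k A A' T) {p : F × G}
    (hp : p ∈ T) {x : F} {x' : G} (hx : x ∈ A) (hx' : x' ∈ A') (hxp : x ≠ p.1) (hxp' : x' ≠ p.2) :
    Branch 𝓕 𝓖 k p x x' T := by
  have hns : ∀ q, ∀ y ∈ T, ∀ z ∈ T, ¬ Sep 𝓕 q y.1 z.1 := fun q y hy z hz =>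
    hF.not_sep_of_mem_piece hA (hT.fst_mem hy) (hT.fst_mem hz)
  refine ⟨⟨hk, hT.bilip, ?_, ?_, ?_⟩, hp, ?_, ?_, ?_⟩
  · intro q _ y hy z hz
    exact ⟨fun h => absurd h (hns _ y hy z hz), fun h => absurd h
      (hG.not_sep_of_mem_piece hA' (hT.snd_mem hy) (hT.snd_mem hz))⟩
  · rw [hT.fst]; exact saturated_of_piece hF hA
  · rw [hT.snd]; exact saturated_of_piece hG hA'
  · intro y hy hne
    exact ⟨hF.sameDir_of_mem_piece hA (hT.fst_mem hy) hx hne hxp,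
      hG.sameDir_of_mem_piece hA' (hT.snd_mem hy) hx'
        (mt (eq_iff_of_bilip hk (hT.bilip y hy p hp)).2 hne) hxp'⟩
  · rw [← hT.fst] at hx
    obtain ⟨y, hy, rfl⟩ := hx
    exact ⟨y, hy, hxp⟩
  · intro q _ y hy z hz w _ h
    exact hns _ y hy z hz h.1

/-- Two geodesics with corresponding intervals, and maps between the corresponding pieces. -/
structure GeodesicMatch (𝓕 : Set (Set F)) (𝓖 : Set (Set G)) (k : ℝ) (γ : ℝ → F) (l : ℝ)
    (γ' : ℝ → G) (l' : ℝ) (σ : ℝ → ℝ) (Φ : ℝ → ℝ → Set (F × G)) : Prop where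
  one_le : 1 ≤ k
  pos : 0 < l
  geodesic : IsGeodesicOn γ l
  geodesic' : IsGeodesicOn γ' l'
  map_zero : σ 0 = 0
  map_last : σ l = l'
  bilip : ∀ u v, 0 ≤ u → u ≤ v → v ≤ l → k⁻¹ * (v - u) ≤ σ v - σ u ∧ σ v - σ u ≤ k * (v - u)
  ivl : ∀ A u v, PieceIvl 𝓕 γ l A u v → ∃ A', PieceIvl 𝓖 γ' l' A' (σ u) (σ v) ∧
    PieceMap k A A' (Φ u v) ∧ (γ u, γ' (σ u)) ∈ Φ u v ∧ (γ v, γ' (σ v)) ∈ Φ u v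
  ivl' : ∀ A' u' v', PieceIvl 𝓖 γ' l' A' u' v' → ∃ A u v, PieceIvl 𝓕 γ l A u v ∧ σ u = u' ∧ σ v = v'

namespace GeodesicMatch

variable {γ : ℝ → F} {l : ℝ} {γ' : ℝ → G} {l' : ℝ} {σ : ℝ → ℝ} {Φ : ℝ → ℝ → Set (F × G)}

theorem le_iff (M : GeodesicMatch 𝓕 𝓖 k γ l γ' l' σ Φ) {u v : ℝ} (hu : u ∈ Icc 0 l)
    (hv : v ∈ Icc 0 l) : σ u ≤ σ v ↔ u ≤ v := by
  have hk : 0 < k⁻¹ := inv_pos.2 (by linarith [M.one_le])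
  constructor
  · intro h
    by_contra hc
    rw [not_le] at hc
    have := (M.bilip v u hv.1 hc.le hu.2).1
    have : 0 < k⁻¹ * (u - v) := mul_pos hk (by linarith)
    linarith
  · intro h
    have := (M.bilip u v hu.1 h hv.2).1
    have : 0 ≤ k⁻¹ * (v - u) := mul_nonneg hk.le (by linarith)
    linarith

theorem lt_iff (M : GeodesicMatch 𝓕 𝓖 k γ l γ' l' σ Φ) {u v : ℝ} (hu : u ∈ Icc 0 l)
    (hv : v ∈ Icc 0 l) : σ u < σ v ↔ u < v := by
  rw [← not_le, ← not_le, M.le_iff hv hu]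

theorem mem_Icc (M : GeodesicMatch 𝓕 𝓖 k γ l γ' l' σ Φ) {t : ℝ} (ht : t ∈ Icc 0 l) :
    σ t ∈ Icc 0 l' := by
  rw [← M.map_zero, ← M.map_last]
  exact ⟨(M.le_iff ⟨le_rfl, M.pos.le⟩ ht).2 ht.1, (M.le_iff ht ⟨M.pos.le, le_rfl⟩).2 ht.2⟩

theorem surj (M : GeodesicMatch 𝓕 𝓖 k γ l γ' l' σ Φ) {t' : ℝ} (ht' : t' ∈ Icc 0 l') :
    ∃ t ∈ Icc 0 l, σ t = t' := by
  have hk := M.one_le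
  have hk' : 0 < k⁻¹ := inv_pos.2 (by linarith)
  have : LipschitzOnWith (Real.toNNReal k) σ (Icc 0 l) := by
    refine LipschitzOnWith.of_le_add_mul _ fun x hx y hy => ?_
    rw [Real.coe_toNNReal k (by linarith), Real.dist_eq]
    rcases le_total y x with h | h
    · have := (M.bilip y x hy.1 h hx.2).2
      rw [abs_of_nonneg (by linarith)]; linarith
    · have := (M.le_iff hx hy).2 h
      have : 0 ≤ k * |x - y| := mul_nonneg (by linarith) (abs_nonneg _)
      linarith
  rw [← M.map_zero, ← M.map_last] at ht'
  exact intermediate_value_Icc M.pos.le this.continuousOn ht'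

/-- Transit times are the complement of the interiors of the piece intervals, and the increasing map
`σ` puts these intervals in correspondence. -/
theorem transit (hF : IsTreeGraded 𝓕) (hG : IsTreeGraded 𝓖)
    (M : GeodesicMatch 𝓕 𝓖 k γ l γ' l' σ Φ) {t : ℝ} (ht : t ∈ Icc 0 l) :
    Transit 𝓖 γ' l' (σ t) ↔ Transit 𝓕 γ l t := by
  constructor
  · intro h
    by_contra hn
    obtain ⟨A, u, v, hi, h1, h2⟩ := exists_pieceIvl_of_not_transit hF M.geodesic ht hn
    obtain ⟨A', hi', -⟩ := M.ivl A u v hi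
    have hu := (hi.transit_left hF M.geodesic).1
    have hv := (hi.transit_right hF M.geodesic).1
    rcases hi'.not_transit h with h3 | h3
    · exact absurd ((M.le_iff hv ht).1 h3) (not_le.2 h2)
    · exact absurd ((M.le_iff ht hu).1 h3) (not_le.2 h1)
  · intro h
    by_contra hn
    obtain ⟨A', u', v', hi', h1, h2⟩ :=
      exists_pieceIvl_of_not_transit hG M.geodesic' (M.mem_Icc ht) hn
    obtain ⟨A, u, v, hi, rfl, rfl⟩ := M.ivl' A' u' v' hi'
    have hu := (hi.transit_left hF M.geodesic).1
    have hv := (hi.transit_right hF M.geodesic).1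
    rcases hi.not_transit h with h3 | h3
    · exact absurd ((M.le_iff hv ht).2 h3) (not_le.2 h2)
    · exact absurd ((M.le_iff ht hu).2 h3) (not_le.2 h1)

/-- Corresponding points of the unions of pieces along the two geodesics. -/
def Rel (𝓕 : Set (Set F)) (γ : ℝ → F) (l : ℝ) (γ' : ℝ → G) (σ : ℝ → ℝ) (Φ : ℝ → ℝ → Set (F × G))
    (u v : ℝ) (a : F × G) : Prop :=
  (u = v ∧ Transit 𝓕 γ l u ∧ a = (γ u, γ' (σ u))) ∨ ∃ A, PieceIvl 𝓕 γ l A u v ∧ a ∈ Φ u v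

/-- The correspondence between the unions of pieces along the two geodesics. -/
def graph (𝓕 : Set (Set F)) (γ : ℝ → F) (l : ℝ) (γ' : ℝ → G) (σ : ℝ → ℝ)
    (Φ : ℝ → ℝ → Set (F × G)) : Set (F × G) :=
  {a | ∃ u v, Rel 𝓕 γ l γ' σ Φ u v a}

theorem rel_fst (M : GeodesicMatch 𝓕 𝓖 k γ l γ' l' σ Φ) {u v : ℝ} {a : F × G}
    (ha : Rel 𝓕 γ l γ' σ Φ u v a) : HullPt 𝓕 γ l u v a.1 := by
  rcases ha with ⟨h1, h2, rfl⟩ | ⟨A, hi, ha⟩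
  · exact Or.inl ⟨h1, h2, rfl⟩
  · obtain ⟨A', -, hΦ, -⟩ := M.ivl A u v hi
    exact hi.hullPt (hΦ.fst_mem ha)

theorem rel_snd (hF : IsTreeGraded 𝓕) (hG : IsTreeGraded 𝓖)
    (M : GeodesicMatch 𝓕 𝓖 k γ l γ' l' σ Φ) {u v : ℝ} {a : F × G}
    (ha : Rel 𝓕 γ l γ' σ Φ u v a) : HullPt 𝓖 γ' l' (σ u) (σ v) a.2 := by
  rcases ha with ⟨rfl, h2, rfl⟩ | ⟨A, hi, ha⟩
  · exact Or.inl ⟨rfl, (M.transit hF hG h2.1).2 h2, rfl⟩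
  · obtain ⟨A', hi', hΦ, -⟩ := M.ivl A u v hi
    exact hi'.hullPt (hΦ.snd_mem ha)

theorem rel_bilip_ends (M : GeodesicMatch 𝓕 𝓖 k γ l γ' l' σ Φ) {u v : ℝ} {a : F × G}
    (ha : Rel 𝓕 γ l γ' σ Φ u v a) :
    (k⁻¹ * dist (γ u) a.1 ≤ dist (γ' (σ u)) a.2 ∧ dist (γ' (σ u)) a.2 ≤ k * dist (γ u) a.1) ∧
    (k⁻¹ * dist a.1 (γ v) ≤ dist a.2 (γ' (σ v)) ∧ dist a.2 (γ' (σ v)) ≤ k * dist a.1 (γ v)) := by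
  rcases ha with ⟨rfl, h2, rfl⟩ | ⟨A, hi, ha⟩
  · simp
  · obtain ⟨A', hi', hΦ, h1, h2⟩ := M.ivl A u v hi
    exact ⟨hΦ.bilip _ h1 _ ha, hΦ.bilip _ ha _ h2⟩

/-- For points attached to different intervals, `HullPt.dist` splits both distances into three
terms; the outer ones are compared by the piece maps and the middle one by `σ`. -/
theorem bilip_graph (hF : IsTreeGraded 𝓕) (hG : IsTreeGraded 𝓖)
    (M : GeodesicMatch 𝓕 𝓖 k γ l γ' l' σ Φ) {a b : F × G}
    (ha : a ∈ graph 𝓕 γ l γ' σ Φ) (hb : b ∈ graph 𝓕 γ l γ' σ Φ) :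
    k⁻¹ * dist a.1 b.1 ≤ dist a.2 b.2 ∧ dist a.2 b.2 ≤ k * dist a.1 b.1 := by
  have key : ∀ {u v u' v' : ℝ} {a b : F × G}, Rel 𝓕 γ l γ' σ Φ u v a → Rel 𝓕 γ l γ' σ Φ u' v' b →
      v ≤ u' → k⁻¹ * dist a.1 b.1 ≤ dist a.2 b.2 ∧ dist a.2 b.2 ≤ k * dist a.1 b.1 := by
    intro u v u' v' a b ha hb hvu
    have hv := ((M.rel_fst ha).transit_right hF M.geodesic).1
    have hu := ((M.rel_fst hb).transit_left hF M.geodesic).1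
    rw [(M.rel_fst ha).dist hF M.geodesic (M.rel_fst hb) hvu,
      (M.rel_snd hF hG ha).dist hG M.geodesic' (M.rel_snd hF hG hb) ((M.le_iff hv hu).2 hvu)]
    have h1 := (M.rel_bilip_ends ha).2
    have h2 := (M.rel_bilip_ends hb).1
    have h3 := M.bilip v u' hv.1 hvu hu.2
    simp only [mul_add]
    exact ⟨by linarith, by linarith⟩
  obtain ⟨u, v, ha⟩ := ha
  obtain ⟨u', v', hb⟩ := hb
  rcases (M.rel_fst ha).compare hF M.geodesic (M.rel_fst hb) with ⟨rfl, rfl⟩ | h | h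
  · by_cases huv : u = v
    · exact key ha hb huv.ge
    · rcases ha with ⟨h, -⟩ | ⟨A, hi, ha⟩
      · exact absurd h huv
      rcases hb with ⟨h, -⟩ | ⟨B, -, hb⟩
      · exact absurd h huv
      obtain ⟨A', hi', hΦ, -⟩ := M.ivl A u v hi
      exact hΦ.bilip a ha b hb
  · exact key ha hb h
  · have := key hb ha h
    rwa [dist_comm b.1, dist_comm b.2] at this

theorem mem_graph (_M : GeodesicMatch 𝓕 𝓖 k γ l γ' l' σ Φ) {t : ℝ} (ht : Transit 𝓕 γ l t) :
    (γ t, γ' (σ t)) ∈ graph 𝓕 γ l γ' σ Φ := ⟨t, t, Or.inl ⟨rfl, ht, rfl⟩⟩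

/-- Either `q` is a point of the geodesics, or it lies off them and has only one direction. -/
theorem graph_cases (hF : IsTreeGraded 𝓕) (hG : IsTreeGraded 𝓖)
    (M : GeodesicMatch 𝓕 𝓖 k γ l γ' l' σ Φ) {q : F × G} (hq : q ∈ graph 𝓕 γ l γ' σ Φ) :
    (∃ t, Transit 𝓕 γ l t ∧ q = (γ t, γ' (σ t))) ∨
      ∀ y ∈ graph 𝓕 γ l γ' σ Φ, ∀ z ∈ graph 𝓕 γ l γ' σ Φ,
        ¬ Sep 𝓕 q.1 y.1 z.1 ∧ ¬ Sep 𝓖 q.2 y.2 z.2 := by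
  obtain ⟨u, v, hq'⟩ := hq
  rcases hq' with ⟨rfl, ht, rfl⟩ | ⟨A, hi, hqΦ⟩
  · exact Or.inl ⟨u, ht, rfl⟩
  obtain ⟨A', hi', hΦ, hu, hv⟩ := M.ivl A u v hi
  by_cases hqu : q.1 = γ u
  · exact Or.inl ⟨u, hi.transit_left hF M.geodesic, Prod.ext hqu
      ((eq_iff_of_bilip M.one_le (hΦ.bilip _ hqΦ _ hu)).1 hqu)⟩
  by_cases hqv : q.1 = γ v
  · exact Or.inl ⟨v, hi.transit_right hF M.geodesic, Prod.ext hqv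
      ((eq_iff_of_bilip M.one_le (hΦ.bilip _ hqΦ _ hv)).1 hqv)⟩
  have hqu' : q.2 ≠ γ' (σ u) := mt (eq_iff_of_bilip M.one_le (hΦ.bilip _ hqΦ _ hu)).2 hqu
  have hqv' : q.2 ≠ γ' (σ v) := mt (eq_iff_of_bilip M.one_le (hΦ.bilip _ hqΦ _ hv)).2 hqv
  right
  rintro y ⟨a, b, hy⟩ z ⟨c, d, hz⟩
  constructor
  · intro h
    have h1 := hi.dir hF M.geodesic (hΦ.fst_mem hqΦ) hqu hqv (M.rel_fst hy) h.1
    have h2 := hi.dir hF M.geodesic (hΦ.fst_mem hqΦ) hqu hqv (M.rel_fst hz) h.2.1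
    exact h.2.2 (hF.sameDir_trans h1 h2.symm)
  · intro h
    have h1 := hi'.dir hG M.geodesic' (hΦ.snd_mem hqΦ) hqu' hqv' (M.rel_snd hF hG hy) h.1
    have h2 := hi'.dir hG M.geodesic' (hΦ.snd_mem hqΦ) hqu' hqv' (M.rel_snd hF hG hz) h.2.1
    exact h.2.2 (hG.sameDir_trans h1 h2.symm)

/-- At a point of the geodesics each point lies to the left or to the right. -/
theorem left_or_right (hF : IsTreeGraded 𝓕) (hG : IsTreeGraded 𝓖)
    (M : GeodesicMatch 𝓕 𝓖 k γ l γ' l' σ Φ) {t : ℝ} (ht : Transit 𝓕 γ l t) {y : F × G}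
    (hy : y ∈ graph 𝓕 γ l γ' σ Φ) (hne : y.1 ≠ γ t) :
    (0 < t ∧ SameDir 𝓕 (γ t) y.1 (γ 0) ∧ SameDir 𝓖 (γ' (σ t)) y.2 (γ' 0)) ∨
      (t < l ∧ SameDir 𝓕 (γ t) y.1 (γ l) ∧ SameDir 𝓖 (γ' (σ t)) y.2 (γ' l')) := by
  have hne' : y.2 ≠ γ' (σ t) :=
    mt (eq_iff_of_bilip M.one_le (M.bilip_graph hF hG hy (M.mem_graph ht))).2 hne
  obtain ⟨u, v, hy⟩ := hy
  have h1 := M.rel_fst hy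
  have h2 := M.rel_snd hF hG hy
  have ht' := (M.transit hF hG ht.1).2 ht
  rcases h1.le_or_le ht with h | h
  · left
    obtain ⟨a, b⟩ := h1.dir_left hF M.geodesic ht h hne
    exact ⟨a, b, (h2.dir_left hG M.geodesic' ht'
      ((M.le_iff (h1.transit_right hF M.geodesic).1 ht.1).2 h) hne').2⟩
  · right
    obtain ⟨a, b⟩ := h1.dir_right hF M.geodesic ht h hne
    exact ⟨a, b, (h2.dir_right hG M.geodesic' ht'
      ((M.le_iff ht.1 (h1.transit_left hF M.geodesic).1).2 h) hne').2⟩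

theorem transit_sep (hF : IsTreeGraded 𝓕) (hG : IsTreeGraded 𝓖)
    (M : GeodesicMatch 𝓕 𝓖 k γ l γ' l' σ Φ) {t : ℝ} (ht : Transit 𝓕 γ l t) (h0 : 0 < t)
    (hl : t < l) : Sep 𝓕 (γ t) (γ 0) (γ l) ∧ Sep 𝓖 (γ' (σ t)) (γ' 0) (γ' l') := by
  refine ⟨ht.sep hF M.geodesic h0 hl, ((M.transit hF hG ht.1).2 ht).sep hG M.geodesic' ?_ ?_⟩
  · have := (M.lt_iff ⟨le_rfl, M.pos.le⟩ ht.1).2 h0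
    rwa [M.map_zero] at this
  · have := (M.lt_iff ht.1 ⟨M.pos.le, le_rfl⟩).2 hl
    rwa [M.map_last] at this

/-- Separation occurs only at transit points, between the left and the right side, and the two sides
correspond. This also gives thinness: of three points, two are on the same side. -/
theorem branch (hF : IsTreeGraded 𝓕) (hG : IsTreeGraded 𝓖)
    (M : GeodesicMatch 𝓕 𝓖 k γ l γ' l' σ Φ) :
    Branch 𝓕 𝓖 k (γ 0, γ' 0) (γ l) (γ' l') (graph 𝓕 γ l γ' σ Φ) := by
  have h0 : Transit 𝓕 γ l 0 := transit_zero M.pos.le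
  have hbase := M.mem_graph h0
  have hlast := M.mem_graph (transit_last (𝓟 := 𝓕) (γ := γ) M.pos.le)
  rw [M.map_zero] at hbase
  rw [M.map_last] at hlast
  have hgr : ∀ a ∈ graph 𝓕 γ l γ' σ Φ, ∀ b ∈ graph 𝓕 γ l γ' σ Φ, a.1 = b.1 ↔ a.2 = b.2 :=
    fun a ha b hb => eq_iff_of_bilip M.one_le (M.bilip_graph hF hG ha hb)
  refine ⟨⟨M.one_le, fun a ha b hb => M.bilip_graph hF hG ha hb, ?_, ?_, ?_⟩, hbase, ?_, ?_, ?_⟩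
  · intro q hq y hy z hz
    by_cases hyq : y.1 = q.1
    · exact ⟨fun h => absurd hyq h.1, fun h => absurd ((hgr y hy q hq).1 hyq) h.1⟩
    by_cases hzq : z.1 = q.1
    · exact ⟨fun h => absurd hzq h.2.1, fun h => absurd ((hgr z hz q hq).1 hzq) h.2.1⟩
    rcases M.graph_cases hF hG hq with ⟨t, ht, rfl⟩ | h
    · rcases M.left_or_right hF hG ht hy hyq with ⟨a1, a2, a3⟩ | ⟨a1, a2, a3⟩ <;>
      rcases M.left_or_right hF hG ht hz hzq with ⟨b1, b2, b3⟩ | ⟨b1, b2, b3⟩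
      · exact ⟨fun h => absurd (hF.sameDir_trans a2 b2.symm) h.2.2,
          fun h => absurd (hG.sameDir_trans a3 b3.symm) h.2.2⟩
      · have := M.transit_sep hF hG ht a1 b1
        exact ⟨fun _ => (hG.sep_congr a3 b3).2 this.2, fun _ => (hF.sep_congr a2 b2).2 this.1⟩
      · have := M.transit_sep hF hG ht b1 a1
        exact ⟨fun _ => (hG.sep_congr a3 b3).2 this.2.symm,
          fun _ => (hF.sep_congr a2 b2).2 this.1.symm⟩
      · exact ⟨fun h => absurd (hF.sameDir_trans a2 b2.symm) h.2.2,
          fun h => absurd (hG.sameDir_trans a3 b3.symm) h.2.2⟩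
    · exact ⟨fun h1 => absurd h1 (h y hy z hz).1, fun h1 => absurd h1 (h y hy z hz).2⟩
  · have : Prod.fst '' graph 𝓕 γ l γ' σ Φ = {x | ∃ u v, HullPt 𝓕 γ l u v x} := by
      ext x
      constructor
      · rintro ⟨a, ⟨u, v, ha⟩, rfl⟩
        exact ⟨u, v, M.rel_fst ha⟩
      · rintro ⟨u, v, ⟨rfl, ht, rfl⟩ | ⟨A, hi, hx⟩⟩
        · exact ⟨_, M.mem_graph ht, rfl⟩
        · obtain ⟨A', hi', hΦ, -⟩ := M.ivl A u v hi
          rw [← hΦ.fst] at hx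
          obtain ⟨a, ha, rfl⟩ := hx
          exact ⟨a, ⟨u, v, Or.inr ⟨A, hi, ha⟩⟩, rfl⟩
    rw [this]
    exact saturated_hull hF M.geodesic
  · have : Prod.snd '' graph 𝓕 γ l γ' σ Φ = {x | ∃ u v, HullPt 𝓖 γ' l' u v x} := by
      ext x
      constructor
      · rintro ⟨a, ⟨u, v, ha⟩, rfl⟩
        exact ⟨σ u, σ v, M.rel_snd hF hG ha⟩
      · rintro ⟨u', v', ⟨rfl, ht, rfl⟩ | ⟨A', hi', hx⟩⟩
        · obtain ⟨t, ht', rfl⟩ := M.surj ht.1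
          exact ⟨_, M.mem_graph ((M.transit hF hG ht').1 ht), rfl⟩
        · obtain ⟨A, u, v, hi, rfl, rfl⟩ := M.ivl' A' u' v' hi'
          obtain ⟨B', hj', hΦ, -⟩ := M.ivl A u v hi
          rw [hG.piece_eq hi'.mem hj'.mem (hi'.ne M.geodesic') hi'.left_mem hi'.right_mem
            hj'.left_mem hj'.right_mem, ← hΦ.snd] at hx
          obtain ⟨a, ha, rfl⟩ := hx
          exact ⟨a, ⟨u, v, Or.inr ⟨A, hi, ha⟩⟩, rfl⟩
    rw [this]
    exact saturated_hull hG M.geodesic'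
  · intro y hy hne
    rcases M.left_or_right hF hG h0 hy hne with ⟨h, -⟩ | ⟨-, h1, h2⟩
    · exact absurd h (lt_irrefl _)
    · rw [M.map_zero] at h2
      exact ⟨h1, h2⟩
  · refine ⟨_, hlast, fun heq => ?_⟩
    exact M.pos.ne' (M.geodesic.injOn ⟨M.pos.le, le_rfl⟩ ⟨le_rfl, M.pos.le⟩ heq)
  · rintro q hq x hx y hy z hz ⟨h1, h2, h3⟩
    rcases M.graph_cases hF hG hq with ⟨t, ht, rfl⟩ | h
    · rcases M.left_or_right hF hG ht hx h1.1 with ⟨-, a, -⟩ | ⟨-, a, -⟩ <;>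
      rcases M.left_or_right hF hG ht hy h2.1 with ⟨-, b, -⟩ | ⟨-, b, -⟩ <;>
      rcases M.left_or_right hF hG ht hz h3.2.1 with ⟨-, c, -⟩ | ⟨-, c, -⟩ <;>
      first
        | exact h1.2.2 (hF.sameDir_trans a b.symm)
        | exact h2.2.2 (hF.sameDir_trans b c.symm)
        | exact h3.2.2 (hF.sameDir_trans a c.symm)
    · exact (h x hx y hy).1 h1

end GeodesicMatch

end Branch

/-! ### Germs and directions -/

section Germs

variable {X : Type u} [MetricSpace X] {𝓟 : Set (Set X)} {p : X}

theorem GeodesicFrom.dist_eq (γ : GeodesicFrom p) {t : ℝ} (h0 : 0 ≤ t) (hl : t ≤ γ.len) :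
    dist p (γ.toFun t) = t := by
  have := γ.isGeodesic.dist_zero h0 hl
  rwa [γ.start] at this

theorem GeodesicFrom.btw (γ : GeodesicFrom p) {t : ℝ} (h0 : 0 ≤ t) (hl : t ≤ γ.len) :
    Btw p (γ.toFun t) (γ.toFun γ.len) := by
  have := γ.isGeodesic.btw le_rfl h0 hl le_rfl
  rwa [γ.start] at this

theorem GeodesicFrom.ne (γ : GeodesicFrom p) {t : ℝ} (h0 : 0 < t) (hl : t ≤ γ.len) :
    γ.toFun t ≠ p := by
  intro h
  have := γ.dist_eq h0.le hl
  rw [h, dist_self] at this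
  linarith

theorem sameGerm_iff (h : IsTreeGraded 𝓟) (γ γ' : GeodesicFrom p) :
    SameGerm 𝓟 γ γ' ↔ SameDir 𝓟 p (γ.toFun γ.len) (γ'.toFun γ'.len) := by
  constructor
  · rintro ⟨x, hx, h1, h2, A, hA, hA1, hA2⟩
    exact ⟨_, _, γ.ne hx h1, γ.btw hx.le h1, γ'.btw hx.le h2,
      by rw [γ.dist_eq hx.le h1, γ'.dist_eq hx.le h2], A, hA, hA1, hA2⟩
  · intro hs
    obtain ⟨m, hm, h1, h2, H⟩ := IsTreeGraded.SameDir.common_piece h hs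
    rw [γ.dist_eq γ.len_pos.le le_rfl] at h1
    rw [γ'.dist_eq γ'.len_pos.le le_rfl] at h2
    refine ⟨m, hm, h1, h2, H _ _ (γ.btw hm.le h1) (γ'.btw hm.le h2) ?_ ?_⟩
    · rw [γ.dist_eq hm.le h1]
    · rw [γ.dist_eq hm.le h1, γ'.dist_eq hm.le h2]

/-- `SameDir` is already transitive, so passing to the generated equivalence relation identifies
nothing more. -/
theorem germ_eq_iff (h : IsTreeGraded 𝓟) (γ γ' : GeodesicFrom p) :
    (Quot.mk _ γ : Germ 𝓟 p) = Quot.mk _ γ' ↔ SameDir 𝓟 p (γ.toFun γ.len) (γ'.toFun γ'.len) := by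
  constructor
  · intro heq
    have := Quot.eqvGen_exact heq
    induction this with
    | rel a b hab => exact (sameGerm_iff h a b).1 hab
    | refl a => exact h.sameDir_refl (a.ne a.len_pos le_rfl)
    | symm a b _ ih => exact (ih ((Quot.eqvGen_sound ‹_›))).symm
    | trans a b c _ _ ih1 ih2 =>
      exact h.sameDir_trans (ih1 (Quot.eqvGen_sound ‹_›)) (ih2 (Quot.eqvGen_sound ‹_›))
  · intro hs
    exact Quot.sound ((sameGerm_iff h γ γ').2 hs)

/-- The germ `g` points towards `y`. -/
def Toward (g : Germ 𝓟 p) (y : X) : Prop :=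
  ∃ γ : GeodesicFrom p, γ.toFun γ.len = y ∧ Quot.mk _ γ = g

theorem exists_toward (h : IsTreeGraded 𝓟) {y : X} (hy : y ≠ p) : ∃ g : Germ 𝓟 p, Toward g y := by
  obtain ⟨γ, hγ, h0, hl⟩ := h.exists_geodesic p y
  exact ⟨Quot.mk _ ⟨dist p y, dist_pos.2 hy.symm, γ, h0, hγ⟩, _, hl, rfl⟩

theorem Toward.ne {g : Germ 𝓟 p} {y : X} (hg : Toward g y) : y ≠ p := by
  obtain ⟨γ, rfl, -⟩ := hg
  exact γ.ne γ.len_pos le_rfl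

theorem Toward.eq_iff (h : IsTreeGraded 𝓟) {g g' : Germ 𝓟 p} {y z : X} (hg : Toward g y)
    (hg' : Toward g' z) : g = g' ↔ SameDir 𝓟 p y z := by
  obtain ⟨γ, rfl, rfl⟩ := hg
  obtain ⟨γ', rfl, rfl⟩ := hg'
  exact germ_eq_iff h γ γ'

theorem Toward.of_sameDir (h : IsTreeGraded 𝓟) {g : Germ 𝓟 p} {y z : X} (hg : Toward g y)
    (hs : SameDir 𝓟 p y z) : Toward g z := by
  obtain ⟨g', hg'⟩ := exists_toward h hs.ne_right
  rwa [(hg.eq_iff h hg').2 hs]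

end Germs

/-! ### Adding the missing directions at a thin point. -/

section Extend

variable {F G : Type u} [MetricSpace F] [MetricSpace G] {𝓕 : Set (Set F)} {𝓖 : Set (Set G)}
  {k : ℝ} {surj : Prop}

theorem exists_three_of_infinite {α : Type*} {S : Set α} (hS : ¬ S.Finite) :
    ∃ a ∈ S, ∃ b ∈ S, ∃ c ∈ S, a ≠ b ∧ b ≠ c ∧ a ≠ c := by
  classical
  obtain ⟨t, ht, hc⟩ := Set.Infinite.exists_subset_card_eq hS 3
  obtain ⟨a, b, c, hab, hac, hbc, rfl⟩ := Finset.card_eq_three.1 hc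
  exact ⟨a, ht (by simp), b, ht (by simp), c, ht (by simp), hab, hbc, hac⟩

/-- Three distinct germs in use would give three pairwise separated points. On the side of `G` these
are carried back by the preservation of separation. -/
theorem thin_finite (hF : IsTreeGraded 𝓕) (hG : IsTreeGraded 𝓖) {R : Set (F × G)}
    (hR : PartialEquiv 𝓕 𝓖 k R) {p : F × G} (hp : p ∈ R) (ht : Thin 𝓕 R p) :
    {g : Germ 𝓕 p.1 | ∃ y ∈ R, Toward g y.1}.Finite ∧
      {g : Germ 𝓖 p.2 | ∃ y ∈ R, Toward g y.2}.Finite := by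
  constructor
  · by_contra hinf
    obtain ⟨a, ⟨x, hx, hxa⟩, b, ⟨y, hy, hyb⟩, c, ⟨z, hz, hzc⟩, hab, hbc, hac⟩ :=
      exists_three_of_infinite hinf
    refine ht x hx y hy z hz ⟨⟨hxa.ne, hyb.ne, ?_⟩, ⟨hyb.ne, hzc.ne, ?_⟩, ⟨hxa.ne, hzc.ne, ?_⟩⟩
    · rwa [← hxa.eq_iff hF hyb]
    · rwa [← hyb.eq_iff hF hzc]
    · rwa [← hxa.eq_iff hF hzc]
  · by_contra hinf
    obtain ⟨a, ⟨x, hx, hxa⟩, b, ⟨y, hy, hyb⟩, c, ⟨z, hz, hzc⟩, hab, hbc, hac⟩ :=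
      exists_three_of_infinite hinf
    refine ht x hx y hy z hz ?_
    rw [hR.sep p hp x hx y hy, hR.sep p hp y hy z hz, hR.sep p hp x hx z hz]
    refine ⟨⟨hxa.ne, hyb.ne, ?_⟩, ⟨hyb.ne, hzc.ne, ?_⟩, ⟨hxa.ne, hzc.ne, ?_⟩⟩
    · rwa [← hxa.eq_iff hG hyb]
    · rwa [← hyb.eq_iff hG hzc]
    · rwa [← hxa.eq_iff hG hzc]

/-- Outside finite sets, germs at `p.1` are matched with germs at `p.2` along branches. -/
def Matched (𝓕 : Set (Set F)) (𝓖 : Set (Set G)) (k : ℝ) (surj : Prop) (p : F × G) : Prop :=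
  ∀ (S : Set (Germ 𝓕 p.1)) (S' : Set (Germ 𝓖 p.2)), S.Finite → S'.Finite →
    ∃ β : Germ 𝓕 p.1 → Germ 𝓖 p.2, InjOn β Sᶜ ∧ MapsTo β Sᶜ S'ᶜ ∧ (surj → SurjOn β Sᶜ S'ᶜ) ∧
      ∀ g ∈ Sᶜ, ∃ x x' T, Toward g x ∧ Toward (β g) x' ∧ Branch 𝓕 𝓖 k p x x' T

/-- One branch is attached at `p` for each germ not yet in use. Since `β` is injective and avoids
the germs in use at `p.2`, the branches and `R` occupy different directions on both sides and can be
wedged. -/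
theorem Admissible.extend (hF : IsTreeGraded 𝓕) (hG : IsTreeGraded 𝓖) {R : Set (F × G)}
    (hR : Admissible 𝓕 𝓖 k surj R) {p : F × G} (hp : p ∈ R) (ht : Thin 𝓕 R p)
    (hm : Matched 𝓕 𝓖 k surj p) :
    ∃ R', Admissible 𝓕 𝓖 k surj R' ∧ R ⊆ R' ∧ Full 𝓕 𝓖 surj R' p := by
  obtain ⟨hfin, hfin'⟩ := thin_finite hF hG hR.toPartialEquiv hp ht
  obtain ⟨β, hinj, hmaps, hsurj, hbr⟩ := hm _ _ hfin hfin'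
  set S := {g : Germ 𝓕 p.1 | ∃ y ∈ R, Toward g y.1} with hS
  set S' := {g : Germ 𝓖 p.2 | ∃ y ∈ R, Toward g y.2} with hS'
  have hbr' : ∀ g : (Sᶜ : Set _), ∃ x x' T, Toward g.1 x ∧ Toward (β g.1) x' ∧
      Branch 𝓕 𝓖 k p x x' T := fun g => hbr g.1 g.2
  choose x x' T hx hx' hT using hbr'
  -- The index `none` stands for `R` itself.
  let D : Option (Sᶜ : Set _) → Set (F × G) := fun i => i.elim R T
  have hD : ∀ i, PartialEquiv 𝓕 𝓖 k (D i) := by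
    rintro (_ | g)
    · exact hR.toPartialEquiv
    · exact (hT g).toPartialEquiv
  have hpD : ∀ i, p ∈ D i := by
    rintro (_ | g)
    · exact hp
    · exact (hT g).base
  have h1 : ∀ g, ∀ y ∈ R, ∀ z ∈ T g, y.1 ≠ p.1 → z.1 ≠ p.1 →
      Sep 𝓕 p.1 y.1 z.1 ∧ Sep 𝓖 p.2 y.2 z.2 := by
    intro g y hy z hz hyp hzp
    obtain ⟨d1, d2⟩ := (hT g).dir z hz hzp
    have hyp' : y.2 ≠ p.2 := mt (hR.eq_iff hy hp).2 hyp
    have hzp' : z.2 ≠ p.2 := mt ((hT g).eq_iff hz (hT g).base).2 hzp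
    refine ⟨⟨hyp, hzp, fun hs => ?_⟩, ⟨hyp', hzp', fun hs => ?_⟩⟩
    · exact g.2 ⟨y, hy, (hx g).of_sameDir hF (hF.sameDir_trans hs d1).symm⟩
    · exact hmaps g.2 ⟨y, hy, (hx' g).of_sameDir hG (hG.sameDir_trans hs d2).symm⟩
  have hs : ∀ i j, i ≠ j → ∀ y ∈ D i, ∀ z ∈ D j, y.1 ≠ p.1 → z.1 ≠ p.1 →
      Sep 𝓕 p.1 y.1 z.1 ∧ Sep 𝓖 p.2 y.2 z.2 := by
    rintro (_ | g) (_ | g') hij y hy z hz hyp hzp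
    · exact absurd rfl hij
    · exact h1 g' y hy z hz hyp hzp
    · have := h1 g z hz y hy hzp hyp
      exact ⟨this.1.symm, this.2.symm⟩
    · obtain ⟨d1, d2⟩ := (hT g).dir y hy hyp
      obtain ⟨e1, e2⟩ := (hT g').dir z hz hzp
      have hne : g.1 ≠ g'.1 := fun h => hij (by rw [Subtype.ext h])
      refine ⟨(hF.sep_congr d1 e1).2 ⟨(hx g).ne, (hx g').ne, ?_⟩,
        (hG.sep_congr d2 e2).2 ⟨(hx' g).ne, (hx' g').ne, ?_⟩⟩
      · rwa [← (hx g).eq_iff hF (hx g')]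
      · rw [← (hx' g).eq_iff hG (hx' g')]
        exact fun h => hne (hinj g.2 g'.2 h)
  have hRD : R ⊆ ⋃ i, D i := subset_iUnion D none
  have hTD : ∀ g, T g ⊆ ⋃ i, D i := fun g => subset_iUnion D (some g)
  have hcore := PartialEquiv.wedge hF hG none hD hpD hs
  have hfull : Full 𝓕 𝓖 surj (⋃ i, D i) p := by
    refine ⟨fun y hy => ?_, fun hsu y hy => ?_⟩
    · obtain ⟨g, hg⟩ := exists_toward hF hy
      by_cases hgS : g ∈ S
      · obtain ⟨z, hz, hgz⟩ := hgS
        exact ⟨z, hRD hz, (hgz.eq_iff hF hg).1 rfl⟩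
      · obtain ⟨z, hz, hzp⟩ := (hT ⟨g, hgS⟩).nontrivial
        exact ⟨z, hTD _ hz, hF.sameDir_trans ((hT ⟨g, hgS⟩).dir z hz hzp).1
          (((hx ⟨g, hgS⟩).eq_iff hF hg).1 rfl)⟩
    · obtain ⟨g', hg'⟩ := exists_toward hG hy
      by_cases hgS : g' ∈ S'
      · obtain ⟨z, hz, hgz⟩ := hgS
        exact ⟨z, hRD hz, (hgz.eq_iff hG hg').1 rfl⟩
      · obtain ⟨g, hg, rfl⟩ := hsurj hsu hgS
        obtain ⟨z, hz, hzp⟩ := (hT ⟨g, hg⟩).nontrivial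
        exact ⟨z, hTD _ hz, hG.sameDir_trans ((hT ⟨g, hg⟩).dir z hz hzp).2
          (((hx' ⟨g, hg⟩).eq_iff hG hg').1 rfl)⟩
  refine ⟨⋃ i, D i, ⟨hcore, ⟨p, hRD hp⟩, fun q hq => ?_⟩, hRD, hfull⟩
  by_cases hqp : q.1 = p.1
  · rw [hcore.eq_of_fst hq (hRD hp) hqp]
    exact Or.inr hfull
  obtain ⟨i, hqi⟩ := mem_iUnion.1 hq
  have : Thin 𝓕 (D i) q ∨ Full 𝓕 𝓖 surj (D i) q := by
    rcases i with _ | g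
    · exact hR.thin_or_full q hqi
    · exact Or.inl ((hT g).thin q hqi)
  rcases this with h | h
  · exact Or.inl (h.wedge hF hG hD hpD hs hqi hqp)
  · exact Or.inr (h.mono (subset_iUnion D i))

theorem exists_bilipschitz_of_matched (hF : IsTreeGraded 𝓕) (hG : IsTreeGraded 𝓖) (hk : 1 ≤ k)
    [Nonempty F] [Nonempty G] (hm : ∀ p : F × G, Matched 𝓕 𝓖 k surj p) :
    ∃ h : F → G, IsBilipschitz k h ∧ Function.Injective h ∧ (surj → Function.Surjective h) :=
  exists_bilipschitz hF hG hk fun _ hR p hp ht => hR.extend hF hG hp ht (hm p)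

end Extend

/-! ### Initial patterns -/

section Pattern

variable {I : Type u} {P : I → Type u} [∀ i, MetricSpace (P i)] {r : ∀ i, P i}

/-- Either both P-geodesics start with an interval of the same index, or neither starts with an
interval and they agree until some positive time. -/
def PatternEq (Γ Γ' : PGeodesic r) : Prop :=
  (∃ q q', (0, q) ∈ Γ.ivl ∧ (0, q') ∈ Γ'.ivl ∧ (Γ.pt (0, q)).1 = (Γ'.pt (0, q')).1) ∨
  ((∀ a ∈ Γ.ivl, 0 < a.1) ∧ (∀ a ∈ Γ'.ivl, 0 < a.1) ∧ ∃ y > 0, ∀ a : ℝ × ℝ, a.2 ≤ y →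
    (a ∈ Γ.ivl ↔ a ∈ Γ'.ivl) ∧ (a ∈ Γ.ivl → Γ.pt a = Γ'.pt a))

theorem PGeodesic.start_cases (Γ : PGeodesic r) :
    (∃ q, (0, q) ∈ Γ.ivl) ∨ ∀ a ∈ Γ.ivl, 0 < a.1 := by
  by_cases h : ∃ q, (0, q) ∈ Γ.ivl
  · exact Or.inl h
  · right
    intro a ha
    refine lt_of_le_of_ne (Γ.nonneg a ha) fun h0 => h ⟨a.2, ?_⟩
    rw [h0]; exact ha

theorem PGeodesic.start_unique (Γ : PGeodesic r) {q q' : ℝ} (h : (0, q) ∈ Γ.ivl)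
    (h' : (0, q') ∈ Γ.ivl) : q = q' := by
  by_contra hne
  have h1 := Γ.lt _ h
  have h2 := Γ.lt _ h'
  rcases Γ.order h h' (fun heq => hne (congrArg Prod.snd heq)) with h3 | h3 <;> simp at * <;> linarith

theorem PatternEq.refl (Γ : PGeodesic r) : PatternEq Γ Γ := by
  rcases Γ.start_cases with ⟨q, hq⟩ | h
  · exact Or.inl ⟨q, q, hq, hq, rfl⟩
  · exact Or.inr ⟨h, h, 1, one_pos, fun a _ => ⟨Iff.rfl, fun _ => rfl⟩⟩

theorem PatternEq.symm {Γ Γ' : PGeodesic r} (h : PatternEq Γ Γ') : PatternEq Γ' Γ := by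
  rcases h with ⟨q, q', h1, h2, h3⟩ | ⟨h1, h2, y, hy, H⟩
  · exact Or.inl ⟨q', q, h2, h1, h3.symm⟩
  · exact Or.inr ⟨h2, h1, y, hy, fun a ha => ⟨(H a ha).1.symm,
      fun h => ((H a ha).2 ((H a ha).1.2 h)).symm⟩⟩

theorem PatternEq.trans {Γ Γ' Γ'' : PGeodesic r} (h : PatternEq Γ Γ') (h' : PatternEq Γ' Γ'') :
    PatternEq Γ Γ'' := by
  rcases h with ⟨q, q', h1, h2, h3⟩ | ⟨h1, h2, y, hy, H⟩ <;>
    rcases h' with ⟨t, t', k1, k2, k3⟩ | ⟨k1, k2, z, hz, K⟩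
  · rw [Γ'.start_unique h2 k1] at h3
    exact Or.inl ⟨q, t', h1, k2, h3.trans k3⟩
  · exact absurd (k1 _ h2) (lt_irrefl _)
  · exact absurd (h2 _ k1) (lt_irrefl _)
  · refine Or.inr ⟨h1, k2, min y z, lt_min hy hz, fun a ha => ?_⟩
    have H1 := H a (ha.trans (min_le_left _ _))
    have K1 := K a (ha.trans (min_le_right _ _))
    exact ⟨H1.1.trans K1.1, fun h => (H1.2 h).trans (K1.2 (H1.1.1 h))⟩

/-- The delicate point is that both or neither must start with an interval. If only `Γ'` did, with
an interval reaching beyond `x`, density would give an interval of `Γ` inside `[0, x]`, shared with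
`Γ'` and overlapping its first interval. -/
theorem SameInitialPattern.patternEq {Γ Γ' : PGeodesic r} (h : SameInitialPattern Γ Γ') :
    PatternEq Γ Γ' := by
  obtain ⟨x, hx, h1, h2, h3⟩ := h
  have hmem : ∀ a, (a ∈ Γ.ivl ∧ a.2 ≤ x) ↔ (a ∈ Γ'.ivl ∧ a.2 ≤ x) := fun a => Set.ext_iff.1 h1 a
  rcases Γ.start_cases with ⟨q, hq⟩ | h0
  · left
    rcases le_or_gt q x with hqx | hqx
    · exact ⟨q, q, hq, ((hmem _).1 ⟨hq, hqx⟩).1, by rw [h2 _ hq hqx]⟩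
    · obtain ⟨a', ha', ha1, ha2, hidx⟩ := h3 _ hq hx hqx
      have := fst_le_of_pattern Γ' Γ (fun a => (hmem a).2) ha' ha1 hq hqx
      have ha0 : a'.1 = 0 := le_antisymm this (Γ'.nonneg _ ha')
      have : a' = (0, a'.2) := by rw [← ha0]
      rw [this] at ha' hidx
      exact ⟨q, a'.2, hq, ha', hidx⟩
  · refine Or.inr ⟨h0, ?_, x, hx, fun a ha => ⟨⟨fun h => ((hmem a).1 ⟨h, ha⟩).1,
      fun h => ((hmem a).2 ⟨h, ha⟩).1⟩, fun h => h2 a h ha⟩⟩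
    rcases Γ'.start_cases with ⟨q', hq'⟩ | h0'
    swap
    · exact h0'
    exfalso
    rcases le_or_gt q' x with hqx | hqx
    · exact absurd (h0 _ ((hmem _).2 ⟨hq', hqx⟩).1) (lt_irrefl _)
    obtain ⟨b, hb, z, hz0, hzx, hbz, -⟩ := Γ.exists_ivl_between le_rfl (lt_min hx Γ.len_pos)
      (min_le_right _ _)
    have hb0 := h0 b hb
    obtain ⟨c, hc, w, hw0, hwb, hcw, -⟩ := Γ.exists_ivl_between le_rfl hb0
      ((Γ.lt b hb).le.trans (Γ.le_len b hb))
    have hbx : b.1 < x := hbz.trans_lt (hzx.trans_le (min_le_left _ _))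
    have hcb : c.2 ≤ b.1 := by
      have hne : c ≠ b := by rintro rfl; linarith
      have := Γ.lt b hb
      rcases Γ.order hc hb hne with h | h
      · exact h
      · linarith
    have hc' := ((hmem c).1 ⟨hc, by linarith⟩).1
    have hc0 := h0 c hc
    have hclt := Γ.lt c hc
    have hne : c ≠ (0, q') := by rintro rfl; exact lt_irrefl _ hc0
    rcases Γ'.order hc' hq' hne with h | h <;> simp at h <;> linarith

/-- If both start with an interval, half the smaller length is a time before either interval ends.
Otherwise the left end of an interval starting before `y` is a suitable time, since no interval of
`Γ` straddles it. -/
theorem PatternEq.sameInitialPattern {Γ Γ' : PGeodesic r} (h : PatternEq Γ Γ') :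
    SameInitialPattern Γ Γ' := by
  have first : ∀ (Γ : PGeodesic r) {q : ℝ}, (0, q) ∈ Γ.ivl → ∀ a ∈ Γ.ivl, a = (0, q) ∨ q ≤ a.1 := by
    intro Γ q hq a ha
    by_cases hne : a = (0, q)
    · exact Or.inl hne
    · right
      have h1 := Γ.lt a ha
      have h2 := Γ.nonneg a ha
      rcases Γ.order ha hq hne with h | h
      · simp at h; linarith
      · exact h
  rcases h with ⟨q, q', h1, h2, h3⟩ | ⟨h1, h2, y, hy, H⟩
  · have hq : 0 < q := Γ.lt _ h1
    have hq' : 0 < q' := Γ'.lt _ h2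
    have l1 : min q q' ≤ q := min_le_left _ _
    have l2 : min q q' ≤ q' := min_le_right _ _
    have l0 : 0 < min q q' := lt_min hq hq'
    have e1 : ∀ a ∈ Γ.ivl, ¬ a.2 ≤ min q q' / 2 := by
      intro a ha hle
      have := Γ.lt a ha
      rcases first Γ h1 a ha with rfl | h
      · simp at hle; linarith
      · linarith
    have e2 : ∀ a ∈ Γ'.ivl, ¬ a.2 ≤ min q q' / 2 := by
      intro a ha hle
      have := Γ'.lt a ha
      rcases first Γ' h2 a ha with rfl | h
      · simp at hle; linarith
      · linarith
    refine ⟨min q q' / 2, by linarith, ?_, fun a ha hle => absurd hle (e1 a ha), ?_⟩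
    · ext a
      exact ⟨fun h => absurd h.2 (e1 a h.1), fun h => absurd h.2 (e2 a h.1)⟩
    · intro a ha hl hr
      rcases first Γ h1 a ha with rfl | h
      · exact ⟨_, h2, by simpa using hl, by simp; linarith, h3⟩
      · linarith
  · obtain ⟨b, hb, z, hz0, hzx, hbz, -⟩ := Γ.exists_ivl_between le_rfl (lt_min hy Γ.len_pos)
      (min_le_right _ _)
    have hby : b.1 < y := hbz.trans_lt (hzx.trans_le (min_le_left _ _))
    refine ⟨b.1, h1 b hb, ?_, fun a ha hle => (H a (hle.trans hby.le)).2 ha,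
      fun a ha hl hr => absurd ⟨hl, hr⟩ (Γ.fst_notInterior hb a ha)⟩
    ext a
    exact ⟨fun h => ⟨(H a (h.2.trans hby.le)).1.1 h.1, h.2⟩,
      fun h => ⟨(H a (h.2.trans hby.le)).1.2 h.1, h.2⟩⟩

/-- `PatternEq` is visibly an equivalence relation, so the relation generated by
`SameInitialPattern` is no larger than it. -/
theorem patternClass_eq_iff {Γ Γ' : PGeodesic r} :
    (Quot.mk _ Γ : PatternClass r) = Quot.mk _ Γ' ↔ PatternEq Γ Γ' := by
  constructor
  · intro heq
    have := Quot.eqvGen_exact heq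
    clear heq
    induction this with
    | rel a b hab => exact hab.patternEq
    | refl a => exact PatternEq.refl a
    | symm a b _ ih => exact ih.symm
    | trans a b c _ _ ih1 ih2 => exact ih1.trans ih2
  · exact fun h => Quot.sound h.sameInitialPattern

end Pattern

/-! ### Induced P-geodesics -/

section Induced

variable {X : Type u} [MetricSpace X] {𝓟 : Set (Set X)} {p : X}
  {I : Type u} {P : I → Type u} [∀ i, MetricSpace (P i)] {r : ∀ i, P i} {c : Charts 𝓟 r}

theorem maximal_inOnePiece_iff (h : IsTreeGraded 𝓟) {γ : ℝ → X} {l : ℝ} (hγ : IsGeodesicOn γ l)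
    (a : ℝ × ℝ) : (InOnePiece 𝓟 γ l a ∧ ∀ b, InOnePiece 𝓟 γ l b → Ico a.1 a.2 ⊆ Ico b.1 b.2 → b = a) ↔
      ∃ A, PieceIvl 𝓟 γ l A a.1 a.2 := by
  constructor
  · rintro ⟨⟨h0, hlt, hle, A, hA, hsub⟩, hmax⟩
    obtain ⟨u, v, hi, hu, hv⟩ := exists_pieceIvl h hγ hA (u := a.1) (v := (a.1 + a.2) / 2) h0
      (by linarith) (by linarith) (hsub _ ⟨le_rfl, hlt⟩) (hsub _ ⟨by linarith, by linarith⟩)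
    have hav : a.2 ≤ v := by
      by_contra hc
      rw [not_le] at hc
      have := ((hi.mem_iff ((v + a.2) / 2) ⟨by linarith, by linarith⟩).1
        (hsub _ ⟨by linarith, by linarith⟩)).2
      linarith
    have := hmax (u, v) ⟨hi.nonneg, hi.lt, hi.le, A, hA, fun t ht =>
      (hi.mem_iff t ⟨hi.nonneg.trans ht.1, ht.2.le.trans hi.le⟩).2 ⟨ht.1, ht.2.le⟩⟩
      (Ico_subset_Ico hu hav)
    exact ⟨A, this ▸ hi⟩
  · rintro ⟨A, hi⟩
    have hlt := hi.lt
    have hmid : (a.1 + a.2) / 2 ∈ Ico a.1 a.2 := ⟨by linarith, by linarith⟩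
    have hA : ∀ t ∈ Ico a.1 a.2, γ t ∈ A := fun t ht =>
      (hi.mem_iff t ⟨hi.nonneg.trans ht.1, ht.2.le.trans hi.le⟩).2 ⟨ht.1, ht.2.le⟩
    have h0 := hi.nonneg
    have hl := hi.le
    refine ⟨⟨hi.nonneg, hi.lt, hi.le, A, hi.mem, hA⟩, ?_⟩
    rintro b ⟨hb0, hblt, hble, B, hB, hBsub⟩ hab
    have ha1 := hab ⟨le_rfl, hlt⟩
    have hne : γ a.1 ≠ γ ((a.1 + a.2) / 2) := fun heq => by
      have := hγ.injOn ⟨h0, by linarith⟩ ⟨by linarith, by linarith⟩ heq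
      linarith
    have := h.piece_eq hi.mem hB hne hi.left_mem (hA _ hmid) (hBsub _ ha1) (hBsub _ (hab hmid))
    subst this
    have hIcc : ∀ t ∈ Ico b.1 b.2, t ∈ Icc a.1 a.2 := fun t ht =>
      (hi.mem_iff t ⟨hb0.trans ht.1, ht.2.le.trans hble⟩).1 (hBsub t ht)
    have e1 : b.1 = a.1 := le_antisymm ha1.1 (hIcc b.1 ⟨le_rfl, hblt⟩).1
    refine Prod.ext e1 (le_antisymm ?_ ?_)
    · by_contra hc
      rw [not_le] at hc
      have := (hIcc ((a.2 + b.2) / 2) ⟨by linarith, by linarith⟩).2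
      linarith
    · by_contra hc
      rw [not_le] at hc
      exact lt_irrefl _ (hab (show b.2 ∈ Ico a.1 a.2 from ⟨by linarith, hc⟩)).2

theorem Induces.mem_ivl_iff (h : IsTreeGraded 𝓟) {γ : GeodesicFrom p} {Γ : PGeodesic r}
    (hi : Induces c γ Γ) (a : ℝ × ℝ) : a ∈ Γ.ivl ↔ ∃ A, PieceIvl 𝓟 γ.toFun γ.len A a.1 a.2 := by
  rw [hi.2.1, ← maximal_inOnePiece_iff h γ.isGeodesic]
  rfl

theorem Induces.pt_eq (h : IsTreeGraded 𝓟) {γ : GeodesicFrom p} {Γ : PGeodesic r}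
    (hi : Induces c γ Γ) {A : Set X} {u v : ℝ} (hA : PieceIvl 𝓟 γ.toFun γ.len A u v) :
    Γ.pt (u, v) = ⟨c.idx A hA.mem ⟨γ.toFun u, hA.left_mem⟩,
      c.iso A hA.mem ⟨γ.toFun u, hA.left_mem⟩ ⟨γ.toFun v, hA.right_mem⟩⟩ := by
  obtain ⟨B, hB, hx, hy, -, heq⟩ := hi.2.2 (u, v) ((hi.mem_ivl_iff h (u, v)).2 ⟨A, hA⟩)
  obtain rfl := h.piece_eq hA.mem hB (hA.ne γ.isGeodesic) hA.left_mem hA.right_mem hx hy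
  exact heq

/-- The chart used for the interval `[u, v]`. -/
theorem Induces.exists_chart (h : IsTreeGraded 𝓟) {γ : GeodesicFrom p} {Γ : PGeodesic r}
    (hi : Induces c γ Γ) {A : Set X} {u v : ℝ} (hA : PieceIvl 𝓟 γ.toFun γ.len A u v) :
    ∃ e : A ≃ᵢ P (Γ.pt (u, v)).1, e ⟨γ.toFun u, hA.left_mem⟩ = r _ ∧
      e ⟨γ.toFun v, hA.right_mem⟩ = (Γ.pt (u, v)).2 := by
  have := hi.pt_eq h hA
  generalize Γ.pt (u, v) = z at this
  subst this
  exact ⟨c.iso A hA.mem _, c.iso_base A hA.mem _, rfl⟩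

/-- On a time interval disjoint from all piece intervals the geodesic meets each piece at most once,
so it joins two distinct points of one transversal tree. -/
theorem dense_pieceIvl (h : IsTreeGraded 𝓟) (ht : TrivialTransversalTrees 𝓟) {γ : ℝ → X} {l : ℝ}
    (hγ : IsGeodesicOn γ l) (hl : 0 < l) : Icc 0 l ⊆
      closure (⋃ a ∈ {a : ℝ × ℝ | ∃ A, PieceIvl 𝓟 γ l A a.1 a.2}, Ico a.1 a.2) := by
  intro t htl
  rw [Metric.mem_closure_iff]
  intro ε hε
  by_contra hc
  push Not at hc
  obtain ⟨u, v, hu, huv, hv, hclose⟩ : ∃ u v, 0 ≤ u ∧ u < v ∧ v ≤ l ∧ ∀ τ ∈ Icc u v, dist t τ < ε := by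
    rcases htl.2.lt_or_eq with h1 | h1
    · refine ⟨t, min l (t + ε / 2), htl.1, lt_min h1 (by linarith), min_le_left _ _, fun τ hτ => ?_⟩
      have := hτ.2.trans (min_le_right _ _)
      rw [Real.dist_eq, abs_lt]
      exact ⟨by linarith, by linarith [hτ.1]⟩
    · refine ⟨max 0 (t - ε / 2), t, le_max_left _ _, max_lt (by linarith) (by linarith), htl.2,
        fun τ hτ => ?_⟩
      have := (le_max_right _ _).trans hτ.1
      rw [Real.dist_eq, abs_lt]
      exact ⟨by linarith [hτ.2], by linarith⟩
  have hseg : ∀ τ : unitInterval, u + τ * (v - u) ∈ Icc u v := fun τ => by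
    have h1 := mul_nonneg τ.2.1 (sub_nonneg.2 huv.le)
    have h2 := mul_le_mul_of_nonneg_right τ.2.2 (sub_nonneg.2 huv.le)
    exact ⟨by linarith, by linarith⟩
  have hseg' : ∀ τ : unitInterval, u + τ * (v - u) ∈ Icc 0 l := fun τ =>
    ⟨hu.trans (hseg τ).1, (hseg τ).2.trans hv⟩
  let σ : Path (γ u) (γ v) :=
    { toFun := fun τ => γ (u + τ * (v - u))
      continuous_toFun := hγ.continuousOn.comp_continuous (by fun_prop) hseg'
      source' := by simp
      target' := by simp }
  have hmeet : ∀ A ∈ 𝓟, ∀ a b, a ∈ Icc u v → b ∈ Icc u v → a < b → γ a ∈ A → γ b ∈ A → False := by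
    intro A hA a b ha hb hab haA hbA
    obtain ⟨u', v', hi, h1, h2⟩ := exists_pieceIvl h hγ hA (hu.trans ha.1) hab (hb.2.trans hv) haA hbA
    refine absurd (hclose a ha) (not_lt.2 (hc a ?_))
    simp only [mem_iUnion]
    exact ⟨(u', v'), ⟨A, hi⟩, h1, hab.trans_le h2⟩
  have hmem : γ v ∈ transversalTree 𝓟 (γ u) := by
    refine ⟨σ, fun A hA => ?_⟩
    rintro _ ⟨⟨a, rfl⟩, haA⟩ _ ⟨⟨b, rfl⟩, hbA⟩
    have haA' : γ (u + a * (v - u)) ∈ A := haA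
    have hbA' : γ (u + b * (v - u)) ∈ A := hbA
    change γ (u + a * (v - u)) = γ (u + b * (v - u))
    rcases lt_trichotomy (u + a * (v - u)) (u + b * (v - u)) with h1 | h1 | h1
    · exact (hmeet A hA _ _ (hseg a) (hseg b) h1 haA' hbA').elim
    · rw [h1]
    · exact (hmeet A hA _ _ (hseg b) (hseg a) h1 hbA' haA').elim
  rw [ht (γ u)] at hmem
  exact huv.ne' (hγ.injOn ⟨hu.trans huv.le, hv⟩ ⟨hu, huv.le.trans hv⟩ hmem)

theorem exists_induces (h : IsTreeGraded 𝓟) (ht : TrivialTransversalTrees 𝓟) (c : Charts 𝓟 r)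
    (hne : Nonempty (Σ i, P i)) (γ : GeodesicFrom p) : ∃ Γ : PGeodesic r, Induces c γ Γ := by
  have key : ∀ a : ℝ × ℝ, ∃ z : Σ i, P i, ∀ A, ∀ hi : PieceIvl 𝓟 γ.toFun γ.len A a.1 a.2,
      z = ⟨c.idx A hi.mem ⟨γ.toFun a.1, hi.left_mem⟩,
      c.iso A hi.mem ⟨γ.toFun a.1, hi.left_mem⟩ ⟨γ.toFun a.2, hi.right_mem⟩⟩ := by
    intro a
    by_cases hA : ∃ A, PieceIvl 𝓟 γ.toFun γ.len A a.1 a.2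
    · obtain ⟨A, hA⟩ := hA
      refine ⟨⟨c.idx A hA.mem ⟨γ.toFun a.1, hA.left_mem⟩,
        c.iso A hA.mem ⟨γ.toFun a.1, hA.left_mem⟩ ⟨γ.toFun a.2, hA.right_mem⟩⟩, fun B hB => ?_⟩
      obtain rfl := h.piece_eq hA.mem hB.mem (hA.ne γ.isGeodesic) hA.left_mem hA.right_mem
        hB.left_mem hB.right_mem
      rfl
    · exact ⟨hne.some, fun A hi => absurd ⟨A, hi⟩ hA⟩
  choose z hz using key
  refine ⟨{
    len := γ.len
    len_pos := γ.len_pos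
    ivl := {a | ∃ A, PieceIvl 𝓟 γ.toFun γ.len A a.1 a.2}
    nonneg := fun a ⟨A, hi⟩ => hi.nonneg
    lt := fun a ⟨A, hi⟩ => hi.lt
    le_len := fun a ⟨A, hi⟩ => hi.le
    disj := ?_
    dense := dense_pieceIvl h ht γ.isGeodesic γ.len_pos
    pt := z
    dist_pt := ?_ }, rfl, ?_, ?_⟩
  · rintro a ⟨A, hi⟩ b ⟨B, hj⟩ hab
    rw [Ico_disjoint_Ico]
    rcases (hi.hullPt hi.left_mem).compare h γ.isGeodesic (hj.hullPt hj.left_mem) with h1 | h1 | h1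
    · exact absurd (Prod.ext h1.1 h1.2) hab
    · exact (min_le_left _ _).trans (h1.trans (le_max_right _ _))
    · exact (min_le_right _ _).trans (h1.trans (le_max_left _ _))
  · rintro a ⟨A, hi⟩
    rw [hz a A hi]
    change dist (r (c.idx A hi.mem ⟨γ.toFun a.1, hi.left_mem⟩)) _ = _
    rw [← c.iso_base A hi.mem, (c.iso A hi.mem _).dist_eq, Subtype.dist_eq]
    exact γ.isGeodesic.dist_le hi.nonneg hi.lt.le hi.le
  · ext a
    exact (maximal_inOnePiece_iff h γ.isGeodesic a).symm
  · rintro a ⟨A, hi⟩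
    exact ⟨A, hi.mem, hi.left_mem, hi.right_mem, fun t ht => (hi.mem_iff t ⟨hi.nonneg.trans ht.1,
      ht.2.le.trans hi.le⟩).2 ⟨ht.1, ht.2.le⟩, hz a A hi⟩

theorem IsGate.eq_of_dist {A : Set X} {x e a w : X} (he : IsGate A x e) (ha : a ∈ A)
    (hw : Btw x w a) (hd : dist x w = dist x e) : w = e := by
  rcases he.2.2 a ha w hw with h | h
  · exact ((he.2.1 w h).eq_of_dist hd.symm).symm
  · exact h.eq_of_dist hd

/-- If a geodesic starts inside a piece then so does each geodesic with the same germ. -/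
theorem start_in_piece (h : IsTreeGraded 𝓟) {γ₁ γ₂ : GeodesicFrom p} (hs : SameGerm 𝓟 γ₁ γ₂)
    {A : Set X} {v : ℝ} (hi : PieceIvl 𝓟 γ₁.toFun γ₁.len A 0 v) :
    ∃ v', PieceIvl 𝓟 γ₂.toFun γ₂.len A 0 v' := by
  obtain ⟨m, hm, h1, h2, H⟩ :=
    IsTreeGraded.SameDir.common_piece h ((sameGerm_iff h γ₁ γ₂).1 hs)
  rw [γ₁.dist_eq γ₁.len_pos.le le_rfl] at h1
  rw [γ₂.dist_eq γ₂.len_pos.le le_rfl] at h2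
  have hpA : p ∈ A := by
    have := hi.left_mem
    rwa [γ₁.start] at this
  have hy0 : 0 < min m v := lt_min hm hi.lt
  have hy1 : min m v ≤ γ₁.len := (min_le_left _ _).trans h1
  have hy2 : min m v ≤ γ₂.len := (min_le_left _ _).trans h2
  obtain ⟨B, hB, hB1, hB2⟩ := H _ _ (γ₁.btw hy0.le hy1) (γ₂.btw hy0.le hy2)
    (by rw [γ₁.dist_eq hy0.le hy1]; exact min_le_left _ _)
    (by rw [γ₁.dist_eq hy0.le hy1, γ₂.dist_eq hy0.le hy2])
  have hyA : γ₁.toFun (min m v) ∈ A := (hi.mem_iff _ ⟨hy0.le, hy1⟩).2 ⟨hy0.le, min_le_right _ _⟩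
  -- If `p` is in `B`, then `B = A`. Otherwise `γ₂` passes through the gate of `p` in `B`, which is
  -- in `A` because it lies between `p` and a point of `A`.
  have : ∃ t, 0 < t ∧ t ≤ γ₂.len ∧ γ₂.toFun t ∈ A := by
    by_cases hpB : p ∈ B
    · rw [h.piece_eq hi.mem hB (γ₁.ne hy0 hy1).symm hpA hyA hpB hB1]
      exact ⟨_, hy0, hy2, hB2⟩
    · obtain ⟨e, he⟩ := h.exists_gate hB ⟨_, hB1⟩ p
      have hep : e ≠ p := fun hc => hpB (hc ▸ he.1)
      have hle := (he.2.1 _ hB2).dist_le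
      rw [γ₂.dist_eq hy0.le hy2] at hle
      have heA := h.piece_convex hi.mem hpA hyA (he.2.1 _ hB1)
      have hb := γ₂.isGeodesic.btw le_rfl dist_nonneg hle hy2
      rw [γ₂.start] at hb
      have heq := he.eq_of_dist hB2 hb (γ₂.dist_eq dist_nonneg (hle.trans hy2))
      exact ⟨dist p e, dist_pos.2 hep.symm, hle.trans hy2, by rwa [heq]⟩
  obtain ⟨t, ht0, htl, htA⟩ := this
  obtain ⟨u', v', hj, hu', -⟩ := exists_pieceIvl h γ₂.isGeodesic hi.mem le_rfl ht0 htl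
    (by rwa [γ₂.start]) htA
  rw [le_antisymm hu' hj.nonneg] at hj
  exact ⟨v', hj⟩

/-- Before a common point, geodesics from `p` pass through the same pieces. -/
theorem pieceIvl_of_common_point (h : IsTreeGraded 𝓟) {γ₁ γ₂ : GeodesicFrom p} {t : ℝ}
    (ht1 : t ≤ γ₁.len) (ht2 : t ≤ γ₂.len) (heq : γ₁.toFun t = γ₂.toFun t) {A : Set X} {u v : ℝ}
    (hi : PieceIvl 𝓟 γ₁.toFun γ₁.len A u v) (hu : 0 < u) (hv : v < t) :
    PieceIvl 𝓟 γ₂.toFun γ₂.len A u v ∧ γ₁.toFun u = γ₂.toFun u ∧ γ₁.toFun v = γ₂.toFun v := by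
  have hlt := hi.lt
  -- A transit point of `γ₁` before `t` separates `p` from the common point, so `γ₂` must pass
  -- through it, and at the same time.
  have key : ∀ τ, Transit 𝓟 γ₁.toFun γ₁.len τ → 0 < τ → τ < t → γ₁.toFun τ = γ₂.toFun τ := by
    intro τ hτ h0 h1
    have s1 := hτ.sep h γ₁.isGeodesic h0 (h1.trans_le ht1)
    have hne : γ₁.toFun t ≠ γ₁.toFun τ := fun hc =>
      h1.ne' (γ₁.isGeodesic.injOn ⟨(h0.trans h1).le, ht1⟩ hτ.1 hc)
    have s2 := h.sameDir_of_btw hne (γ₁.isGeodesic.btw h0.le h1.le ht1 le_rfl)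
    have s3 := h.sep_of_sep_sameDir s1 s2.symm
    obtain ⟨τ', hτ', hq⟩ := h.sep_mem_geodesic s3 (γ₂.isGeodesic.mono (h0.trans h1).le ht2)
      (γ₂.start.trans γ₁.start.symm) heq.symm
    rw [← hq]
    congr 1
    exact γ₂.isGeodesic.eq_time γ₁.isGeodesic (γ₂.start.trans γ₁.start.symm)
      ⟨hτ'.1, hτ'.2.trans ht2⟩ hτ.1 hq
  have hu' := key u (hi.transit_left h γ₁.isGeodesic) hu (hlt.trans hv)
  have hv' := key v (hi.transit_right h γ₁.isGeodesic) (hu.trans hlt) hv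
  have huA := hi.left_mem
  have hvA := hi.right_mem
  rw [hu'] at huA
  rw [hv'] at hvA
  obtain ⟨a, b, hj, ha, hb⟩ := exists_pieceIvl h γ₂.isGeodesic hi.mem hu.le hlt
    (hv.le.trans ht2) huA hvA
  refine ⟨?_, hu', hv'⟩
  have g1 := hi.gate_left h γ₁.isGeodesic le_rfl hu.le
  have g2 := hi.gate_right h γ₁.isGeodesic hv.le ht1
  have ha' : a = u := by
    refine le_antisymm ha ?_
    have := (g1.2.1 _ hj.left_mem).dist_le
    rwa [γ₁.start, γ₁.dist_eq hu.le (by linarith [hi.le]), γ₂.dist_eq hj.nonneg (by linarith [hj.lt, hj.le])]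
      at this
  have hb' : b = v := by
    refine le_antisymm ?_ hb
    by_contra hc
    rw [not_le] at hc
    have hw1 : v < min b t := lt_min hc hv
    have hw2 : min b t ≤ t := min_le_right _ _
    have hwA := (hj.mem_iff (min b t) ⟨by linarith, by linarith⟩).2
      ⟨by linarith, min_le_left _ _⟩
    have := (g2.2.1 _ hwA).dist_le
    rw [dist_comm, γ₁.isGeodesic.dist_le (by linarith) hv.le ht1, heq, dist_comm,
      γ₂.isGeodesic.dist_le (by linarith) hw2 ht2] at this
    linarith
  rwa [ha', hb'] at hj

theorem Charts.pt_congr (c : Charts 𝓟 r) {A : Set X} (hA : A ∈ 𝓟) {x x' y y' : A} (hx : x = x')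
    (hy : y = y') : (⟨c.idx A hA x, c.iso A hA x y⟩ : Σ i, P i) =
      ⟨c.idx A hA x', c.iso A hA x' y'⟩ := by
  subst hx; subst hy; rfl

/-- The pattern induced by a geodesic depends only on its germ. -/
theorem Induces.patternEq (h : IsTreeGraded 𝓟) {γ₁ γ₂ : GeodesicFrom p} {Γ₁ Γ₂ : PGeodesic r}
    (h1 : Induces c γ₁ Γ₁) (h2 : Induces c γ₂ Γ₂) (hs : SameGerm 𝓟 γ₁ γ₂) : PatternEq Γ₁ Γ₂ := by
  have start : ∀ {γ₁ γ₂ : GeodesicFrom p} {Γ₁ Γ₂ : PGeodesic r}, Induces c γ₁ Γ₁ →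
      Induces c γ₂ Γ₂ → SameGerm 𝓟 γ₁ γ₂ → (∃ q, (0, q) ∈ Γ₁.ivl) → PatternEq Γ₁ Γ₂ := by
    rintro γ₁ γ₂ Γ₁ Γ₂ h1 h2 hs ⟨q, hq⟩
    obtain ⟨A, hi⟩ := (h1.mem_ivl_iff h _).1 hq
    obtain ⟨q', hj⟩ := start_in_piece h hs hi
    refine Or.inl ⟨q, q', hq, (h2.mem_ivl_iff h _).2 ⟨A, hj⟩, ?_⟩
    rw [h1.pt_eq h hi, h2.pt_eq h hj]
    exact congrArg (c.idx A hi.mem) (Subtype.ext (γ₁.start.trans γ₂.start.symm))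
  have hsd := (sameGerm_iff h γ₁ γ₂).1 hs
  rcases Γ₁.start_cases with h3 | h3
  · exact start h1 h2 hs h3
  rcases Γ₂.start_cases with h4 | h4
  · exact (start h2 h1 ((sameGerm_iff h γ₂ γ₁).2 hsd.symm) h4).symm
  obtain ⟨m, hm, hm1, hm2, B, hB, hB1, hB2⟩ := hs
  -- Neither geodesic starts inside a piece, so the common piece `B` avoids `p`. Both geodesics then
  -- pass through the gate of `p` in `B`, and before this common point they traverse the same
  -- pieces.
  have hpB : p ∉ B := by
    intro hpB
    obtain ⟨u, v, hi, hu, -⟩ := exists_pieceIvl h γ₁.isGeodesic hB le_rfl hm hm1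
      (by rwa [γ₁.start]) hB1
    exact absurd (h3 (u, v) ((h1.mem_ivl_iff h _).2 ⟨B, hi⟩)) (not_lt.2 hu)
  obtain ⟨e, he⟩ := h.exists_gate hB ⟨_, hB1⟩ p
  have hep : e ≠ p := fun hc => hpB (hc ▸ he.1)
  have hle : dist p e ≤ m := by
    have := (he.2.1 _ hB1).dist_le
    rwa [γ₁.dist_eq hm.le hm1] at this
  have on_geod : ∀ γ : GeodesicFrom p, m ≤ γ.len → γ.toFun m ∈ B → γ.toFun (dist p e) = e := by
    intro γ hmγ hγB
    have hb := γ.isGeodesic.btw le_rfl dist_nonneg hle hmγ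
    rw [γ.start] at hb
    exact he.eq_of_dist hγB hb (γ.dist_eq dist_nonneg (hle.trans hmγ))
  have heq := (on_geod γ₁ hm1 hB1).trans (on_geod γ₂ hm2 hB2).symm
  have hpos : 0 < dist p e := dist_pos.2 hep.symm
  refine Or.inr ⟨h3, h4, dist p e / 2, by linarith, fun a ha => ⟨⟨fun hm => ?_, fun hm => ?_⟩,
    fun hm => ?_⟩⟩
  · obtain ⟨A, hi⟩ := (h1.mem_ivl_iff h _).1 hm
    exact (h2.mem_ivl_iff h _).2 ⟨A, (pieceIvl_of_common_point h (hle.trans hm1) (hle.trans hm2) heq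
      hi (h3 a hm) (by linarith)).1⟩
  · obtain ⟨A, hi⟩ := (h2.mem_ivl_iff h _).1 hm
    exact (h1.mem_ivl_iff h _).2 ⟨A, (pieceIvl_of_common_point h (hle.trans hm2) (hle.trans hm1)
      heq.symm hi (h4 a hm) (by linarith)).1⟩
  · obtain ⟨A, hi⟩ := (h1.mem_ivl_iff h _).1 hm
    obtain ⟨hj, hu, hv⟩ := pieceIvl_of_common_point h (hle.trans hm1) (hle.trans hm2) heq
      hi (h3 a hm) (by linarith)
    rw [show a = (a.1, a.2) from rfl, h1.pt_eq h hi, h2.pt_eq h hj]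
    exact c.pt_congr hi.mem (Subtype.ext hu) (Subtype.ext hv)

end Induced

/-! ### Branches from geodesics with matching patterns -/

section Match

variable {F G : Type u} [MetricSpace F] [MetricSpace G] {𝓕 : Set (Set F)} {𝓖 : Set (Set G)}
  {J : Type u} {Q : J → Type u} [∀ j, MetricSpace (Q j)] {s : ∀ j, Q j}
  {I : Type u} {P : I → Type u} [∀ i, MetricSpace (P i)] {r : ∀ i, P i} {k : ℝ}
  {c : Charts 𝓕 s} {c' : Charts 𝓖 r} {p : F × G}

theorem toward_of_time (hF : IsTreeGraded 𝓕) {o : F} (γ : GeodesicFrom o) {t : ℝ} (h0 : 0 < t)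
    (hl : t ≤ γ.len) : Toward (Quot.mk _ γ : Germ 𝓕 o) (γ.toFun t) :=
  Toward.of_sameDir hF ⟨γ, rfl, rfl⟩ (hF.sameDir_of_btw (γ.ne h0 hl) (γ.btw h0.le hl)).symm

/-- The set `Φ` is the graph of `f.map j` read in the two charts. -/
theorem exists_pieceMap (f : BilipFamily s r k) {A : Set F} {A' : Set G} {j : J} (e : A ≃ᵢ Q j)
    (e' : A' ≃ᵢ P (f.idx j)) : ∃ Φ : Set (F × G), PieceMap k A A' Φ ∧
      ∀ (x : A) (x' : A'), e' x' = f.map j (e x) → (x.1, x'.1) ∈ Φ := by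
  refine ⟨{a | ∃ (x : A) (x' : A'), e' x' = f.map j (e x) ∧ a = (x.1, x'.1)}, ⟨?_, ?_, ?_⟩,
    fun x x' h => ⟨x, x', h, rfl⟩⟩
  · ext x
    constructor
    · rintro ⟨_, ⟨x, x', -, rfl⟩, rfl⟩
      exact x.2
    · intro hx
      exact ⟨_, ⟨⟨x, hx⟩, e'.symm (f.map j (e ⟨x, hx⟩)), by simp, rfl⟩, rfl⟩
  · ext x'
    constructor
    · rintro ⟨_, ⟨x, x', -, rfl⟩, rfl⟩
      exact x'.2
    · intro hx'
      exact ⟨_, ⟨e.symm ((f.map j).symm (e' ⟨x', hx'⟩)), ⟨x', hx'⟩, by simp, rfl⟩, rfl⟩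
  · rintro _ ⟨x, x', hx, rfl⟩ _ ⟨y, y', hy, rfl⟩
    have h1 := f.bilip j (e x) (e y)
    rwa [← hx, ← hy, e.dist_eq, e'.dist_eq] at h1

/-- Cutting a geodesic at a transit time does not cut any piece interval. -/
theorem pieceIvl_restrict {γ : ℝ → F} {l m : ℝ} (ht : Transit 𝓕 γ l m) (A : Set F) (u v : ℝ) :
    PieceIvl 𝓕 γ m A u v ↔ PieceIvl 𝓕 γ l A u v ∧ v ≤ m := by
  constructor
  · intro hi
    refine ⟨⟨hi.mem, hi.nonneg, hi.lt, hi.le.trans ht.1.2, fun t htl => ?_⟩, hi.le⟩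
    rcases le_or_gt t m with h | h
    · exact hi.mem_iff t ⟨htl.1, h⟩
    · refine ⟨fun htA => ?_, fun htv => ?_⟩
      · exact (ht.2 A hi.mem u t hi.nonneg (hi.lt.trans_le hi.le) h htl.2 hi.left_mem htA).elim
      · exact absurd (htv.2.trans hi.le) (not_le.2 h)
  · rintro ⟨hi, hv⟩
    exact ⟨hi.mem, hi.nonneg, hi.lt, hv, fun t h => hi.mem_iff t ⟨h.1, h.2.trans ht.1.2⟩⟩

/-- The two alternatives of `PatternEq` give the two kinds of branches: a single pair of pieces, or
the pieces along initial segments that end with a common interval of the patterns. -/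
theorem exists_branch (hF : IsTreeGraded 𝓕) (hG : IsTreeGraded 𝓖) (f : BilipFamily s r k)
    {γ : GeodesicFrom p.1} {γ' : GeodesicFrom p.2} {Γ : PGeodesic s} {Γ' : PGeodesic r}
    (h1 : Induces c γ Γ) (h2 : Induces c' γ' Γ') (hΓ : PatternEq (stretchGeodesic f Γ) Γ') :
    ∃ x x' T, Toward (Quot.mk _ γ : Germ 𝓕 p.1) x ∧ Toward (Quot.mk _ γ' : Germ 𝓖 p.2) x' ∧
      Branch 𝓕 𝓖 k p x x' T := by
  rcases hΓ with ⟨q, q', ⟨a, ha, haq⟩, hq', hidx⟩ | ⟨h3, h4, y, hy, H⟩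
  · have ha0 : a.1 = 0 := by
      have := congrArg Prod.fst haq
      rw [newIvl_eq f Γ ha, ← stretchAll_zero f Γ] at this
      refine le_antisymm ?_ (Γ.nonneg a ha)
      exact (stretchAll_le_iff f Γ (Γ.nonneg a ha) le_rfl).1 this.le
    rw [← haq, stretchGeodesic_pt f Γ ha] at hidx
    obtain ⟨A, hi⟩ := (h1.mem_ivl_iff hF a).1 ha
    obtain ⟨A', hi'⟩ := (h2.mem_ivl_iff hG _).1 hq'
    obtain ⟨e, he, -⟩ := h1.exists_chart hF hi
    -- Equality of the indices makes the model space of `A'` the target of the map on the model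
    -- space of `A`.
    obtain ⟨e', he'⟩ : ∃ e' : A' ≃ᵢ P (f.idx (Γ.pt a).1), e' ⟨γ'.toFun 0, hi'.left_mem⟩ = r _ := by
      obtain ⟨e', he', -⟩ := h2.exists_chart hG hi'
      change f.idx (Γ.pt a).1 = _ at hidx
      rw [hidx]
      exact ⟨e', he'⟩
    obtain ⟨Φ, hΦ, hmem⟩ := exists_pieceMap f e e'
    have hbase := hmem _ _ (show e' ⟨γ'.toFun 0, hi'.left_mem⟩ = f.map _ (e ⟨_, hi.left_mem⟩) by
      rw [he, he', f.map_base])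
    simp only [ha0] at hbase
    rw [γ.start, γ'.start] at hbase
    have ha2 : 0 < a.2 := by have := hi.lt; rwa [ha0] at this
    exact ⟨γ.toFun a.2, γ'.toFun q', Φ, toward_of_time hF γ ha2 hi.le,
      toward_of_time hG γ' hi'.lt hi'.le, hΦ.branch hF hG f.one_le hi.mem hi'.mem hbase
        hi.right_mem hi'.right_mem (γ.ne ha2 hi.le) (γ'.ne hi'.lt hi'.le)⟩
  · -- choose an interval close to the origin
    obtain ⟨a, ha, hay⟩ : ∃ a ∈ Γ.ivl, (newIvl f Γ a).2 ≤ y := by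
      set Δ := stretchGeodesic f Γ
      obtain ⟨b, hb, z, -, hzx, hbz, -⟩ := Δ.exists_ivl_between le_rfl (lt_min hy Δ.len_pos)
        (min_le_right _ _)
      obtain ⟨d, hd, w, -, hwb, hdw, -⟩ := Δ.exists_ivl_between le_rfl (h3 b hb)
        ((Δ.lt b hb).le.trans (Δ.le_len b hb))
      have hby : b.1 < y := hbz.trans_lt (hzx.trans_le (min_le_left _ _))
      have hblt := Δ.lt b hb
      have hne : d ≠ b := by rintro rfl; linarith
      have hdb : d.2 ≤ b.1 := by
        rcases Δ.order hd hb hne with h | h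
        · exact h
        · linarith
      obtain ⟨a, ha, rfl⟩ := hd
      exact ⟨a, ha, hdb.trans hby.le⟩
    set σ := stretchAll f Γ with hσ
    have hnew : ∀ a ∈ Γ.ivl, newIvl f Γ a = (σ a.1, σ a.2) := fun a ha => newIvl_eq f Γ ha
    have ha0 := Γ.nonneg a ha
    have halt := Γ.lt a ha
    have ha2 : 0 < a.2 := ha0.trans_lt halt
    rw [hnew a ha] at hay
    -- Up to the right end of `a`, where both geodesics are cut, the pattern of `γ'` is the
    -- stretched pattern of `γ`.
    have corr : ∀ b ∈ Γ.ivl, b.2 ≤ a.2 → (σ b.1, σ b.2) ∈ Γ'.ivl ∧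
        Γ'.pt (σ b.1, σ b.2) = f.push (Γ.pt b) ∧ σ b.2 ≤ σ a.2 := by
      intro b hb hba
      have hle : σ b.2 ≤ σ a.2 :=
        (stretchAll_le_iff f Γ ((Γ.nonneg b hb).trans (Γ.lt b hb).le) ha2.le).2 hba
      have hm : (σ b.1, σ b.2) ∈ (stretchGeodesic f Γ).ivl := ⟨b, hb, hnew b hb⟩
      have := H (σ b.1, σ b.2) (hle.trans hay)
      refine ⟨this.1.1 hm, ?_, hle⟩
      rw [← this.2 hm, ← hnew b hb, stretchGeodesic_pt f Γ hb]
    obtain ⟨A₀, hi₀⟩ := (h1.mem_ivl_iff hF a).1 ha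
    obtain ⟨A₀', hi₀'⟩ := (h2.mem_ivl_iff hG _).1 (corr a ha le_rfl).1
    have htr := hi₀.transit_right hF γ.isGeodesic
    have htr' := hi₀'.transit_right hG γ'.isGeodesic
    have hpos' : 0 < σ a.2 := by
      rw [hσ, ← stretchAll_zero f Γ]
      exact stretchAll_lt f Γ le_rfl ha2
    have hex : ∀ u v, ∃ Φ : Set (F × G), ∀ A, PieceIvl 𝓕 γ.toFun a.2 A u v →
        ∃ A', PieceIvl 𝓖 γ'.toFun (σ a.2) A' (σ u) (σ v) ∧ PieceMap k A A' Φ ∧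
          (γ.toFun u, γ'.toFun (σ u)) ∈ Φ ∧ (γ.toFun v, γ'.toFun (σ v)) ∈ Φ := by
      intro u v
      by_cases hA : ∃ A, PieceIvl 𝓕 γ.toFun a.2 A u v
      swap
      · exact ⟨∅, fun A hA' => absurd ⟨A, hA'⟩ hA⟩
      obtain ⟨A, hi⟩ := hA
      obtain ⟨hi, hva⟩ := (pieceIvl_restrict htr A u v).1 hi
      have hm := (h1.mem_ivl_iff hF (u, v)).2 ⟨A, hi⟩
      obtain ⟨hm', hpt, hle⟩ := corr (u, v) hm hva
      obtain ⟨A', hi'⟩ := (h2.mem_ivl_iff hG _).1 hm'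
      obtain ⟨e, he1, he2⟩ := h1.exists_chart hF hi
      -- Charts based at the entrance points send these to the base points, and equality of the
      -- pattern values makes the exit points correspond under `f`.
      obtain ⟨e', he1', he2'⟩ : ∃ e' : A' ≃ᵢ P (f.idx (Γ.pt (u, v)).1),
          e' ⟨γ'.toFun (σ u), hi'.left_mem⟩ = r _ ∧
          e' ⟨γ'.toFun (σ v), hi'.right_mem⟩ = f.map _ (Γ.pt (u, v)).2 := by
        have := h2.exists_chart hG hi'
        simp only at this hpt
        rw [hpt] at this
        exact this
      obtain ⟨Φ, hΦ, hmem⟩ := exists_pieceMap f e e'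
      refine ⟨Φ, fun B hB => ?_⟩
      obtain ⟨hB, -⟩ := (pieceIvl_restrict htr B u v).1 hB
      obtain rfl := hF.piece_eq hi.mem hB.mem (hi.ne γ.isGeodesic) hi.left_mem hi.right_mem
        hB.left_mem hB.right_mem
      refine ⟨A', (pieceIvl_restrict htr' A' _ _).2 ⟨hi', hle⟩, hΦ, ?_, ?_⟩
      · exact hmem ⟨_, hi.left_mem⟩ ⟨_, hi'.left_mem⟩ (by rw [he1, he1', f.map_base])
      · exact hmem ⟨_, hi.right_mem⟩ ⟨_, hi'.right_mem⟩ (by rw [he2, he2'])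
    choose Φ hΦ using hex
    have M : GeodesicMatch 𝓕 𝓖 k γ.toFun a.2 γ'.toFun (σ a.2) σ Φ :=
      { one_le := f.one_le
        pos := ha2
        geodesic := γ.isGeodesic.mono ha2.le hi₀.le
        geodesic' := γ'.isGeodesic.mono hpos'.le hi₀'.le
        map_zero := stretchAll_zero f Γ
        map_last := rfl
        bilip := fun u v hu huv _ => stretchAll_bounds f Γ hu huv
        ivl := fun A u v hA => hΦ u v A hA
        ivl' := by
          intro A' u' v' hi'
          obtain ⟨hi', hv'⟩ := (pieceIvl_restrict htr' A' u' v').1 hi'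
          have hm' := (h2.mem_ivl_iff hG (u', v')).2 ⟨A', hi'⟩
          obtain ⟨b, hb, hbe⟩ := (H (u', v') (hv'.trans hay)).1.2 hm'
          rw [hnew b hb, Prod.mk.injEq] at hbe
          obtain ⟨B, hB⟩ := (h1.mem_ivl_iff hF b).1 hb
          refine ⟨B, b.1, b.2, (pieceIvl_restrict htr B _ _).2 ⟨hB, ?_⟩, hbe.1, hbe.2⟩
          rw [← hbe.2] at hv'
          exact (stretchAll_le_iff f Γ ((Γ.nonneg b hb).trans (Γ.lt b hb).le) ha2.le).1 hv' }
    have hb := M.branch hF hG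
    rw [γ.start, γ'.start] at hb
    exact ⟨_, _, _, toward_of_time hF γ ha2 hi₀.le, toward_of_time hG γ' hpos' hi₀'.le, hb⟩

end Match

/-! ### Surjectivity of the map on pattern classes -/

section PsiSurjective

variable {J : Type u} {Q : J → Type u} [∀ j, MetricSpace (Q j)] {s : ∀ j, Q j}
  {I : Type u} {P : I → Type u} [∀ i, MetricSpace (P i)] {r : ∀ i, P i} {k : ℝ}

/-- For each `i` an index `j` above it is chosen and `f.map j` is inverted; the inverse is
bilipschitz with the same `k`. -/
theorem BilipFamily.exists_rightInverse (f : BilipFamily s r k) (hf : Function.Surjective f.idx) :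
    ∃ g : BilipFamily r s k, ∀ z, f.push (g.push z) = z := by
  have h : ∀ i, ∃ (j : J) (e : P i ≃ Q j), e (r i) = s j ∧ IsBilipschitz k e ∧
      ∀ x, f.push ⟨j, e x⟩ = ⟨i, x⟩ := by
    intro i
    obtain ⟨j, rfl⟩ := hf i
    refine ⟨j, (f.map j).symm, ?_, fun x y => ?_, fun x => ?_⟩
    · rw [← f.map_base, Equiv.symm_apply_apply]
    · have hk : 0 < k := zero_lt_one.trans_le f.one_le
      have h1 := f.bilip j ((f.map j).symm x) ((f.map j).symm y)
      simp only [Equiv.apply_symm_apply] at h1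
      exact ⟨(inv_mul_le_iff₀ hk).2 h1.2, (inv_mul_le_iff₀ hk).1 h1.1⟩
    · simp [BilipFamily.push]
  choose j e h1 h2 h3 using h
  exact ⟨⟨j, e, h1, f.one_le, h2⟩, fun z => h3 z.1 z.2⟩

/-- As `t` is not interior to `b`, the interval counts either fully or not at all, on both sides. -/
theorem cutLen_newIvl (g : BilipFamily r s k) (Γ : PGeodesic r) {t : ℝ} (h0 : 0 ≤ t)
    (ht : ∀ a ∈ Γ.ivl, ¬ (a.1 < t ∧ t < a.2)) {b : ℝ × ℝ} (hb : b ∈ Γ.ivl) :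
    cutLen (newIvl g Γ b) (stretchAll g Γ t) =
      g.newLen (Γ.pt b) / (b.2 - b.1) * cutLen b t := by
  have hb0 := Γ.nonneg b hb
  have hlt := Γ.lt b hb
  rw [newIvl_eq g Γ hb]
  unfold cutLen
  simp only
  rcases le_or_gt b.2 t with h | h
  · rw [min_eq_left h, min_eq_left ((stretchAll_le_iff g Γ (hb0.trans hlt.le) h0).2 h),
      stretchAll_ivl g Γ hb, max_eq_right (g.newLen_pos Γ hb).le, max_eq_right (by linarith),
      div_mul_cancel₀ _ (by linarith)]
  · have h' : t ≤ b.1 := by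
      by_contra hc
      exact ht b hb ⟨not_le.1 hc, h⟩
    have h2 := (stretchAll_le_iff g Γ h0 hb0).2 h'
    rw [max_eq_left (b := min b.2 t - b.1) (by linarith [min_le_right b.2 t]), mul_zero]
    exact max_eq_left (by linarith [min_le_right (stretchAll g Γ b.2) (stretchAll g Γ t)])

theorem hasSum_newIvl (g : BilipFamily r s k) (Γ : PGeodesic r) {φ ψ : ℝ × ℝ → ℝ} {m : ℝ}
    (h : HasSum (indicator (stretchGeodesic g Γ).ivl φ) m)
    (hφ : ∀ b ∈ Γ.ivl, φ (newIvl g Γ b) = ψ b) : HasSum (indicator Γ.ivl ψ) m := by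
  rw [← hasSum_subtype_iff_indicator] at h ⊢
  let E : Γ.ivl ≃ (stretchGeodesic g Γ).ivl := Equiv.Set.imageOfInjOn _ _ (newIvl_injOn g Γ)
  rw [← E.hasSum_iff] at h
  convert h using 1
  exact funext fun b => (hφ b.1 b.2).symm

/-- Stretching by `g` preserves the measure of the uncovered part (`e1`), and stretching by `f`
restores the original length of each interval (`e2`). -/
theorem stretchAll_stretchGeodesic {f : BilipFamily s r k} {g : BilipFamily r s k}
    (hfg : ∀ z, f.push (g.push z) = z) (Γ : PGeodesic r) {t : ℝ} (h0 : 0 ≤ t)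
    (ht : ∀ a ∈ Γ.ivl, ¬ (a.1 < t ∧ t < a.2)) :
    stretchAll f (stretchGeodesic g Γ) (stretchAll g Γ t) = t := by
  have hσ : 0 ≤ stretchAll g Γ t := by
    rw [← stretchAll_zero g Γ]
    exact (stretchAll_le_iff g Γ le_rfl h0).2 h0
  have hcut := fun b hb => cutLen_newIvl g Γ h0 ht (b := b) hb
  have e1 := (hasSum_newIvl g Γ (hasSum_cutLen _ hσ) hcut).unique (hasSum_stretchAll g Γ h0)
  have e2 := (hasSum_newIvl g Γ (hasSum_stretchAll f _ hσ) (ψ := fun b => cutLen b t)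
    (fun b hb => ?_)).unique (hasSum_cutLen Γ h0)
  · linarith
  · have hpos := g.newLen_pos Γ hb
    have hlt := Γ.lt b hb
    have hlen : f.newLen (g.push (Γ.pt b)) = b.2 - b.1 := by
      rw [← Γ.dist_pt b hb]
      conv_rhs => rw [← hfg (Γ.pt b)]
      rfl
    have hnew : (newIvl g Γ b).2 - (newIvl g Γ b).1 = g.newLen (Γ.pt b) := by
      rw [newIvl_eq g Γ hb]
      exact stretchAll_ivl g Γ hb
    rw [hcut b hb, stretchGeodesic_pt g Γ hb, hlen, hnew]
    field_simp [hpos.ne', (sub_pos.2 hlt).ne']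

theorem stretchGeodesic_stretchGeodesic {f : BilipFamily s r k} {g : BilipFamily r s k}
    (hfg : ∀ z, f.push (g.push z) = z) (Γ : PGeodesic r) :
    SameInitialPattern (stretchGeodesic f (stretchGeodesic g Γ)) Γ := by
  have hnew : ∀ a ∈ Γ.ivl, newIvl f (stretchGeodesic g Γ) (newIvl g Γ a) = a := by
    intro a ha
    rw [newIvl_eq f _ (mem_image_of_mem _ ha), newIvl_eq g Γ ha]
    exact Prod.ext (stretchAll_stretchGeodesic hfg Γ (Γ.nonneg a ha) (Γ.fst_notInterior ha))
      (stretchAll_stretchGeodesic hfg Γ ((Γ.nonneg a ha).trans (Γ.lt a ha).le)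
        (Γ.snd_notInterior ha))
  have hpt : ∀ a ∈ Γ.ivl, (stretchGeodesic f (stretchGeodesic g Γ)).pt a = Γ.pt a := by
    intro a ha
    have := stretchGeodesic_pt f (stretchGeodesic g Γ) (mem_image_of_mem (newIvl g Γ) ha)
    rwa [hnew a ha, stretchGeodesic_pt g Γ ha, hfg] at this
  have hivl : (stretchGeodesic f (stretchGeodesic g Γ)).ivl = Γ.ivl := by
    ext a
    constructor
    · rintro ⟨_, ⟨b, hb, rfl⟩, rfl⟩
      rwa [hnew b hb]
    · intro ha
      exact ⟨_, mem_image_of_mem _ ha, hnew a ha⟩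
  -- The patterns agree everywhere, so any positive time would do.
  refine ⟨1, one_pos, by rw [hivl], fun a ha _ => hpt a (hivl ▸ ha), fun a ha h1 h2 => ?_⟩
  rw [hivl] at ha
  exact ⟨a, ha, h1, h2, by rw [hpt a ha]⟩

theorem psi_surjective (f : BilipFamily s r k) (hf : Function.Surjective f.idx) :
    Function.Surjective (psi f) := by
  obtain ⟨g, hg⟩ := f.exists_rightInverse hf
  rintro ⟨Γ⟩
  exact ⟨Quot.mk _ (stretchGeodesic g Γ), Quot.sound (stretchGeodesic_stretchGeodesic hg Γ)⟩

end PsiSurjective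

/-! ### Matching germs by counting -/

section Count

theorem mk_diff_of_finite {A : Type u} {X S : Set A} (hX : Cardinal.aleph0 ≤ Cardinal.mk X)
    (hS : S.Finite) : Cardinal.mk (X \ S : Set A) = Cardinal.mk X := by
  refine le_antisymm (Cardinal.mk_le_mk_of_subset sdiff_subset) ?_
  have h1 := Cardinal.le_mk_sdiff_add_mk X S
  have hlt : Cardinal.mk S < Cardinal.aleph0 := Cardinal.lt_aleph0_iff_set_finite.2 hS
  by_contra hc
  exact absurd h1 (not_le.2 (Cardinal.add_lt_of_lt hX (not_le.1 hc) (hlt.trans_le hX)))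

/-- Maps between the fibres of `u` and `v`, away from finite sets. -/
theorem exists_fibrewise {A B D : Type u} (u : A → D) (v : B → D) {surj : Prop}
    (hinf : ∀ d, Cardinal.aleph0 ≤ Cardinal.mk {b | v b = d})
    (hle : ∀ d, Cardinal.mk {a | u a = d} ≤ Cardinal.mk {b | v b = d})
    (heq : surj → ∀ d, Cardinal.mk {a | u a = d} = Cardinal.mk {b | v b = d})
    {S : Set A} {S' : Set B} (hS : S.Finite) (hS' : S'.Finite) :
    ∃ β : A → B, InjOn β Sᶜ ∧ MapsTo β Sᶜ S'ᶜ ∧ (surj → SurjOn β Sᶜ S'ᶜ) ∧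
      ∀ a ∈ Sᶜ, v (β a) = u a := by
  have key : ∀ d, ∃ i : ({a | u a = d} \ S : Set A) → ({b | v b = d} \ S' : Set B),
      Function.Injective i ∧ (surj → Function.Surjective i) := by
    intro d
    by_cases hs : surj
    · have h : Cardinal.mk ({a | u a = d} \ S : Set A) = Cardinal.mk ({b | v b = d} \ S' : Set B) := by
        rw [mk_diff_of_finite (heq hs d ▸ hinf d) hS, mk_diff_of_finite (hinf d) hS', heq hs d]
      obtain ⟨e⟩ := Cardinal.eq.1 h
      exact ⟨e, e.injective, fun _ => e.surjective⟩
    · have h : Cardinal.mk ({a | u a = d} \ S : Set A) ≤ Cardinal.mk ({b | v b = d} \ S' : Set B) := by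
        rw [mk_diff_of_finite (hinf d) hS']
        exact (Cardinal.mk_le_mk_of_subset sdiff_subset).trans (hle d)
      obtain ⟨e⟩ := (Cardinal.le_def _ _).1 h
      exact ⟨e, e.injective, fun h => absurd h hs⟩
  choose i hi1 hi2 using key
  have hB : ∀ a : A, ∃ b, v b = u a := fun a => by
    have : Cardinal.mk {b | v b = u a} ≠ 0 :=
      (Cardinal.aleph0_pos.trans_le (hinf (u a))).ne'
    obtain ⟨b⟩ := Cardinal.mk_ne_zero_iff.1 this
    exact ⟨b.1, b.2⟩
  classical
  -- The values on `S` are irrelevant; outside `S` the map is assembled from the maps between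
  -- fibres.
  let β : A → B := fun a => if h : a ∈ S then (hB a).choose else (i (u a) ⟨a, rfl, h⟩).1
  have hi : ∀ d a (h : u a = d) (hS : a ∉ S), (i (u a) ⟨a, rfl, hS⟩).1 = (i d ⟨a, h, hS⟩).1 := by
    rintro _ a rfl hS
    rfl
  have hβ : ∀ a (h : a ∉ S), β a = (i (u a) ⟨a, rfl, h⟩).1 := fun a h => dif_neg h
  have hv : ∀ a ∈ Sᶜ, v (β a) = u a := fun a ha => by
    rw [hβ a ha]
    exact (i (u a) ⟨a, rfl, ha⟩).2.1
  refine ⟨β, fun a ha b hb hab => ?_, fun a ha => ?_, fun hs b hb => ?_, hv⟩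
  · have hu : u a = u b := by rw [← hv a ha, ← hv b hb, hab]
    rw [hβ a ha, hβ b hb, hi _ b hu.symm hb] at hab
    exact congrArg Subtype.val (hi1 _ (Subtype.ext hab))
  · rw [hβ a ha]
    exact (i (u a) ⟨a, rfl, ha⟩).2.2
  · obtain ⟨⟨a, ha, haS⟩, hab⟩ := hi2 (v b) hs ⟨b, rfl, hb⟩
    refine ⟨a, haS, ?_⟩
    rw [hβ a haS, hi _ a ha haS, hab]

end Count

section GermClass

variable {X : Type u} [MetricSpace X] {𝓟 : Set (Set X)}
  {I : Type u} {P : I → Type u} [∀ i, MetricSpace (P i)] {r : ∀ i, P i} {p : X}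

/-- The map from germs to pattern classes whose fibres are counted by `germCount`. -/
theorem exists_germClass (h : IsTreeGraded 𝓟) (ht : TrivialTransversalTrees 𝓟) (c : Charts 𝓟 r)
    (hne : Nonempty (Σ i, P i)) : ∃ w : Germ 𝓟 p → PatternClass r,
      (∀ y, ∃ γ Γ, y = Quot.mk _ γ ∧ Induces c γ Γ ∧ w y = Quot.mk _ Γ) ∧
      ∀ x, germCount c p x = Cardinal.mk {y | w y = x} := by
  choose Γ hΓ using fun γ : GeodesicFrom p => exists_induces h ht c hne γ
  let w : Germ 𝓟 p → PatternClass r := Quot.lift (fun γ => Quot.mk _ (Γ γ)) fun γ₁ γ₂ hs =>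
    patternClass_eq_iff.2 ((hΓ γ₁).patternEq h (hΓ γ₂) hs)
  refine ⟨w, ?_, fun x => ?_⟩
  · rintro ⟨γ⟩
    exact ⟨γ, Γ γ, rfl, hΓ γ, rfl⟩
  · unfold germCount
    congr 1
    refine congrArg Subtype (funext fun y => propext ⟨?_, ?_⟩)
    -- The P-geodesic in the definition of the count may differ from the chosen one, but both are
    -- induced by `γ`, so their classes agree.
    · rintro ⟨γ, Γ', rfl, h1, rfl⟩
      exact patternClass_eq_iff.2 ((hΓ γ).patternEq h h1
        ((sameGerm_iff h γ γ).2 (h.sameDir_refl (γ.ne γ.len_pos le_rfl))))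
    · rintro rfl
      obtain ⟨γ⟩ := y
      exact ⟨γ, Γ γ, rfl, hΓ γ, rfl⟩

end GermClass

/-! ### From the germ counts to matched germs. -/

section Final

variable {F G : Type u} [MetricSpace F] [MetricSpace G] {𝓕 : Set (Set F)} {𝓖 : Set (Set G)}
  {J : Type u} {Q : J → Type u} [∀ j, MetricSpace (Q j)] {s : ∀ j, Q j}
  {I : Type u} {P : I → Type u} [∀ i, MetricSpace (P i)] {r : ∀ i, P i} {k : ℝ}

theorem mk_fibre_comp {A : Type u} {E D : Type u} (w : A → E) (ψ : E → D) (d : D) :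
    Cardinal.mk {a | ψ (w a) = d} =
      Cardinal.sum fun x' : {x' : E // ψ x' = d} => Cardinal.mk {a | w a = x'.1} := by
  rw [← Cardinal.mk_sigma]
  refine Cardinal.mk_congr ⟨fun a => ⟨⟨w a.1, a.2⟩, ⟨a.1, rfl⟩⟩, fun z => ⟨z.2.1, ?_⟩,
    fun a => rfl, ?_⟩
  · have := z.2.2
    simp only [mem_ofPred_eq] at this ⊢
    rw [this]
    exact z.1.2
  · rintro ⟨⟨x, h⟩, ⟨a, ha⟩⟩
    have ha' : w a = x := ha
    subst ha'
    rfl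

/-- The sum over a fibre of `psi f` counts the germs at `p.1` whose class is sent to a given class
(`mk_fibre_comp`). The hypotheses thus compare the fibres of two maps into `PatternClass r`, as
`exists_fibrewise` requires, and germs in corresponding fibres carry branches. -/
theorem matched_of_germCount (hF : IsTreeGraded 𝓕) (hFt : TrivialTransversalTrees 𝓕)
    (hG : IsTreeGraded 𝓖) (hGt : TrivialTransversalTrees 𝓖) (f : BilipFamily s r k)
    (hf : Function.Surjective f.idx) (hne : Nonempty (Σ j, Q j)) {surj : Prop} {p : F × G}
    (c : Charts 𝓕 s) (c' : Charts 𝓖 r) (hinf : ∀ d, Cardinal.aleph0 ≤ germCount c' p.2 d)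
    (hle : ∀ x : PatternClass s, Cardinal.sum (fun x' : {x' : PatternClass s // psi f x' = psi f x} =>
      germCount c p.1 x'.1) ≤ germCount c' p.2 (psi f x))
    (heq : surj → ∀ x : PatternClass s,
      Cardinal.sum (fun x' : {x' : PatternClass s // psi f x' = psi f x} =>
        germCount c p.1 x'.1) = germCount c' p.2 (psi f x)) :
    Matched 𝓕 𝓖 k surj p := by
  intro S S' hS hS'
  obtain ⟨w, hw, hwc⟩ := exists_germClass (p := p.1) hF hFt c hne
  obtain ⟨v, hv, hvc⟩ := exists_germClass (p := p.2) hG hGt c' (hne.map f.push)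
  simp only [hwc, hvc, ← mk_fibre_comp w (psi f)] at hinf hle heq
  obtain ⟨β, h1, h2, h3, h4⟩ := exists_fibrewise (fun y => psi f (w y)) v hinf
    (fun d => by obtain ⟨x, rfl⟩ := psi_surjective f hf d; exact hle x)
    (fun hs d => by obtain ⟨x, rfl⟩ := psi_surjective f hf d; exact heq hs x) hS hS'
  refine ⟨β, h1, h2, h3, fun g hg => ?_⟩
  have h5 := h4 g hg
  obtain ⟨γ, Γ, hγ, hΓ, hwΓ⟩ := hw g
  obtain ⟨γ', Γ', hγ', hΓ', hvΓ⟩ := hv (β g)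
  rw [hwΓ, hvΓ] at h5
  rw [hγ', hγ]
  exact exists_branch hF hG f hΓ hΓ' (patternClass_eq_iff.1 h5.symm)

end Final

end TreeGr

end

theorem mainTheorem6 {I J : Type u}
    {P : I → Type u} [∀ i, MetricSpace (P i)] (r : ∀ i, P i)
    (hP_complete : ∀ i, CompleteSpace (P i))
    (hP_geodesic : ∀ i, TreeGr.IsGeodesicSet (Set.univ : Set (P i)))
    (hP_homogeneous : ∀ i, TreeGr.IsHomogeneous (P i))
    (hP_nontrivial : ∀ i, Nontrivial (P i))
    (hP_distinct : ∀ i i', i ≠ i' → IsEmpty (P i ≃ᵢ P i'))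
    {Q : J → Type u} [∀ j, MetricSpace (Q j)] (s : ∀ j, Q j)
    (hQ_complete : ∀ j, CompleteSpace (Q j))
    (hQ_geodesic : ∀ j, TreeGr.IsGeodesicSet (Set.univ : Set (Q j)))
    (hQ_homogeneous : ∀ j, TreeGr.IsHomogeneous (Q j))
    (k : ℝ) (f : TreeGr.BilipFamily s r k) (hf : Function.Surjective f.idx)
    (α : TreeGr.PatternClass r → Cardinal.{u}) (hα : ∀ w, Cardinal.aleph0 ≤ α w)
    {G : Type u} [MetricSpace G] (𝓖 : Set (Set G)) (hG : TreeGr.IsUniversal r α 𝓖)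
    {F : Type u} [MetricSpace F] [Nonempty F] (𝓕 : Set (Set F))
    (hF : TreeGr.IsTreeGraded 𝓕) (hF_homogeneous : TreeGr.IsHomogeneous F)
    (hF_trees : TreeGr.TrivialTransversalTrees 𝓕)
    (hF_pieces : ∀ A ∈ 𝓕, ∃ j, Nonempty (A ≃ᵢ Q j)) :
    ((∀ p : F, ∃ c : TreeGr.Charts 𝓕 s, ∀ x : TreeGr.PatternClass s,
        Cardinal.sum (fun x' : {x' : TreeGr.PatternClass s // TreeGr.psi f x' = TreeGr.psi f x} =>
          TreeGr.germCount c p x'.1) ≤ α (TreeGr.psi f x)) →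
      ∃ h : F → G, TreeGr.IsBilipschitz k h) ∧
    ((∀ p : F, ∃ c : TreeGr.Charts 𝓕 s, ∀ x : TreeGr.PatternClass s,
        Cardinal.sum (fun x' : {x' : TreeGr.PatternClass s // TreeGr.psi f x' = TreeGr.psi f x} =>
          TreeGr.germCount c p x'.1) = α (TreeGr.psi f x)) →
      ∃ h : F ≃ G, TreeGr.IsBilipschitz k h) := by
  have := hG.nonempty
  have hne : Nonempty (Σ j, Q j) := by
    obtain ⟨p⟩ := ‹Nonempty F›
    obtain ⟨A, hA, -⟩ : p ∈ ⋃₀ 𝓕 := hF.cover ▸ Set.mem_univ p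
    obtain ⟨j, -⟩ := hF_pieces A hA
    exact ⟨⟨j, s j⟩⟩
  constructor
  · intro H
    -- For an embedding only the directions in `F` have to be exhausted.
    obtain ⟨h, hh, -⟩ := TreeGr.exists_bilipschitz_of_matched (surj := False) hF hG.treeGraded
      f.one_le fun p => by
        obtain ⟨c, hc⟩ := H p.1
        obtain ⟨c', hc'⟩ := hG.germCount_eq p.2
        exact TreeGr.matched_of_germCount hF hF_trees hG.treeGraded hG.trivial_trees f hf hne c c'
          (fun d => hc' d ▸ hα d) (fun x => hc' (TreeGr.psi f x) ▸ hc x) False.elim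
    exact ⟨h, hh⟩
  · intro H
    obtain ⟨h, hh, hi, hs⟩ := TreeGr.exists_bilipschitz_of_matched (surj := True) hF hG.treeGraded
      f.one_le fun p => by
        obtain ⟨c, hc⟩ := H p.1
        obtain ⟨c', hc'⟩ := hG.germCount_eq p.2
        have heq := fun x => (hc x).trans (hc' (TreeGr.psi f x)).symm
        exact TreeGr.matched_of_germCount hF hF_trees hG.treeGraded hG.trivial_trees f hf hne c c'
          (fun d => hc' d ▸ hα d) (fun x => (heq x).le) fun _ => heq
    exact ⟨Equiv.ofBijective h ⟨hi, hs trivial⟩, hh⟩
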